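/- **Setting.** Let $\Omega\subset\mathbb R^3$ be an open, bounded, contractible domain with polyhedral Lipschitz boundary and $\mathcal T_H$ a partition of $\Omega$ into closed tetrahedra, $\bigcup\mathcal T_H=\overline\Omega$, any two of which are disjoint or share a common vertex, edge or face. All functions are complex-valued; $(\cdot,\cdot)$ is the $L^2$ inner product, linear in its first entry. $H_0(\mathrm{curl})$ is the space of fields in $H(\mathrm{curl},\Omega)$ with vanishing tangential trace (the closure of $C_c^\infty(\Omega;\mathbb C^3)$), normed by $\|v\|_{H(\mathrm{curl})}^2=\|\mathrm{curl}\,v\|_{L^2}^2+\|v\|_{L^2}^2$. Let $\mu\in L^\infty(\Omega;\mathbb R^{3\times3})$ and $\kappa\in L^\infty(\Omega;\mathbb C^{3\times3})$ be such that $$\mathcal B(v,\psi):=(\mu\,\mathrm{curl}\,v,\mathrm{curl}\,\psi)+(\kappa v,\psi)$$ is $H_0(\mathrm{curl})$-elliptic: there is $\alpha>0$ with $|\mathcal B(v,v)|\ge\alpha\|v\|_{H(\mathrm{curl})}^2$ for all $v\in H_0(\mathrm{curl})$. Let $f\in H(\mathrm{div},\Omega)$ and let $u\in H_0(\mathrm{curl})$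 solve $\mathcal B(u,\psi)=(f,\psi)$ for all $\psi\in H_0(\mathrm{curl})$. Let $$\mathring{\mathcal N}(\mathcal T_H):=\{v\in H_0(\mathrm{curl}) : \forall T\in\mathcal T_H\ \exists a_T,b_T\in\mathbb C^3:\ v|_T(x)=a_T\times x+b_T\}.$$ **The Falk–Winther operator $\pi_H^E:H_0(\mathrm{curl})\to\mathring{\mathcal N}(\mathcal T_H)$.** An edge is interior if it is not contained in $\partial\Omega$. Orient each edge $E$ from an endpoint $y_1(E)$ to $y_2(E)$, with unit tangent $t_E$ and length $|E|$. Let $(\psi_E)$, $E$ interior, be the basis of $\mathring{\mathcal N}(\mathcal T_H)$ with $|E'|^{-1}\int_{E'}\psi_E\cdot t_{E'}\,ds=\delta_{EE'}$ for interior $E'$. For a vertex $z$ let $\omega_z$ be the interior of the union of the tetrahedra containing $z$, and for an interior edge $E$ let $\omega_E:=\omega_{y_1(E)}\cup\omega_{y_2(E)}$. For $\omega$ equal to $\omega_z$ or $\omega_E$, let $\mathcal S^1(\omega)$ be the space of continuous functions on $\omega$ that are affine on each tetrahedron of the patch, and $\mathcal N(\omega)$ the space of fields in $H(\mathrm{curl},\omega)$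 of the form $x\mapsto a_T\times x+b_T$ on each tetrahedron $T$ of the patch. * $Q_E^1v\in\mathcal N(\omega_E)$ is defined by $(v-Q_E^1v,\nabla\tau)_{L^2(\omega_E)}=0$ for all $\tau\in\mathcal S^1(\omega_E)$ and $(\mathrm{curl}(v-Q^1_Ev),\mathrm{curl}\,w)_{L^2(\omega_E)}=0$ for all $w\in\mathcal N(\omega_E)$. * For an interior vertex $y$ (one lying in $\Omega$), $Q^1_{y,-}v\in\mathcal S^1(\omega_y)$ has mean zero over $\omega_y$ and satisfies $(v-\nabla Q^1_{y,-}v,\nabla\tau)_{L^2(\omega_y)}=0$ for all $\tau\in\mathcal S^1(\omega_y)$. * $z^1_E$ is the lowest-order Raviart–Thomas field on the mesh of $\omega_E$ with vanishing normal trace on $\partial\omega_E$ such that $\mathrm{div}\,z^1_E=-\bigl(|\omega_{y_2(E)}|^{-1}\mathbf 1_{\omega_{y_2(E)}}-|\omega_{y_1(E)}|^{-1}\mathbf 1_{\omega_{y_1(E)}}\bigr)$ and $(z_E^1,\mathrm{curl}\,\tau)_{L^2(\omega_E)}=0$ for all $\tau\in\mathcal N(\omega_E)\cap H_0(\mathrm{curl},\omega_E)$.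 * $S^1v:=\sum_E|E|^{-1}\int_{\omega_E}v\cdot z^1_E\,dx\ \psi_E+\sum_{y}(Q^1_{y,-}v)(y)\,\nabla\lambda_y$, where $E$ runs over the interior edges, $y$ over the interior vertices, and $\lambda_y$ is the nodal hat function at $y$. The coefficient of $\psi_E$ in $S^1v$ depends only on $v|_{\omega_E}$. Then $\pi_H^Ev:=S^1v+\sum_E|E|^{-1}\int_E\bigl((\mathrm{id}-S^1)Q^1_Ev\bigr)\cdot t_E\,ds\ \psi_E$, the sum running over the interior edges. **Correctors.** Let $W:=\ker\pi_H^E\subset H_0(\mathrm{curl})$ and $\mathcal L:H_0(\mathrm{curl})\to H_0(\mathrm{curl})'$, $\mathcal L(v)(w)=\mathcal B(v,w)$. For $F\in H_0(\mathrm{curl})'$ let $\mathcal G(F)\in W$ be the solution of $\mathcal B(\mathcal G(F),w)=F(w)$ for all $w\in W$. Put $\mathcal K:=-\mathcal G\circ\mathcal L$, and let $\mathcal K^*$ be its adjoint with respect to $\mathcal B$, that is, $\mathcal B(\mathcal Kv,w)=\mathcal B(v,\mathcal K^*w)$ for all $v,w\in H_0(\mathrm{curl})$. **Theorem.** The coarse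 part $u_H:=\pi_H^E(u)$ is the unique element of $\mathring{\mathcal N}(\mathcal T_H)$ such that $$\mathcal B\bigl((\mathrm{id}+\mathcal K)u_H,(\mathrm{id}+\mathcal K^*)v_H\bigr)=\bigl(f,(\mathrm{id}+\mathcal K^*)v_H\bigr)\qquad\text{for all }v_H\in\mathring{\mathcal N}(\mathcal T_H).$$ The form $\mathcal B\bigl((\mathrm{id}+\mathcal K)\,\cdot\,,(\mathrm{id}+\mathcal K^*)\,\cdot\,\bigr)$ is sesquilinear and $H(\mathrm{curl})$-elliptic on $\mathring{\mathcal N}(\mathcal T_H)$: there is $\alpha'>0$ with $$\bigl|\mathcal B\bigl((\mathrm{id}+\mathcal K)v_H,(\mathrm{id}+\mathcal K^*)v_H\bigr)\bigr|\ge\alpha'\|v_H\|_{H(\mathrm{curl})}^2\qquad\text{for all }v_H\in\mathring{\mathcal N}(\mathcal T_H).$$ -/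

import Mathlib

open MeasureTheory
open scoped ContDiff ENNReal NNReal

noncomputable section

namespace CurlLOD

/-! ### Vector calculus and weak derivatives -/

abbrev R3 := EuclideanSpace ℝ (Fin 3)

abbrev C3 := EuclideanSpace ℂ (Fin 3)

/-- The inclusion of `ℝ³` into `ℂ³`. -/
def toC (x : R3) : C3 := WithLp.toLp 2 fun i => (x i : ℂ)

/-- The bilinear (unconjugated) product on `ℂ³`. -/
def dot (a b : C3) : ℂ := ∑ i, a i * b i

/-- The vector product on `ℂ³`. -/
def cross (a b : C3) : C3 :=
  !₂[a 1 * b 2 - a 2 * b 1, a 2 * b 0 - a 0 * b 2, a 0 * b 1 - a 1 * b 0]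

/-- The `i`-th partial derivative. -/
def pd (i : Fin 3) (f : R3 → ℂ) (x : R3) : ℂ := fderiv ℝ f x (EuclideanSpace.single i 1)

def grad (f : R3 → ℂ) (x : R3) : C3 := WithLp.toLp 2 fun i => pd i f x

def divergence (v : R3 → C3) (x : R3) : ℂ := ∑ i, pd i (fun y => v y i) x

def curl (v : R3 → C3) (x : R3) : C3 :=
  !₂[pd 1 (fun y => v y 2) x - pd 2 (fun y => v y 1) x,
     pd 2 (fun y => v y 0) x - pd 0 (fun y => v y 2) x,
     pd 0 (fun y => v y 1) x - pd 1 (fun y => v y 0) x]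

/-- `φ` is a smooth function with compact support in `G`. -/
structure IsTest {F : Type*} [NormedAddCommGroup F] [NormedSpace ℝ F]
    (G : Set R3) (φ : R3 → F) : Prop where
  smooth : ContDiff ℝ ∞ φ
  compact : HasCompactSupport φ
  supp : tsupport φ ⊆ G

/-- `w` is the weak curl of `v` on `G`. -/
def IsWeakCurl (G : Set R3) (v w : R3 → C3) : Prop :=
  ∀ φ : R3 → C3, IsTest G φ → ∫ x in G, dot (v x) (curl φ x) = ∫ x in G, dot (w x) (φ x)

/-- `d` is the weak divergence of `v` on `G`. -/
def IsWeakDiv (G : Set R3) (v : R3 → C3) (d : R3 → ℂ) : Prop :=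
  ∀ φ : R3 → ℂ, IsTest G φ → ∫ x in G, dot (v x) (grad φ x) = -∫ x in G, d x * φ x

/-! ### The spaces `H(curl)`, `H₀(curl)`, `H(div)`, `H₀(div)`

A field `v` of `H(curl, G)` is represented by the pair `(v, curl v)` in `L² × L²`, a field of
`H(div, G)` by `(v, div v)`; the norm of the Hilbert sum is then the graph norm. -/

abbrev L2V (G : Set R3) := Lp C3 2 (volume.restrict G)

abbrev L2S (G : Set R3) := Lp ℂ 2 (volume.restrict G)

abbrev CurlPair (G : Set R3) := WithLp 2 (L2V G × L2V G)

abbrev DivPair (G : Set R3) := WithLp 2 (L2V G × L2S G)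

theorem integrable_dot {m : Measure R3} {v g : R3 → C3} (hv : MemLp v 2 m) (hg : MemLp g 2 m) :
    Integrable (fun x => dot (v x) (g x)) m := by
  unfold dot
  refine integrable_finsetSum _ fun i _ => ?_
  exact (hv.eval_piLp i).integrable_mul (hg.eval_piLp i)

theorem IsTest.memLp {F : Type*} [NormedAddCommGroup F] [NormedSpace ℝ F]
    {G : Set R3} {φ : R3 → F} (h : IsTest G φ) :
    MemLp φ 2 (volume.restrict G) :=
  (h.smooth.continuous.memLp_of_hasCompactSupport h.compact).restrict G

theorem memLp_pd {G : Set R3} {f : R3 → ℂ} (h : IsTest G f) (i : Fin 3) :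
    MemLp (pd i f) 2 (volume.restrict G) := by
  have hc : Continuous (pd i f) :=
    (h.smooth.continuous_fderiv (by simp)).clm_apply continuous_const
  have hs : HasCompactSupport (pd i f) := h.compact.fderiv_apply ℝ _
  exact (hc.memLp_of_hasCompactSupport hs).restrict G

theorem IsTest.coord {G : Set R3} {φ : R3 → C3} (h : IsTest G φ) (i : Fin 3) :
    IsTest G (fun y => φ y i) where
  smooth := ((EuclideanSpace.proj i : C3 →L[ℂ] ℂ).restrictScalars ℝ).contDiff.comp h.smooth
  compact := h.compact.comp_left (g := fun a : C3 => a i) rfl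
  supp := (closure_mono (Function.support_comp_subset (g := fun a : C3 => a i) rfl φ)).trans h.supp

theorem IsTest.memLp_curl {G : Set R3} {φ : R3 → C3} (h : IsTest G φ) :
    MemLp (curl φ) 2 (volume.restrict G) := by
  refine MemLp.of_eval_piLp fun i => ?_
  fin_cases i
  · exact (memLp_pd (h.coord 2) 1).sub (memLp_pd (h.coord 1) 2)
  · exact (memLp_pd (h.coord 0) 2).sub (memLp_pd (h.coord 2) 0)
  · exact (memLp_pd (h.coord 1) 0).sub (memLp_pd (h.coord 0) 1)

theorem IsTest.memLp_grad {G : Set R3} {φ : R3 → ℂ} (h : IsTest G φ) :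
    MemLp (grad φ) 2 (volume.restrict G) :=
  MemLp.of_eval_piLp fun i => memLp_pd h i

theorem integral_dot_add {G : Set R3} (v w : L2V G) {g : R3 → C3}
    (hg : MemLp g 2 (volume.restrict G)) :
    ∫ x in G, dot ((v + w : L2V G) x) (g x)
      = (∫ x in G, dot (v x) (g x)) + ∫ x in G, dot (w x) (g x) := by
  rw [← integral_add (integrable_dot (Lp.memLp v) hg) (integrable_dot (Lp.memLp w) hg)]
  refine integral_congr_ae ?_
  filter_upwards [Lp.coeFn_add v w] with x hx
  rw [hx]
  simp [dot, add_mul, Finset.sum_add_distrib]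

theorem integral_dot_smul {G : Set R3} (c : ℂ) (v : L2V G) (g : R3 → C3) :
    ∫ x in G, dot ((c • v : L2V G) x) (g x) = c * ∫ x in G, dot (v x) (g x) := by
  rw [← integral_const_mul]
  refine integral_congr_ae ?_
  filter_upwards [Lp.coeFn_smul c v] with x hx
  simp [hx, dot, Finset.mul_sum, mul_assoc]

theorem integral_dot_zero {G : Set R3} (g : R3 → C3) :
    ∫ x in G, dot ((0 : L2V G) x) (g x) = 0 := by
  have h := integral_dot_smul (0 : ℂ) (0 : L2V G) g
  rwa [zero_smul, zero_mul] at h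

/-- The space `H(curl, G)`. -/
def Hcurl (G : Set R3) : Submodule ℂ (CurlPair G) where
  carrier := {p | IsWeakCurl G p.fst p.snd}
  add_mem' := by
    intro p q hp hq φ hφ
    rw [WithLp.add_fst, WithLp.add_snd, integral_dot_add _ _ hφ.memLp_curl,
      integral_dot_add _ _ hφ.memLp, hp φ hφ, hq φ hφ]
  zero_mem' := by
    intro φ _
    rw [WithLp.zero_fst, WithLp.zero_snd, integral_dot_zero, integral_dot_zero]
  smul_mem' := by
    intro c p hp φ hφ
    rw [WithLp.smul_fst, WithLp.smul_snd, integral_dot_smul, integral_dot_smul, hp φ hφ]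

/-- The space `H(div, G)`. -/
def Hdiv (G : Set R3) : Submodule ℂ (DivPair G) where
  carrier := {p | IsWeakDiv G p.fst p.snd}
  add_mem' := by
    intro p q hp hq φ hφ
    have hi : ∀ d : L2S G, Integrable (fun x => d x * φ x) (volume.restrict G) := fun d =>
      (Lp.memLp d).integrable_mul hφ.memLp
    have hs : ∫ x in G, (p.snd + q.snd : L2S G) x * φ x
        = (∫ x in G, p.snd x * φ x) + ∫ x in G, q.snd x * φ x := by
      rw [← integral_add (hi _) (hi _)]
      refine integral_congr_ae ?_
      filter_upwards [Lp.coeFn_add p.snd q.snd] with x hx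
      rw [hx, Pi.add_apply, add_mul]
    rw [WithLp.add_fst, WithLp.add_snd, integral_dot_add _ _ hφ.memLp_grad, hs, hp φ hφ, hq φ hφ]
    ring
  zero_mem' := by
    intro φ _
    have hs : ∫ x in G, (0 : L2S G) x * φ x = 0 := by
      rw [← integral_zero R3 ℂ (μ := volume.restrict G)]
      refine integral_congr_ae ?_
      filter_upwards [Lp.coeFn_zero ℂ 2 (volume.restrict G)] with x hx
      rw [hx, Pi.zero_apply, zero_mul]
    rw [WithLp.zero_fst, WithLp.zero_snd, integral_dot_zero, hs, neg_zero]
  smul_mem' := by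
    intro c p hp φ hφ
    have hs : ∫ x in G, (c • p.snd : L2S G) x * φ x = c * ∫ x in G, p.snd x * φ x := by
      rw [← integral_const_mul]
      refine integral_congr_ae ?_
      filter_upwards [Lp.coeFn_smul c p.snd] with x hx
      simp [hx, mul_assoc]
    rw [WithLp.smul_fst, WithLp.smul_snd, integral_dot_smul, hs, hp φ hφ]
    ring

/-- The space `H₀(curl, G)` of fields with vanishing tangential trace: the closure of the smooth
compactly supported fields in the norm of `H(curl, G)`. -/
def H0curl (G : Set R3) : Submodule ℂ (CurlPair G) :=
  (Submodule.span ℂ {p | ∃ φ : R3 → C3, IsTest G φ ∧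
    p.fst =ᵐ[volume.restrict G] φ ∧ p.snd =ᵐ[volume.restrict G] curl φ}).topologicalClosure

/-- The space `H₀(div, G)` of fields with vanishing normal trace: the closure of the smooth
compactly supported fields in the norm of `H(div, G)`. -/
def H0div (G : Set R3) : Submodule ℂ (DivPair G) :=
  (Submodule.span ℂ {p | ∃ φ : R3 → C3, IsTest G φ ∧
    p.fst =ᵐ[volume.restrict G] φ ∧ p.snd =ᵐ[volume.restrict G] divergence φ}).topologicalClosure

/-! ### The sesquilinear form -/

/-- Near each of its boundary points `Ω` is, in suitable Cartesian coordinates, the set of points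
above the graph of a Lipschitz function. -/
def HasLipschitzBoundary (Ω : Set R3) : Prop :=
  ∀ p ∈ frontier Ω, ∃ (A : R3 ≃ₗᵢ[ℝ] R3) (r : ℝ) (K : ℝ≥0) (g : EuclideanSpace ℝ (Fin 2) → ℝ),
    0 < r ∧ LipschitzWith K g ∧
      ∀ y ∈ Metric.ball p r, y ∈ Ω ↔ g !₂[A y 0, A y 1] < A y 2

/-- Coefficients `μ ∈ L^∞(Ω; ℝ³ˣ³)` and `κ ∈ L^∞(Ω; ℂ³ˣ³)`. -/
structure Coefficients (Ω : Set R3) where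
  μ : R3 → Matrix (Fin 3) (Fin 3) ℝ
  κ : R3 → Matrix (Fin 3) (Fin 3) ℂ
  μ_bdd : ∀ i j, MemLp (fun x => μ x i j) ∞ (volume.restrict Ω)
  κ_bdd : ∀ i j, MemLp (fun x => κ x i j) ∞ (volume.restrict Ω)

/-- Multiplication of a vector by a matrix. -/
def mulVec (M : Matrix (Fin 3) (Fin 3) ℂ) (a : C3) : C3 := WithLp.toLp 2 (M.mulVec a.ofLp)

/-- `B(v, ψ) = (μ curl v, curl ψ) + (κ v, ψ)`, with the `L²` product conjugate-linear in its second
entry (the entries of Mathlib's `inner` are in the opposite order). -/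
def form {Ω : Set R3} (c : Coefficients Ω) (v ψ : CurlPair Ω) : ℂ :=
  (∫ x in Ω, inner ℂ (ψ.snd x) (mulVec ((c.μ x).map Complex.ofReal) (v.snd x)))
    + ∫ x in Ω, inner ℂ (ψ.fst x) (mulVec (c.κ x) (v.fst x))

theorem memLp_mulVec {Ω : Set R3} {M : R3 → Matrix (Fin 3) (Fin 3) ℂ}
    (hM : ∀ i j, MemLp (fun x => M x i j) ∞ (volume.restrict Ω)) (v : L2V Ω) :
    MemLp (fun x => mulVec (M x) (v x)) 2 (volume.restrict Ω) := by
  refine MemLp.of_eval_piLp fun i => ?_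
  simp only [mulVec, Matrix.mulVec, dotProduct]
  exact memLp_finsetSum _ fun j _ => ((Lp.memLp v).eval_piLp j).mul (hM i j)

theorem integral_inner_eq {G : Set R3} {g : R3 → C3} (hg : MemLp g 2 (volume.restrict G))
    (w : L2V G) : ∫ x in G, inner ℂ (w x) (g x) = inner ℂ w (hg.toLp g) := by
  rw [L2.inner_def]
  refine integral_congr_ae ?_
  filter_upwards [hg.coeFn_toLp] with x hx
  rw [hx]

theorem form_eq {Ω : Set R3} (c : Coefficients Ω) (v : CurlPair Ω) :
    ∃ a : CurlPair Ω, ∀ ψ, form c v ψ = inner ℂ ψ a := by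
  have hμ : ∀ i j, MemLp (fun x => (c.μ x).map Complex.ofReal i j) ∞ (volume.restrict Ω) :=
    fun i j => (c.μ_bdd i j).ofReal
  exact ⟨WithLp.toLp 2 ((memLp_mulVec c.κ_bdd v.fst).toLp _, (memLp_mulVec hμ v.snd).toLp _),
    fun ψ => by
      rw [form, integral_inner_eq (memLp_mulVec hμ v.snd),
        integral_inner_eq (memLp_mulVec c.κ_bdd v.fst), WithLp.prod_inner_apply, add_comm]
      rfl⟩

/-- The differential operator `𝓛 : H₀(curl) → H₀(curl)'`, `𝓛(v)(w) = B(v, w)`. The dual space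
consists of the continuous antilinear functionals. -/
def opL {Ω : Set R3} (c : Coefficients Ω) (v : H0curl Ω) : H0curl Ω →L⋆[ℂ] ℂ where
  toFun ψ := form c v ψ
  map_add' ψ₁ ψ₂ := by
    obtain ⟨a, ha⟩ := form_eq c (v : CurlPair Ω)
    simp only [ha, Submodule.coe_add, inner_add_left]
  map_smul' z ψ := by
    obtain ⟨a, ha⟩ := form_eq c (v : CurlPair Ω)
    simp only [ha, Submodule.coe_smul, inner_smul_left, smul_eq_mul]
  cont := by
    obtain ⟨a, ha⟩ := form_eq c (v : CurlPair Ω)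
    simp only [ha]
    exact continuous_subtype_val.inner continuous_const

/-! ### Meshes and finite element spaces -/

/-- A regular partition of `Ω` into tetrahedra, each given by its set of vertices: two tetrahedra
meet exactly in the convex hull of their common vertices. -/
structure TetMesh (Ω : Set R3) where
  cells : Finset (Finset R3)
  card_eq : ∀ T ∈ cells, T.card = 4
  indep : ∀ T ∈ cells, AffineIndependent ℝ ((↑) : T → R3)
  inter : ∀ T ∈ cells, ∀ T' ∈ cells,
    convexHull ℝ (T : Set R3) ∩ convexHull ℝ (T' : Set R3) = convexHull ℝ ((T : Set R3) ∩ T')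
  cover : ⋃ T ∈ cells, convexHull ℝ (T : Set R3) = closure Ω

/-- The Nédélec field `x ↦ a × x + b`. -/
def nedField (a b : C3) (x : R3) : C3 := cross a (toC x) + b

/-- The Raviart-Thomas field `x ↦ s x + b`. -/
def rtField (s : ℂ) (b : C3) (x : R3) : C3 := s • toC x + b

/-- On the tetrahedron `T` (inside `G`) the field `v` equals `x ↦ a × x + b`. -/
def IsNedOn (G : Set R3) (T : Finset R3) (v : R3 → C3) (a b : C3) : Prop :=
  ∀ᵐ x ∂volume.restrict G, x ∈ convexHull ℝ (T : Set R3) → v x = nedField a b x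

/-- The fields of `V` that on every tetrahedron of `cells` have the form `x ↦ a × x + b`. With
`V = H(curl, G)` and `V = H₀(curl, G)` this is the lowest-order Nédélec space without and with
vanishing tangential trace. -/
def nedelec {G : Set R3} (cells : Finset (Finset R3)) (V : Submodule ℂ (CurlPair G)) :
    Submodule ℂ (CurlPair G) where
  carrier := {p | p ∈ V ∧ ∀ T ∈ cells, ∃ a b, IsNedOn G T p.fst a b}
  add_mem' := by
    rintro p q ⟨hp, hp'⟩ ⟨hq, hq'⟩
    refine ⟨V.add_mem hp hq, fun T hT => ?_⟩
    obtain ⟨a, b, h⟩ := hp' T hT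
    obtain ⟨a', b', h'⟩ := hq' T hT
    refine ⟨a + a', b + b', ?_⟩
    filter_upwards [h, h', Lp.coeFn_add p.fst q.fst] with x hx hx' hs hxT
    rw [WithLp.add_fst, hs, Pi.add_apply, hx hxT, hx' hxT]
    ext i
    fin_cases i <;> simp [nedField, cross] <;> ring
  zero_mem' := by
    refine ⟨V.zero_mem, fun T _ => ⟨0, 0, ?_⟩⟩
    filter_upwards [Lp.coeFn_zero C3 2 (volume.restrict G)] with x hx _
    rw [WithLp.zero_fst, hx]
    ext i
    fin_cases i <;> simp [nedField, cross]
  smul_mem' := by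
    rintro c p ⟨hp, hp'⟩
    refine ⟨V.smul_mem c hp, fun T hT => ?_⟩
    obtain ⟨a, b, h⟩ := hp' T hT
    refine ⟨c • a, c • b, ?_⟩
    filter_upwards [h, Lp.coeFn_smul c p.fst] with x hx hs hxT
    rw [WithLp.smul_fst, hs, Pi.smul_apply, hx hxT]
    ext i
    fin_cases i <;> simp [nedField, cross] <;> ring

/-- The lowest-order Raviart-Thomas fields in `H₀(div, G)`. -/
def raviartThomas0 (G : Set R3) (cells : Finset (Finset R3)) : Set (DivPair G) :=
  {p | p ∈ H0div G ∧ ∀ T ∈ cells, ∃ (s : ℂ) (b : C3), ∀ᵐ x ∂volume.restrict G,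
    x ∈ convexHull ℝ (T : Set R3) → p.fst x = rtField s b x}

/-- The first-order Lagrange space over `G`: continuous functions on `G` that are affine on each
tetrahedron of `cells`. Only the values on `G` matter. -/
def lagrange (G : Set R3) (cells : Finset (Finset R3)) : Set (R3 → ℂ) :=
  {τ | ContinuousOn τ G ∧ ∀ T ∈ cells, ∃ (g : C3) (s : ℂ),
    ∀ x ∈ interior (convexHull ℝ (T : Set R3)), τ x = dot g (toC x) + s}

section Mesh

variable {Ω : Set R3} (𝒯 : TetMesh Ω)

/-- The Nédélec space of the mesh, with vanishing tangential trace, as a subspace of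
`H₀(curl, Ω)`. -/
def coarse : Submodule ℂ (H0curl Ω) :=
  (nedelec 𝒯.cells (H0curl Ω)).comap (H0curl Ω).subtype

open Classical in
/-- The edges of the mesh, each given by the set of its two endpoints. -/
def edges : Finset (Finset R3) := 𝒯.cells.biUnion fun T => T.powersetCard 2

open Classical in
/-- The edges that are not contained in the boundary of `Ω`. -/
def interiorEdges : Finset (Finset R3) :=
  (edges 𝒯).filter fun E => ¬ convexHull ℝ (E : Set R3) ⊆ frontier Ω

open Classical in
/-- The tetrahedra that contain the vertex `z`. -/
def cellsAt (z : R3) : Finset (Finset R3) := 𝒯.cells.filter fun T => z ∈ T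

/-- The nodal patch `ω_z`. -/
def nodalPatch (z : R3) : Set R3 :=
  interior (⋃ T ∈ cellsAt 𝒯 z, convexHull ℝ (T : Set R3))

/-- A global orientation of the edges: the edge `E` points from `tail E` to `head E`. -/
structure EdgeOrientation where
  tail : Finset R3 → R3
  head : Finset R3 → R3
  spec : ∀ E ∈ edges 𝒯, (E : Set R3) = {tail E, head E}

variable {𝒯} (o : EdgeOrientation 𝒯) (E : Finset R3)

def edgeLength : ℝ := dist (o.tail E) (o.head E)

/-- The unit tangent `t_E`. -/
def tangent : R3 := (edgeLength o E)⁻¹ • (o.head E - o.tail E)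

/-- The extended edge patch. -/
def edgePatch : Set R3 := nodalPatch 𝒯 (o.tail E) ∪ nodalPatch 𝒯 (o.head E)

open Classical in
/-- The tetrahedra of the extended edge patch. -/
def edgeCells : Finset (Finset R3) := cellsAt 𝒯 (o.tail E) ∪ cellsAt 𝒯 (o.head E)

/-! ### The Falk-Winther operator

Objects characterized by a uniquely solvable problem are selected by `Classical.epsilon`. -/

/-- `m` is the mean over the edge `E` of the tangential component of the piecewise Nédélec field
`v`, evaluated from any tetrahedron that contains `E`. -/
def HasEdgeMean (G : Set R3) (v : R3 → C3) (m : ℂ) : Prop :=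
  ∀ T ∈ 𝒯.cells, E ⊆ T → ∃ a b, IsNedOn G T v a b ∧
    m = ∫ s in (0 : ℝ)..1,
      dot (nedField a b (AffineMap.lineMap (o.tail E) (o.head E) s)) (toC (tangent o E))

/-- The mean over the edge `E` of the tangential component of `v`. -/
def edgeMean (G : Set R3) (v : R3 → C3) : ℂ :=
  Classical.epsilon fun m => HasEdgeMean o E G v m

open Classical in
/-- The edge basis function `ψ_E` of the Nédélec space. -/
def edgeBasis : H0curl Ω :=
  Classical.epsilon fun ψ : H0curl Ω => ψ ∈ coarse 𝒯 ∧ ∀ E' ∈ interiorEdges 𝒯,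
    HasEdgeMean o E' Ω (ψ : CurlPair Ω).fst (if E' = E then 1 else 0)

/-- `q` solves the local problem that defines `Q¹_E u`, for a field `u` with curl `cu`. -/
def IsEdgeProjection (u cu : R3 → C3) (q : CurlPair (edgePatch o E)) : Prop :=
  q ∈ nedelec (edgeCells o E) (Hcurl (edgePatch o E)) ∧
  (∀ τ ∈ lagrange (edgePatch o E) (edgeCells o E),
    ∫ x in edgePatch o E, inner ℂ (grad τ x) (u x - q.fst x) = 0) ∧
  ∀ v ∈ nedelec (edgeCells o E) (Hcurl (edgePatch o E)),
    ∫ x in edgePatch o E, inner ℂ (v.snd x) (cu x - q.snd x) = 0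

/-- `Q¹_E u`, for a field `u` with curl `cu`; only the values on the extended edge patch matter. -/
def edgeProjection (u cu : R3 → C3) : CurlPair (edgePatch o E) :=
  Classical.epsilon fun q => IsEdgeProjection o E u cu q

variable (𝒯) in
/-- The piecewise constant function `z⁰_y`. -/
def z0 (y : R3) : R3 → ℂ :=
  (nodalPatch 𝒯 y).indicator fun _ => (((volume (nodalPatch 𝒯 y)).toReal)⁻¹ : ℂ)

/-- `z` solves the problem that defines `z¹_E`. -/
def IsEdgeWeight (z : DivPair (edgePatch o E)) : Prop :=
  z ∈ raviartThomas0 (edgePatch o E) (edgeCells o E) ∧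
  (∀ᵐ x ∂volume.restrict (edgePatch o E),
    z.snd x = -(z0 𝒯 (o.head E) x - z0 𝒯 (o.tail E) x)) ∧
  ∀ τ ∈ nedelec (edgeCells o E) (H0curl (edgePatch o E)),
    ∫ x in edgePatch o E, inner ℂ (τ.snd x) (z.fst x) = 0

/-- The field `z¹_E`. -/
def edgeWeight : DivPair (edgePatch o E) := Classical.epsilon fun z => IsEdgeWeight o E z

variable (𝒯) in
/-- `q` solves the discrete Neumann problem on the nodal patch of `y` that defines
`Q¹_{y,-} u`. -/
def IsNodalPotential (y : R3) (u : R3 → C3) (q : R3 → ℂ) : Prop :=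
  q ∈ lagrange (nodalPatch 𝒯 y) (cellsAt 𝒯 y) ∧
  (∀ v ∈ lagrange (nodalPatch 𝒯 y) (cellsAt 𝒯 y),
    ∫ x in nodalPatch 𝒯 y, inner ℂ (grad v x) (u x - grad q x) = 0) ∧
  ∫ x in nodalPatch 𝒯 y, q x = 0

variable (𝒯) in
/-- `Q¹_{y,-} u`. -/
def nodalPotential (y : R3) (u : R3 → C3) : R3 → ℂ :=
  Classical.epsilon fun q => IsNodalPotential 𝒯 y u q

open Classical in
variable (𝒯) in
/-- The coefficient `(Q¹_{y,-} u)(y)` of `∇ λ_y`, which occurs for interior vertices only. -/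
def nodalValue (y : R3) (u : R3 → C3) : ℂ := if y ∈ Ω then nodalPotential 𝒯 y u y else 0

/-- The coefficient of `ψ_E` in `S¹ u = M¹ u + ∑_y (Q¹_{y,-} u)(y) ∇ λ_y`, the sum running over the
interior vertices: the mean of `∇ λ_y ⬝ t_E` over `E` is `1 / length E` if `y` is the head of `E`,
`-1 / length E` if `y` is its tail, and `0` otherwise. The coefficient depends only on the values
of `u` on the extended edge patch, hence makes sense for fields defined only there. -/
def sCoeff (u : R3 → C3) : ℂ :=
  (edgeLength o E : ℂ)⁻¹ * ((∫ x in edgePatch o E, dot (u x) ((edgeWeight o E).fst x))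
    + (nodalValue 𝒯 (o.head E) u - nodalValue 𝒯 (o.tail E) u))

/-- The operator `S¹`. -/
def opS (u : R3 → C3) : H0curl Ω := ∑ E ∈ interiorEdges 𝒯, sCoeff o E u • edgeBasis o E

/-- The Falk-Winther interpolation operator: `S¹ u` plus the sum over the interior edges `E` of the
mean over `E` of the tangential component of `(id - S¹) Q¹_E u`, times `ψ_E`. -/
def falkWinther (u : H0curl Ω) : H0curl Ω :=
  opS o (u : CurlPair Ω).fst + ∑ E ∈ interiorEdges 𝒯,
    (edgeMean o E (edgePatch o E)
        (edgeProjection o E (u : CurlPair Ω).fst (u : CurlPair Ω).snd).fst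
      - sCoeff o E (edgeProjection o E (u : CurlPair Ω).fst (u : CurlPair Ω).snd).fst)
      • edgeBasis o E

/-! ### Correctors -/

variable (c : Coefficients Ω)

/-- The corrector space `W`, the kernel of the interpolation operator. -/
def kernelSpace : Set (H0curl Ω) := {w | falkWinther o w = 0}

/-- The corrector Green's operator: `𝓖(F) ∈ W` with `B(𝓖(F), w) = F(w)` for all `w ∈ W`. -/
def greens (F : H0curl Ω →L⋆[ℂ] ℂ) : H0curl Ω :=
  Classical.epsilon fun g : H0curl Ω =>
    g ∈ kernelSpace o ∧ ∀ w ∈ kernelSpace o, form c g w = F w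

/-- The corrector operator `𝒦 = -𝓖 ∘ 𝓛`. -/
def corrector (v : H0curl Ω) : H0curl Ω := -greens o c (opL c v)

/-- The adjoint `𝒦*` of the corrector operator with respect to the form `B`:
`B(𝒦 u, v) = B(u, 𝒦* v)` for all `u`. -/
def correctorAdj (v : H0curl Ω) : H0curl Ω :=
  Classical.epsilon fun k : H0curl Ω => ∀ u : H0curl Ω, form c (corrector o c u) v = form c u k

end Mesh

end CurlLOD

end

/-!
The theorem splits into a statement about Hilbert spaces and one about the Falk-Winther operator.

**Corrected problems.** Let `π` be a continuous projection of a Hilbert space onto a subspace, the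
coarse space, let `W` be its kernel, and let `B` be an elliptic form. The corrector `K v ∈ W` is
characterized by `B (v + K v, w) = 0` for all `w ∈ W`. Hence `v + K v` depends only on `π v`; in
particular `u + K u = π u + K (π u)`. Moreover `K (v + K v) = 0`, so that `B (v + K v, K* v') = B
(K (v + K v), v') = 0`: testing a corrected function with `v' + K* v'` is the same as testing it
with `v'`. If `u` solves the continuous problem, its right-hand side in the coarse equation is
therefore `B (u, v' + K* v') = B (u + K u, v') = B (π u + K (π u), v')`, and `π u` is a solution.
For `v` in the coarse space, `B (v + K v, v + K* v)` equals `B (v + K v, v)` and hence, as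
`K v ∈ W`, also `B (v + K v, v + K v)`, while `v = π (v + K v)` gives `‖v‖ ≤ ‖π‖ ‖v + K v‖`. This proves
ellipticity, which implies uniqueness (`corrected_problem`). Existence of the correctors and of
their adjoints is the Lax-Milgram lemma for forms that are elliptic in absolute value
(`surjective_of_coercive`).

It remains to see that `π_H^E` is a continuous projection onto the coarse Nédélec space
(`exists_falkWintherCLM`).

**Coefficients.** The operator is a finite sum of coefficients times edge basis fields. The
coefficients are continuous functionals because each local problem is finite dimensional and
uniquely solvable (`exists_mixed_projection`, `exists_nodalValueCLM`). For the mixed problem on an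
extended edge patch, uniqueness means that a curl-free Nédélec field there is the gradient of a
continuous piecewise affine function (`fst_mem_gradSpace`): its potential is constructed from the
common vertices, with one constant fixed by the tangential component on the edge. On coarse fields
the local projection is the identity, so the two contributions of `S¹` cancel and what remains is
the edge mean (`exists_coefficientCLM`). Of the weight `z_E^1` only its square integrability
enters.

**Edge basis.** Conversely the edge means must be a system of coordinates on the coarse space.

* The dual basis consists of multiples of the Whitney fields `λ₁ ∇ λ₂ - λ₂ ∇ λ₁`
  (`exists_edgeBasis`). Near an interior edge the barycentric coordinates of the endpoints extend
  to Lipschitz functions on the whole space (`exists_edgeHat`) that are both nonnegative only on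
  the tetrahedra around the edge. Cutting these off at a small positive level and mollifying
  gives test fields that converge boundedly together with their curls, so the Whitney field lies
  in `H₀(curl)` (`whitney_mem_H0curl`).
* A coarse field with vanishing edge means is zero (`eq_zero_of_hasEdgeMean_zero`), because a
  Nédélec field on a tetrahedron is determined by its tangential components along the six edges.
  This uses that these components do not depend on the tetrahedron: a bounded field with bounded
  weak curl has continuous tangential components (`tangential_eq`), by Stokes' theorem for its
  mollifications on thin parallelograms, because a mollification reproduces affine fields. On
  boundary edges the field is extended by zero and compared with its values on parallel segments
  outside the domain (`dot_tangent_eq_zero_of_boundary`). Such segments exist because a Lipschitz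
  domain is the interior of its closure (`interior_closure_subset_of_lipschitz`).
-/

open MeasureTheory
open scoped ContDiff ENNReal NNReal

noncomputable section

namespace CurlLOD

/-! ### Correctors in an abstract Hilbert space -/

section Abstract

variable {H : Type*} [NormedAddCommGroup H] [InnerProductSpace ℂ H]

theorem norm_le_of_coercive {A : H →L[ℂ] H} {α : ℝ}
    (hA : ∀ v, α * ‖v‖ ^ 2 ≤ ‖inner ℂ v (A v)‖) (v : H) : α * ‖v‖ ≤ ‖A v‖ := by
  by_cases h : v = 0
  · simp [h]
  · have hv : 0 < ‖v‖ := norm_pos_iff.2 h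
    refine le_of_mul_le_mul_right ?_ hv
    calc α * ‖v‖ * ‖v‖ = α * ‖v‖ ^ 2 := by ring
      _ ≤ ‖inner ℂ v (A v)‖ := hA v
      _ ≤ ‖v‖ * ‖A v‖ := norm_inner_le_norm _ _
      _ = ‖A v‖ * ‖v‖ := mul_comm _ _

/-- The Lax-Milgram lemma for a complex form that is coercive in absolute value. -/
theorem surjective_of_coercive [CompleteSpace H] {A : H →L[ℂ] H} {α : ℝ} (hα : 0 < α)
    (hA : ∀ v, α * ‖v‖ ^ 2 ≤ ‖inner ℂ v (A v)‖) : Function.Surjective A := by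
  have hanti : AntilipschitzWith (α⁻¹.toNNReal) A := by
    refine ContinuousLinearMap.antilipschitz_of_bound A fun x => ?_
    rw [Real.coe_toNNReal _ (inv_pos.2 hα).le, ← div_eq_inv_mul, le_div_iff₀ hα, mul_comm]
    exact norm_le_of_coercive hA x
  have hcl : IsClosed ((LinearMap.range A.toLinearMap : Submodule ℂ H) : Set H) := by
    exact hanti.isClosed_range A.uniformContinuous
  have : CompleteSpace (LinearMap.range A.toLinearMap) := hcl.completeSpace_coe
  rw [← ContinuousLinearMap.coe_coe, ← LinearMap.range_eq_top,
    ← (LinearMap.range A.toLinearMap).orthogonal_orthogonal, Submodule.eq_top_iff']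
  intro v w hw
  obtain rfl : w = 0 := by
    have h1 : inner ℂ w (A w) = 0 := by
      rw [← inner_conj_symm]
      exact (congrArg _ (hw _ ⟨w, rfl⟩)).trans (map_zero _)
    have h2 := hA w
    rw [h1, norm_zero] at h2
    have h3 : ‖w‖ ^ 2 = 0 := le_antisymm (by nlinarith [sq_nonneg ‖w‖]) (sq_nonneg _)
    simpa using h3
  exact inner_zero_left _

/-- Coercivity on the whole space makes the problem on every closed subspace solvable. -/
theorem exists_mem_inner_eq_of_coercive {A : H →L[ℂ] H} {α : ℝ}
    (hα : 0 < α) (hA : ∀ v, α * ‖v‖ ^ 2 ≤ ‖inner ℂ v (A v)‖) (W : Submodule ℂ H)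
    [CompleteSpace W] (a : H) : ∃ g ∈ W, ∀ w ∈ W, inner ℂ w (A g) = inner ℂ w a := by
  have key : ∀ (x : H) (w : W), inner ℂ w (W.orthogonalProjectionOnto x) = inner ℂ (w : H) x :=
    fun x w => Submodule.inner_orthogonalProjectionOnto_eq_of_mem_left w x
  obtain ⟨g, hg⟩ := surjective_of_coercive (A := W.orthogonalProjectionOnto ∘L A ∘L W.subtypeL) hα
    (fun v => by simpa [key] using hA v) (W.orthogonalProjectionOnto a)
  refine ⟨g, g.2, fun w hw => ?_⟩
  have := congrArg (fun z => inner ℂ (⟨w, hw⟩ : W) z) hg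
  simpa [key] using this

theorem eq_of_coercive {A : H →L[ℂ] H} {α : ℝ}
    (hα : 0 < α) (hA : ∀ v, α * ‖v‖ ^ 2 ≤ ‖inner ℂ v (A v)‖) {W : Submodule ℂ H}
    {g g' : H} (hg : g ∈ W) (hg' : g' ∈ W) (h : ∀ w ∈ W, inner ℂ w (A g) = inner ℂ w (A g')) :
    g = g' := by
  have h1 := hA (g - g')
  rw [map_sub, inner_sub_right, h _ (W.sub_mem hg hg'), sub_self, norm_zero] at h1
  have h3 : ‖g - g'‖ ^ 2 = 0 := le_antisymm (by nlinarith [sq_nonneg ‖g - g'‖]) (sq_nonneg _)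
  exact sub_eq_zero.1 (by simpa using h3)

variable {A : H →L[ℂ] H} {α : ℝ} {W : Submodule ℂ H} {K K' : H → H}

/-- Every corrector operator has an adjoint with respect to the form. -/
theorem exists_adjoint_corrector [CompleteSpace H] [CompleteSpace W] (hα : 0 < α)
    (hA : ∀ v, α * ‖v‖ ^ 2 ≤ ‖inner ℂ v (A v)‖)
    (hKW : ∀ v, K v ∈ W) (hK : ∀ v, ∀ w ∈ W, inner ℂ w (A (v + K v)) = 0) (v : H) :
    ∃ k : H, ∀ u, inner ℂ v (A (K u)) = inner ℂ k (A u) := by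
  have hA' : ∀ v, α * ‖v‖ ^ 2 ≤ ‖inner ℂ v (A.adjoint v)‖ := fun v => by
    rw [ContinuousLinearMap.adjoint_inner_right, ← inner_conj_symm, RCLike.norm_conj]
    exact hA v
  obtain ⟨g, hgW, hg⟩ := exists_mem_inner_eq_of_coercive hα hA' W (A.adjoint v)
  have hg' : ∀ w ∈ W, inner ℂ g (A w) = inner ℂ v (A w) := fun w hw => by
    have := hg w hw
    rw [ContinuousLinearMap.adjoint_inner_right, ContinuousLinearMap.adjoint_inner_right] at this
    rw [← inner_conj_symm, this, inner_conj_symm]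
  refine ⟨-g, fun u => ?_⟩
  have h := hK u g hgW
  rw [map_add, inner_add_right] at h
  rw [← hg' _ (hKW u), inner_neg_left]
  linear_combination h

/-- The corrected functions have no component in the corrector space. -/
theorem corrector_add_corrector (hα : 0 < α)
    (hA : ∀ v, α * ‖v‖ ^ 2 ≤ ‖inner ℂ v (A v)‖)
    (hKW : ∀ v, K v ∈ W) (hK : ∀ v, ∀ w ∈ W, inner ℂ w (A (v + K v)) = 0) (v : H) :
    K (v + K v) = 0 :=
  eq_of_coercive hα hA (hKW _) W.zero_mem fun w hw => by
    have h := hK (v + K v) w hw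
    rw [map_add, inner_add_right, hK v w hw, zero_add] at h
    rw [h, map_zero, inner_zero_right]

/-- Testing with corrected functions is the same as testing with uncorrected ones. -/
theorem inner_corrected (hα : 0 < α)
    (hA : ∀ v, α * ‖v‖ ^ 2 ≤ ‖inner ℂ v (A v)‖)
    (hKW : ∀ v, K v ∈ W) (hK : ∀ v, ∀ w ∈ W, inner ℂ w (A (v + K v)) = 0)
    (hK' : ∀ v u, inner ℂ v (A (K u)) = inner ℂ (K' v) (A u)) (v w : H) :
    inner ℂ (w + K' w) (A (v + K v)) = inner ℂ w (A (v + K v)) := by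
  rw [inner_add_left, ← hK', corrector_add_corrector hα hA hKW hK, map_zero, inner_zero_right,
    add_zero]

theorem corrector_eq_of_sub_mem (hα : 0 < α)
    (hA : ∀ v, α * ‖v‖ ^ 2 ≤ ‖inner ℂ v (A v)‖)
    (hKW : ∀ v, K v ∈ W) (hK : ∀ v, ∀ w ∈ W, inner ℂ w (A (v + K v)) = 0) {u v : H}
    (h : u - v ∈ W) : u + K u = v + K v := by
  have h1 : u - v + K u = K v :=
    eq_of_coercive hα hA (W.add_mem h (hKW u)) (hKW v) fun w hw => by
      have e1 := hK u w hw
      have e2 := hK v w hw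
      simp only [map_add, map_sub, inner_add_right, inner_sub_right] at e1 e2 ⊢
      linear_combination e1 - e2
  rw [← h1]
  abel

theorem corrector_add (hα : 0 < α)
    (hA : ∀ v, α * ‖v‖ ^ 2 ≤ ‖inner ℂ v (A v)‖)
    (hKW : ∀ v, K v ∈ W) (hK : ∀ v, ∀ w ∈ W, inner ℂ w (A (v + K v)) = 0) (u v : H) :
    K (u + v) = K u + K v :=
  eq_of_coercive hα hA (hKW _) (W.add_mem (hKW u) (hKW v)) fun w hw => by
    have e1 := hK u w hw
    have e2 := hK v w hw
    have e3 := hK (u + v) w hw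
    simp only [map_add, inner_add_right] at e1 e2 e3 ⊢
    linear_combination e3 - e1 - e2

theorem corrector_smul (hα : 0 < α)
    (hA : ∀ v, α * ‖v‖ ^ 2 ≤ ‖inner ℂ v (A v)‖)
    (hKW : ∀ v, K v ∈ W) (hK : ∀ v, ∀ w ∈ W, inner ℂ w (A (v + K v)) = 0) (z : ℂ) (v : H) :
    K (z • v) = z • K v :=
  eq_of_coercive hα hA (hKW _) (W.smul_mem z (hKW v)) fun w hw => by
    have e2 := hK v w hw
    have e3 := hK (z • v) w hw
    simp only [map_add, map_smul, inner_add_right, inner_smul_right] at e2 e3 ⊢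
    linear_combination e3 - z * e2

/-- The corrected form is elliptic on the range of a bounded projection `π` that vanishes on the
corrector space. -/
theorem exists_le_norm_inner_corrected (hα : 0 < α)
    (hA : ∀ v, α * ‖v‖ ^ 2 ≤ ‖inner ℂ v (A v)‖)
    (hKW : ∀ v, K v ∈ W) (hK : ∀ v, ∀ w ∈ W, inner ℂ w (A (v + K v)) = 0)
    (π : H →L[ℂ] H) (hπ : ∀ w ∈ W, π w = 0) :
    ∃ α' : ℝ, 0 < α' ∧ ∀ v, π v = v → α' * ‖v‖ ^ 2 ≤ ‖inner ℂ v (A (v + K v))‖ := by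
  refine ⟨α / (‖π‖ + 1) ^ 2, by positivity, fun v hv => ?_⟩
  have h1 : π (v + K v) = v := by rw [map_add, hv, hπ _ (hKW v), add_zero]
  have h2 : ‖v‖ ≤ (‖π‖ + 1) * ‖v + K v‖ := by
    calc ‖v‖ = ‖π (v + K v)‖ := by rw [h1]
      _ ≤ ‖π‖ * ‖v + K v‖ := π.le_opNorm _
      _ ≤ (‖π‖ + 1) * ‖v + K v‖ := by gcongr; linarith
  have h3 : inner ℂ v (A (v + K v)) = inner ℂ (v + K v) (A (v + K v)) := by
    rw [inner_add_left (v) (K v), hK v _ (hKW v), add_zero]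
  rw [h3]
  refine le_trans ?_ (hA _)
  rw [div_mul_eq_mul_div, div_le_iff₀ (by positivity)]
  calc α * ‖v‖ ^ 2 ≤ α * ((‖π‖ + 1) * ‖v + K v‖) ^ 2 := by gcongr
    _ = _ := by ring

/-- The coarse problem with corrected trial and test functions. The corrector space `W` is the
kernel of the projection `π`, so that `u` and `π u` have the same corrected function. -/
theorem corrected_problem (hα : 0 < α)
    (hA : ∀ v, α * ‖v‖ ^ 2 ≤ ‖inner ℂ v (A v)‖)
    (hKW : ∀ v, K v ∈ W) (hK : ∀ v, ∀ w ∈ W, inner ℂ w (A (v + K v)) = 0)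
    (hK' : ∀ v u, inner ℂ v (A (K u)) = inner ℂ (K' v) (A u))
    (π : H →L[ℂ] H) (hπ : ∀ w, w ∈ W ↔ π w = 0) {C : Submodule ℂ H}
    (hmem : ∀ u, π u ∈ C) (hfix : ∀ u ∈ C, π u = u) :
    (∀ (F : H → ℂ) (u : H), (∀ ψ, inner ℂ ψ (A u) = F ψ) → ∀ w : H,
      (w ∈ C ∧ ∀ v ∈ C, inner ℂ (v + K' v) (A (w + K w)) = F (v + K' v)) ↔ w = π u) ∧
    ∃ a : C →ₗ[ℂ] C →ₗ⋆[ℂ] ℂ,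
      (∀ v w : C, a v w = inner ℂ ((w : H) + K' w) (A ((v : H) + K v))) ∧
      ∃ α' : ℝ, 0 < α' ∧ ∀ v : C, α' * ‖v‖ ^ 2 ≤ ‖a v v‖ := by
  have hB := inner_corrected hα hA hKW hK hK'
  obtain ⟨α', hα', hell'⟩ :=
    exists_le_norm_inner_corrected hα hA hKW hK π fun w hw => (hπ w).1 hw
  refine ⟨fun F u hu w => ?_, ?_⟩
  · have hsol : ∀ v, F (v + K' v) = inner ℂ v (A (π u + K (π u))) := fun v => by
      have hsub : u - π u ∈ W := by
        rw [hπ, map_sub, hfix _ (hmem u), sub_self]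
      rw [← hu, inner_add_left, ← hK', ← inner_add_right, ← map_add,
        corrector_eq_of_sub_mem hα hA hKW hK hsub]
    constructor
    · rintro ⟨hw, h⟩
      have hd : w - π u ∈ C := C.sub_mem hw (hmem u)
      have h1 := h _ hd
      rw [hB, hsol] at h1
      have h2 : inner ℂ (w - π u) (A ((w - π u) + K (w - π u))) = 0 := by
        have h3 : (w - π u) + K (w - π u) = (w + K w) - (π u + K (π u)) := by
          have := corrector_add hα hA hKW hK (w - π u) (π u)
          rw [sub_add_cancel] at this
          rw [this]
          abel
        rw [h3, map_sub, inner_sub_right, h1, sub_self]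
      have h3 := hell' _ (hfix _ hd)
      rw [h2, norm_zero] at h3
      have h4 : ‖w - π u‖ ^ 2 = 0 :=
        le_antisymm (by nlinarith [sq_nonneg ‖w - π u‖]) (sq_nonneg _)
      exact sub_eq_zero.1 (by simpa using h4)
    · rintro rfl
      exact ⟨hmem u, fun v _ => by rw [hB, hsol]⟩
  · refine ⟨LinearMap.mk₂'ₛₗ (RingHom.id ℂ) (starRingEnd ℂ)
      (fun v w => inner ℂ (w : H) (A (v + K v))) ?_ ?_ ?_ ?_,
      fun v w => (hB v w).symm, α', hα', fun v => hell' v (hfix _ v.2)⟩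
    · intro v₁ v₂ w
      rw [Submodule.coe_add, corrector_add hα hA hKW hK, ← inner_add_right, ← map_add]
      congr 2
      abel
    · intro z v w
      rw [Submodule.coe_smul, corrector_smul hα hA hKW hK, ← smul_add, map_smul, inner_smul_right]
      rfl
    · intro v w₁ w₂
      rw [Submodule.coe_add, inner_add_left]
    · intro z v w
      rw [Submodule.coe_smul, inner_smul_left]
      rfl

end Abstract

/-! ### The form as a bounded operator -/

theorem ae_norm_mulVec_le {Ω : Set R3} {M : R3 → Matrix (Fin 3) (Fin 3) ℂ}
    (hM : ∀ i j, MemLp (fun x => M x i j) ∞ (volume.restrict Ω)) :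
    ∃ C : ℝ, 0 ≤ C ∧ ∀ᵐ x ∂volume.restrict Ω, ∀ a, ‖mulVec (M x) a‖ ≤ C * ‖a‖ := by
  have h : ∀ i j, ∃ C : ℝ, 0 ≤ C ∧ ∀ᵐ x ∂volume.restrict Ω, ‖M x i j‖ ≤ C := fun i j => by
    refine ⟨(eLpNormEssSup (fun x => M x i j) (volume.restrict Ω)).toReal,
      ENNReal.toReal_nonneg, ?_⟩
    have hfin : eLpNormEssSup (fun x => M x i j) (volume.restrict Ω) ≠ ⊤ := by
      have := (hM i j).2.ne
      rwa [eLpNorm_exponent_top] at this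
    filter_upwards [ae_le_eLpNormEssSup (f := fun x => M x i j) (μ := volume.restrict Ω)] with x hx
    have := ENNReal.toReal_mono hfin hx
    simpa using this
  choose C hC0 hC using h
  refine ⟨∑ i, ∑ j, C i j, Finset.sum_nonneg fun i _ => Finset.sum_nonneg fun j _ => hC0 i j, ?_⟩
  have hall : ∀ᵐ x ∂volume.restrict Ω, ∀ i j, ‖M x i j‖ ≤ C i j :=
    ae_all_iff.2 fun i => ae_all_iff.2 fun j => hC i j
  filter_upwards [hall] with x hx a
  have hsum : mulVec (M x) a
      = ∑ i, EuclideanSpace.single i (∑ j, M x i j * a j) := by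
    ext k
    simp [mulVec, Matrix.mulVec, dotProduct, Pi.single_apply]
  rw [hsum, Finset.sum_mul]
  refine (norm_sum_le _ _).trans (Finset.sum_le_sum fun i _ => ?_)
  rw [PiLp.norm_single, Finset.sum_mul]
  refine (norm_sum_le _ _).trans (Finset.sum_le_sum fun j _ => ?_)
  rw [norm_mul]
  exact mul_le_mul (hx i j) (PiLp.norm_apply_le a j) (norm_nonneg _) (hC0 i j)

/-- Multiplication of `L²` fields by a bounded matrix field. -/
theorem exists_mulVecCLM {Ω : Set R3} {M : R3 → Matrix (Fin 3) (Fin 3) ℂ}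
    (hM : ∀ i j, MemLp (fun x => M x i j) ∞ (volume.restrict Ω)) :
    ∃ T : L2V Ω →L[ℂ] L2V Ω, ∀ v, T v = (memLp_mulVec hM v).toLp _ := by
  obtain ⟨C, -, hC⟩ := ae_norm_mulVec_le hM
  refine ⟨LinearMap.mkContinuous
    { toFun := fun v => (memLp_mulVec hM v).toLp _
      map_add' := fun v w => ?_
      map_smul' := fun z v => ?_ } C fun v => ?_, fun v => rfl⟩
  · rw [← MemLp.toLp_add]
    refine (MemLp.toLp_eq_toLp_iff _ _).2 ?_
    filter_upwards [Lp.coeFn_add v w] with x hx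
    rw [hx]
    ext i
    simp [mulVec, Matrix.mulVec_add]
  · rw [RingHom.id_apply, ← MemLp.toLp_const_smul]
    refine (MemLp.toLp_eq_toLp_iff _ _).2 ?_
    filter_upwards [Lp.coeFn_smul z v] with x hx
    ext i
    simp [hx, mulVec, Matrix.mulVec_smul]
  · refine Lp.norm_le_mul_norm_of_ae_le_mul ?_
    filter_upwards [hC, (memLp_mulVec hM v).coeFn_toLp] with x hx hx'
    change ‖((memLp_mulVec hM v).toLp _ : L2V Ω) x‖ ≤ _
    rw [hx']
    exact hx _

theorem exists_prodMapL2 {E F : Type*} [NormedAddCommGroup E] [NormedSpace ℂ E]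
    [NormedAddCommGroup F] [NormedSpace ℂ F] (T : E →L[ℂ] E) (S : F →L[ℂ] F) :
    ∃ A : WithLp 2 (E × F) →L[ℂ] WithLp 2 (E × F),
      ∀ v, A v = WithLp.toLp 2 (T v.fst, S v.snd) :=
  ⟨(WithLp.prodContinuousLinearEquiv 2 ℂ E F).symm.toContinuousLinearMap ∘L (T.prodMap S) ∘L
    (WithLp.prodContinuousLinearEquiv 2 ℂ E F).toContinuousLinearMap, fun _ => rfl⟩

theorem exists_formCLM {Ω : Set R3} (c : Coefficients Ω) :
    ∃ A : CurlPair Ω →L[ℂ] CurlPair Ω, ∀ v ψ, form c v ψ = inner ℂ ψ (A v) := by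
  have hμ : ∀ i j, MemLp (fun x => (c.μ x).map Complex.ofReal i j) ∞ (volume.restrict Ω) :=
    fun i j => (c.μ_bdd i j).ofReal
  obtain ⟨S, hS⟩ := exists_mulVecCLM hμ
  obtain ⟨T, hT⟩ := exists_mulVecCLM c.κ_bdd
  obtain ⟨A, hA⟩ := exists_prodMapL2 T S
  refine ⟨A, fun v ψ => ?_⟩
  rw [form, integral_inner_eq (memLp_mulVec hμ v.snd),
    integral_inner_eq (memLp_mulVec c.κ_bdd v.fst), hA, WithLp.prod_inner_apply, add_comm,
    hS, hT]
  rfl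

theorem exists_formCLM_H0curl {Ω : Set R3} (c : Coefficients Ω) :
    ∃ A : H0curl Ω →L[ℂ] H0curl Ω, ∀ v ψ : H0curl Ω, form c v ψ = inner ℂ ψ (A v) := by
  obtain ⟨A, hA⟩ := exists_formCLM c
  have : CompleteSpace (H0curl Ω) :=
    (Submodule.isClosed_topologicalClosure _).completeSpace_coe
  refine ⟨(H0curl Ω).orthogonalProjectionOnto ∘L A ∘L (H0curl Ω).subtypeL, fun v ψ => ?_⟩
  rw [hA]
  exact (Submodule.inner_orthogonalProjectionOnto_eq_of_mem_left ψ _).symm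

/-- The problem that selects `greens` is solvable, so the selected element has its properties. -/
theorem greens_spec {Ω : Set R3} {𝒯 : TetMesh Ω} (o : EdgeOrientation 𝒯)
    (c : Coefficients Ω) {A : H0curl Ω →L[ℂ] H0curl Ω}
    (hform : ∀ v ψ : H0curl Ω, form c v ψ = inner ℂ ψ (A v)) {α : ℝ} (hα : 0 < α)
    (hA : ∀ v, α * ‖v‖ ^ 2 ≤ ‖inner ℂ v (A v)‖) (W : Submodule ℂ (H0curl Ω)) [CompleteSpace W]
    (hW : ∀ w, w ∈ W ↔ w ∈ kernelSpace o) (v : H0curl Ω) :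
    greens o c (opL c v) ∈ W ∧
      ∀ w ∈ W, inner ℂ w (A (greens o c (opL c v))) = inner ℂ w (A v) := by
  have hex : ∃ g : H0curl Ω, g ∈ kernelSpace o ∧ ∀ w ∈ kernelSpace o, form c g w = opL c v w := by
    obtain ⟨g, hgW, hg⟩ := exists_mem_inner_eq_of_coercive hα hA W (A v)
    refine ⟨g, (hW g).1 hgW, fun w hw => ?_⟩
    rw [hform, hg w ((hW w).2 hw)]
    exact (hform v w).symm
  have h := Classical.epsilon_spec hex
  refine ⟨(hW _).2 h.1, fun w hw => ?_⟩
  rw [← hform, ← hform]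
  exact h.2 w ((hW w).1 hw)

/-- The condition that selects `correctorAdj` can be met, so the selected element satisfies it. -/
theorem correctorAdj_spec {Ω : Set R3} {𝒯 : TetMesh Ω} (o : EdgeOrientation 𝒯)
    (c : Coefficients Ω) {A : H0curl Ω →L[ℂ] H0curl Ω}
    (hform : ∀ v ψ : H0curl Ω, form c v ψ = inner ℂ ψ (A v)) {v : H0curl Ω}
    (hex : ∃ k : H0curl Ω, ∀ u, inner ℂ v (A (corrector o c u)) = inner ℂ k (A u))
    (u : H0curl Ω) :
    inner ℂ v (A (corrector o c u)) = inner ℂ (correctorAdj o c v) (A u) := by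
  have hex' : ∃ k : H0curl Ω, ∀ u : H0curl Ω, form c (corrector o c u) v = form c u k := by
    obtain ⟨k, hk⟩ := hex
    exact ⟨k, fun u => by rw [hform, hform, hk]⟩
  rw [← hform, ← hform]
  exact Classical.epsilon_spec hex' u

set_option maxHeartbeats 1000000 in
theorem corrected_problem_of_formCLM {Ω : Set R3} {𝒯 : TetMesh Ω} (o : EdgeOrientation 𝒯)
    (c : Coefficients Ω) {A : H0curl Ω →L[ℂ] H0curl Ω}
    (hform : ∀ v ψ : H0curl Ω, form c v ψ = inner ℂ ψ (A v)) {α : ℝ} (hα : 0 < α)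
    (hA : ∀ v, α * ‖v‖ ^ 2 ≤ ‖inner ℂ v (A v)‖)
    (π : H0curl Ω →L[ℂ] H0curl Ω) (hπ : ∀ u, π u = falkWinther o u)
    (hmem : ∀ u, π u ∈ coarse 𝒯) (hfix : ∀ u ∈ coarse 𝒯, π u = u) :
    (∀ (f : Hdiv Ω) (u : H0curl Ω),
      (∀ ψ : H0curl Ω, form c u ψ
        = inner ℂ (ψ : CurlPair Ω).fst (f : DivPair Ω).fst) →
      ∀ w : H0curl Ω,
        (w ∈ coarse 𝒯 ∧ ∀ v ∈ coarse 𝒯,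
          form c ↑(w + corrector o c w) ↑(v + correctorAdj o c v)
            = inner ℂ
                ((v + correctorAdj o c v : H0curl Ω) : CurlPair Ω).fst
                (f : DivPair Ω).fst)
          ↔ w = falkWinther o u) ∧
    ∃ a : coarse 𝒯 →ₗ[ℂ] coarse 𝒯 →ₗ⋆[ℂ] ℂ,
      (∀ v w : coarse 𝒯, a v w
        = form c ↑((v : H0curl Ω) + corrector o c v)
            ↑((w : H0curl Ω) + correctorAdj o c w)) ∧
      ∃ α' : ℝ, 0 < α' ∧ ∀ v : coarse 𝒯, α' * ‖v‖ ^ 2 ≤ ‖a v v‖ := by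
  have hcomp : CompleteSpace (H0curl Ω) :=
    (Submodule.isClosed_topologicalClosure _).completeSpace_coe
  have hWcl : IsClosed (LinearMap.ker π.toLinearMap : Set (H0curl Ω)) := π.isClosed_ker
  have hWcomp : CompleteSpace (LinearMap.ker π.toLinearMap) := hWcl.completeSpace_coe
  have hWmem : ∀ w, w ∈ LinearMap.ker π.toLinearMap ↔ w ∈ kernelSpace o := fun w => by
    change π w = 0 ↔ falkWinther o w = 0
    rw [hπ]
  have hg := greens_spec o c hform hα hA _ hWmem
  have hKW : ∀ v, corrector o c v ∈ LinearMap.ker π.toLinearMap :=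
    fun v => Submodule.neg_mem _ (hg v).1
  have hK : ∀ v, ∀ w ∈ LinearMap.ker π.toLinearMap, inner ℂ w (A (v + corrector o c v)) = 0 :=
    fun v w hw => by
      rw [corrector, map_add, map_neg, inner_add_right, inner_neg_right, (hg v).2 w hw,
        add_neg_cancel]
  have hK' : ∀ v u, inner ℂ v (A (corrector o c u)) = inner ℂ (correctorAdj o c v) (A u) :=
    fun v => correctorAdj_spec o c hform
      (exists_adjoint_corrector (K := corrector o c) hα hA hKW hK v)
  have hmain := corrected_problem (K := corrector o c) (K' := correctorAdj o c) hα hA hKW hK hK' π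
    (fun w => LinearMap.mem_ker) hmem hfix
  cases hmain with | intro h1 h2 => ?_
  cases h2 with | intro a h2 => ?_
  refine ⟨fun f u hu w => ?_, a, fun v w => (h2.1 v w).trans (hform _ _).symm, h2.2⟩
  rw [← hπ, ← h1 (fun ψ => inner ℂ (ψ : CurlPair Ω).fst (f : DivPair Ω).fst) u
    (fun ψ => by rw [← hform, hu]) w]
  simp only [hform]

/-- The theorem for any coefficients and mesh for which the interpolation operator is a bounded
projection onto the Nédélec space. -/
theorem corrected_problem_of_projection {Ω : Set R3} {𝒯 : TetMesh Ω} (o : EdgeOrientation 𝒯)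
    (c : Coefficients Ω)
    (hell : ∃ α : ℝ, 0 < α ∧ ∀ v : H0curl Ω, α * ‖v‖ ^ 2 ≤ ‖form c v v‖)
    (π : H0curl Ω →L[ℂ] H0curl Ω) (hπ : ∀ u, π u = falkWinther o u)
    (hmem : ∀ u, π u ∈ coarse 𝒯) (hfix : ∀ u ∈ coarse 𝒯, π u = u) :
    (∀ (f : Hdiv Ω) (u : H0curl Ω),
      (∀ ψ : H0curl Ω, form c u ψ
        = inner ℂ (ψ : CurlPair Ω).fst (f : DivPair Ω).fst) →
      ∀ w : H0curl Ω,
        (w ∈ coarse 𝒯 ∧ ∀ v ∈ coarse 𝒯,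
          form c ↑(w + corrector o c w) ↑(v + correctorAdj o c v)
            = inner ℂ
                ((v + correctorAdj o c v : H0curl Ω) : CurlPair Ω).fst
                (f : DivPair Ω).fst)
          ↔ w = falkWinther o u) ∧
    ∃ a : coarse 𝒯 →ₗ[ℂ] coarse 𝒯 →ₗ⋆[ℂ] ℂ,
      (∀ v w : coarse 𝒯, a v w
        = form c ↑((v : H0curl Ω) + corrector o c v)
            ↑((w : H0curl Ω) + correctorAdj o c w)) ∧
      ∃ α' : ℝ, 0 < α' ∧ ∀ v : coarse 𝒯, α' * ‖v‖ ^ 2 ≤ ‖a v v‖ := by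
  obtain ⟨α, hα, hA⟩ := hell
  exact (exists_formCLM_H0curl c).elim fun A hform =>
    corrected_problem_of_formCLM o c hform hα (fun v => by rw [← hform]; exact hA v) π hπ hmem hfix

/-! ### Products of vectors -/

theorem dot_add_left (a b c : C3) : dot (a + b) c = dot a c + dot b c := by
  simp [dot, add_mul, Finset.sum_add_distrib]

theorem dot_add_right (a b c : C3) : dot a (b + c) = dot a b + dot a c := by
  simp [dot, mul_add, Finset.sum_add_distrib]

theorem dot_sub_left (a b c : C3) : dot (a - b) c = dot a c - dot b c := by
  simp [dot, sub_mul, Finset.sum_sub_distrib]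

theorem dot_sub_right (a b c : C3) : dot a (b - c) = dot a b - dot a c := by
  simp [dot, mul_sub, Finset.sum_sub_distrib]

theorem dot_smul_left (z : ℂ) (a b : C3) : dot (z • a) b = z * dot a b := by
  simp [dot, Finset.mul_sum, mul_assoc]

theorem dot_smul_right (z : ℂ) (a b : C3) : dot a (z • b) = z * dot a b := by
  simp only [dot, PiLp.smul_apply, smul_eq_mul, Finset.mul_sum]
  exact Finset.sum_congr rfl fun i _ => by ring

theorem dot_real_smul_left (r : ℝ) (a b : C3) : dot (r • a) b = (r : ℂ) * dot a b := by
  simp [dot, Finset.mul_sum, mul_assoc]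

theorem dot_real_smul_right (r : ℝ) (a b : C3) : dot a (r • b) = (r : ℂ) * dot a b := by
  simp only [dot, PiLp.smul_apply, Complex.real_smul, Finset.mul_sum]
  exact Finset.sum_congr rfl fun i _ => by ring

@[simp] theorem dot_zero_left (a : C3) : dot 0 a = 0 := by simp [dot]

@[simp] theorem dot_zero_right (a : C3) : dot a 0 = 0 := by simp [dot]

theorem norm_dot_le (a b : C3) : ‖dot a b‖ ≤ 3 * (‖a‖ * ‖b‖) := by
  calc ‖dot a b‖ ≤ ∑ i : Fin 3, ‖a i * b i‖ := norm_sum_le _ _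
    _ ≤ ∑ _i : Fin 3, ‖a‖ * ‖b‖ := Finset.sum_le_sum fun i _ => by
        rw [norm_mul]
        gcongr <;> exact PiLp.norm_apply_le _ i
    _ = 3 * (‖a‖ * ‖b‖) := by simp

theorem toC_add (x y : R3) : toC (x + y) = toC x + toC y := by
  ext i
  simp [toC]

theorem toC_sub (x y : R3) : toC (x - y) = toC x - toC y := by
  ext i
  simp [toC]

theorem toC_smul (r : ℝ) (x : R3) : toC (r • x) = (r : ℂ) • toC x := by
  ext i
  simp [toC]

theorem toC_neg (x : R3) : toC (-x) = -toC x := by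
  ext i
  simp [toC]

@[simp] theorem toC_zero : toC 0 = 0 := by
  ext i
  simp [toC]

theorem norm_toC (x : R3) : ‖toC x‖ = ‖x‖ := by
  simp [EuclideanSpace.norm_eq, toC]

theorem continuous_toC : Continuous toC := by
  unfold toC
  fun_prop

theorem continuous_dot {X : Type*} [TopologicalSpace X] {f g : X → C3} (hf : Continuous f)
    (hg : Continuous g) : Continuous fun x => dot (f x) (g x) := by
  unfold dot
  fun_prop

/-- The real-bilinear form `dot` as a continuous linear map in its first argument. -/
def dotL (c : C3) : C3 →L[ℝ] ℂ :=
  ∑ i, ((c i) • (EuclideanSpace.proj i : C3 →L[ℂ] ℂ)).restrictScalars ℝ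

theorem dotL_apply (c a : C3) : dotL c a = dot a c := by
  simp [dotL, dot, mul_comm]

theorem nedField_zero_left (b : C3) (x : R3) : nedField 0 b x = b := by
  ext i
  fin_cases i <;> simp [nedField, cross]

theorem continuous_nedField (a b : C3) : Continuous (nedField a b) := by
  unfold nedField cross toC
  fun_prop

/-- The tangential component of a Nédélec field is constant along a line. -/
theorem dot_nedField_add_smul (a b : C3) (x t : R3) (r : ℝ) :
    dot (nedField a b (x + r • t)) (toC t) = dot (nedField a b x) (toC t) := by
  simp [dot, nedField, cross, toC, Fin.sum_univ_three]
  ring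

/-! ### Mollification -/

/-- A smooth bump function supported in the ball of radius `ε`. -/
def bump (ε : ℝ) (hε : 0 < ε) : ContDiffBump (0 : R3) := ⟨ε / 2, ε, by positivity, by linarith⟩

/-- The mollifier: even, nonnegative, of mass one and supported in the ball of radius `ε`. -/
def eta {ε : ℝ} (hε : 0 < ε) : R3 → ℝ := (bump ε hε).normed volume

section Mollify

variable {F : Type*} [NormedAddCommGroup F] [NormedSpace ℝ F] {ε : ℝ} (hε : 0 < ε)

/-- The mollification of `f`. -/
def mollify (f : R3 → F) (x : R3) : F := ∫ z, eta hε z • f (x - z)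

theorem contDiff_eta : ContDiff ℝ ∞ (eta hε) := (bump ε hε).contDiff_normed

theorem hasCompactSupport_eta : HasCompactSupport (eta hε) := (bump ε hε).hasCompactSupport_normed

theorem eta_eq_zero {z : R3} (hz : ε ≤ ‖z‖) : eta hε z = 0 := by
  by_contra h
  have h1 : z ∈ Function.support (eta hε) := h
  rw [eta, ContDiffBump.support_normed_eq] at h1
  exact absurd (mem_ball_zero_iff.1 h1) (not_lt.2 hz)

theorem eta_nonneg (z : R3) : 0 ≤ eta hε z := (bump ε hε).nonneg_normed z

theorem eta_neg (z : R3) : eta hε (-z) = eta hε z := (bump ε hε).normed_neg z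

theorem integral_eta : ∫ z, eta hε z = 1 := (bump ε hε).integral_normed

theorem integrable_eta : Integrable (eta hε) := (bump ε hε).integrable_normed

theorem mollify_eq_convolution (f : R3 → F) :
    mollify hε f = convolution (eta hε) f (ContinuousLinearMap.lsmul ℝ ℝ) volume := rfl

theorem mollify_eq_swap (f : R3 → F) (x : R3) :
    mollify hε f x = ∫ y, eta hε (x - y) • f y := by
  rw [mollify_eq_convolution, convolution_eq_swap]
  rfl

theorem contDiff_mollify [CompleteSpace F] {f : R3 → F} (hf : LocallyIntegrable f) :
    ContDiff ℝ ∞ (mollify hε f) := by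
  rw [mollify_eq_convolution]
  exact (hasCompactSupport_eta hε).contDiff_convolution_left _ (contDiff_eta hε) hf

theorem integrable_eta_smul {f : R3 → F} (hf : LocallyIntegrable f) (x : R3) :
    Integrable fun z => eta hε z • f (x - z) :=
  (hasCompactSupport_eta hε).convolutionExists_left (ContinuousLinearMap.lsmul ℝ ℝ)
    (contDiff_eta hε).continuous hf x

theorem fderiv_mollify [CompleteSpace F] {f : R3 → F} (hf : LocallyIntegrable f) (x h : R3) :
    fderiv ℝ (mollify hε f) x h = ∫ y, fderiv ℝ (eta hε) (x - y) h • f y := by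
  have hc : ContDiff ℝ 1 (eta hε) := (contDiff_eta hε).of_le (by norm_cast)
  have h1 := (hasCompactSupport_eta hε).hasFDerivAt_convolution_left
    (ContinuousLinearMap.lsmul ℝ ℝ : ℝ →L[ℝ] F →L[ℝ] F) hc hf x
  have h2 := ((hasCompactSupport_eta hε).fderiv ℝ).convolutionExists_left
    ((ContinuousLinearMap.lsmul ℝ ℝ : ℝ →L[ℝ] F →L[ℝ] F).precompL R3)
    (hc.continuous_fderiv one_ne_zero) hf x
  rw [mollify_eq_convolution, h1.fderiv, convolution_def, ContinuousLinearMap.integral_apply h2,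
    ← integral_sub_left_eq_self _ volume x]
  refine integral_congr_ae (Filter.Eventually.of_forall fun y => ?_)
  simp [ContinuousLinearMap.precompL_apply]

theorem norm_mollify_le {f : R3 → F} {x : R3} {M : ℝ} 
    (hM : ∀ᵐ y, y ∈ Metric.ball x ε → ‖f y‖ ≤ M) : ‖mollify hε f x‖ ≤ M := by
  have hint : Integrable fun y => eta hε (x - y) * M := ((integrable_eta hε).comp_sub_left x).mul_const M
  rw [mollify_eq_swap]
  refine (norm_integral_le_of_norm_le hint ?_).trans ?_
  · filter_upwards [hM] with y hy
    rw [norm_smul, Real.norm_of_nonneg (eta_nonneg hε _)]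
    by_cases h : y ∈ Metric.ball x ε
    · exact mul_le_mul_of_nonneg_left (hy h) (eta_nonneg hε _)
    · have : eta hε (x - y) = 0 := by
        apply eta_eq_zero
        rw [Metric.mem_ball, dist_eq_norm, not_lt, norm_sub_rev] at h
        exact h
      simp [this]
  · rw [integral_mul_const, integral_sub_left_eq_self (eta hε) volume x, integral_eta, one_mul]

/-- A function with the mean value property for opposite points, in particular an affine one, is
reproduced exactly, since the mollifier is even. -/
theorem mollify_eq_of_ae_eq [CompleteSpace F] {f N : R3 → F} (hN : Continuous N)
    (hsym : ∀ x z, N (x + z) + N (x - z) = (2 : ℝ) • N x) {x : R3}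
    (h : ∀ᵐ y, y ∈ Metric.ball x ε → f y = N y) : mollify hε f x = N x := by
  have h1 : mollify hε f x = mollify hε N x := by
    rw [mollify_eq_swap, mollify_eq_swap]
    refine integral_congr_ae ?_
    filter_upwards [h] with y hy
    by_cases hb : y ∈ Metric.ball x ε
    · rw [hy hb]
    · have : eta hε (x - y) = 0 := by
        apply eta_eq_zero
        rw [Metric.mem_ball, dist_eq_norm, not_lt, norm_sub_rev] at hb
        exact hb
      simp [this]
  have hi := integrable_eta_smul hε hN.locallyIntegrable x
  have h2 : mollify hε N x = ∫ z, eta hε z • N (x + z) := by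
    rw [mollify, ← integral_neg_eq_self]
    simp [eta_neg]
  have hi' : Integrable fun z => eta hε z • N (x + z) := by
    have := hi.comp_neg
    simpa [eta_neg] using this
  have h3 : (2 : ℝ) • mollify hε N x = (2 : ℝ) • N x := by
    rw [two_smul]
    nth_rewrite 1 [h2]
    rw [mollify, ← integral_add hi' hi]
    simp_rw [← smul_add, hsym]
    rw [integral_smul_const, integral_eta, one_smul]
  rw [h1]
  exact smul_right_injective F (two_ne_zero (α := ℝ)) h3

end Mollify

/-- The mean value property that makes mollification reproduce Nédélec fields. -/
theorem nedField_symm (a b : C3) (x z : R3) :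
    nedField a b (x + z) + nedField a b (x - z) = (2 : ℝ) • nedField a b x := by
  ext i
  fin_cases i <;> simp [nedField, cross, toC] <;> ring

/-! ### Tangential continuity -/

/-- The derivative of a field is the sum of the derivatives of its components. -/
theorem pd_apply {F : R3 → C3} {x : R3} (hF : DifferentiableAt ℝ F x) (i k : Fin 3) :
    pd i (fun y => F y k) x = fderiv ℝ F x (EuclideanSpace.single i 1) k := by
  have h : HasFDerivAt (fun y => F y k)
      (((EuclideanSpace.proj k : C3 →L[ℂ] ℂ).restrictScalars ℝ).comp (fderiv ℝ F x)) x :=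
    ((EuclideanSpace.proj k : C3 →L[ℂ] ℂ).restrictScalars ℝ).hasFDerivAt.comp x hF.hasFDerivAt
  rw [pd, h.fderiv]
  rfl

/-- The curl of a scalar function times a constant vector product. -/
theorem curl_smul_cross {g : R3 → ℝ} {y : R3} (hg : DifferentiableAt ℝ g y) (h t : R3) :
    curl (fun y => (g y) • cross (toC h) (toC t)) y
      = (fderiv ℝ g y t) • toC h - (fderiv ℝ g y h) • toC t := by
  have e : ∀ (c : C3) (i k : Fin 3), pd i (fun y => (g y • c) k) y
      = (fderiv ℝ g y (EuclideanSpace.single i 1) : ℂ) * c k := fun c i k => by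
    have h1 := hg.hasFDerivAt.smul_const c
    have h2 := pd_apply h1.differentiableAt i k
    rw [h1.fderiv] at h2
    rw [h2]
    simp
  have hdec : ∀ z : R3, (fderiv ℝ g y z) = ∑ i, z i * fderiv ℝ g y (EuclideanSpace.single i 1) :=
    fun z => by
      have hz : z = ∑ i, z i • EuclideanSpace.single i (1 : ℝ) := by
        ext k
        simp [Pi.single_apply]
      conv_lhs => rw [hz]
      simp
  rw [curl]
  simp only [e]
  ext i
  rw [hdec h, hdec t]
  fin_cases i <;> simp [cross, toC, Fin.sum_univ_three] <;> ring

/-- A mollified weak curl: the antisymmetric part of the derivative of the mollified field. -/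
theorem fderiv_mollify_antisymm {v w : R3 → C3} (hv : LocallyIntegrable v)
    (hw : LocallyIntegrable w) {U : Set R3}
    (hcurl : ∀ φ, IsTest U φ → ∫ x, dot (v x) (curl φ x) = ∫ x, dot (w x) (φ x))
    {ε : ℝ} (hε : 0 < ε) {x : R3} (hx : Metric.closedBall x ε ⊆ U) (h t : R3) :
    dot (fderiv ℝ (mollify hε v) x h) (toC t) - dot (fderiv ℝ (mollify hε v) x t) (toC h)
      = dot (mollify hε w x) (cross (toC h) (toC t)) := by
  have hd : Differentiable ℝ (eta hε) := (contDiff_eta hε).differentiable (by simp)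
  let φ : R3 → C3 := fun y => eta hε (x - y) • cross (toC h) (toC t)
  have hφ : IsTest U φ := by
    have hsub : Function.support φ ⊆ Metric.closedBall x ε := fun y hy => by
      by_contra hn
      apply hy
      have : eta hε (x - y) = 0 := by
        apply eta_eq_zero
        rw [Metric.mem_closedBall, dist_eq_norm, not_le, norm_sub_rev] at hn
        exact hn.le
      simp [φ, this]
    have hts : tsupport φ ⊆ Metric.closedBall x ε :=
      closure_minimal hsub Metric.isClosed_closedBall
    refine ⟨?_, ?_, hts.trans hx⟩
    · exact ((contDiff_eta hε).comp (contDiff_const.sub contDiff_id)).smul contDiff_const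
    · exact HasCompactSupport.of_support_subset_isCompact (isCompact_closedBall x ε) hsub
  have hder : ∀ y z, fderiv ℝ (fun y => eta hε (x - y)) y z = -fderiv ℝ (eta hε) (x - y) z := by
    intro y z
    have h1 : HasFDerivAt (fun y => eta hε (x - y))
        ((fderiv ℝ (eta hε) (x - y)).comp (-ContinuousLinearMap.id ℝ R3)) y :=
      (hd _).hasFDerivAt.comp y ((hasFDerivAt_id y).const_sub x)
    rw [h1.fderiv]
    simp
  have hcφ : ∀ y, curl φ y
      = (fderiv ℝ (eta hε) (x - y) h) • toC t - (fderiv ℝ (eta hε) (x - y) t) • toC h := by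
    intro y
    have h1 : DifferentiableAt ℝ (fun y => eta hε (x - y)) y :=
      (hd _).comp y ((differentiableAt_const x).sub differentiableAt_id)
    rw [curl_smul_cross h1, hder, hder]
    simp only [neg_smul]
    abel
  have hi : ∀ z, Integrable fun y => fderiv ℝ (eta hε) (x - y) z • v y := by
    intro z
    refine hv.integrable_smul_left_of_hasCompactSupport (g := fun y => fderiv ℝ (eta hε) (x - y) z)
      ?_ ?_
    · have := (contDiff_eta hε).continuous_fderiv (by simp)
      fun_prop
    · have h1 : HasCompactSupport fun y => fderiv ℝ (eta hε) y z :=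
        (hasCompactSupport_eta hε).fderiv_apply ℝ z
      exact h1.comp_homeomorph (Homeomorph.subLeft x)
  have hpull : ∀ z c, dot (fderiv ℝ (mollify hε v) x z) c
      = ∫ y, dot (fderiv ℝ (eta hε) (x - y) z • v y) c := by
    intro z c
    rw [fderiv_mollify hε hv]
    simp only [← dotL_apply]
    exact ((dotL c).integral_comp_comm (hi z)).symm
  have hwi : Integrable fun y => eta hε (x - y) • w y := by
    have := (integrable_eta_smul hε hw x).comp_sub_left x
    simpa using this
  have hpw : dot (mollify hε w x) (cross (toC h) (toC t))
      = ∫ y, dot (eta hε (x - y) • w y) (cross (toC h) (toC t)) := by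
    rw [mollify_eq_swap]
    simp only [← dotL_apply]
    exact ((dotL _).integral_comp_comm hwi).symm
  rw [hpull, hpull, hpw, ← integral_sub]
  · have key := hcurl φ hφ
    have e1 : ∀ y, dot (fderiv ℝ (eta hε) (x - y) h • v y) (toC t)
        - dot (fderiv ℝ (eta hε) (x - y) t • v y) (toC h) = dot (v y) (curl φ y) := fun y => by
      rw [hcφ, dot_sub_right, dot_real_smul_left, dot_real_smul_left, dot_real_smul_right,
        dot_real_smul_right]
    have e2 : ∀ y, dot (eta hε (x - y) • w y) (cross (toC h) (toC t)) = dot (w y) (φ y) :=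
      fun y => by rw [dot_real_smul_left, dot_real_smul_right]
    simp only [e1, e2]
    exact key
  · simpa only [← dotL_apply] using (dotL (toC t)).integrable_comp (hi h)
  · simpa only [← dotL_apply] using (dotL (toC h)).integrable_comp (hi t)

/-- Stokes' theorem on the parallelogram spanned by `h` and `t` at `x`. -/
theorem integral_parallelogram {F : R3 → C3} (hF : ContDiff ℝ 1 F) (x h t : R3) :
    (∫ s in (0 : ℝ)..1, ∫ r in (0 : ℝ)..1,
      (dot (fderiv ℝ F (x + s • h + r • t) h) (toC t)
        - dot (fderiv ℝ F (x + s • h + r • t) t) (toC h)))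
      = ((∫ r in (0 : ℝ)..1, dot (F (x + h + r • t)) (toC t))
          - ∫ r in (0 : ℝ)..1, dot (F (x + r • t)) (toC t))
        - ((∫ s in (0 : ℝ)..1, dot (F (x + s • h + t)) (toC h))
          - ∫ s in (0 : ℝ)..1, dot (F (x + s • h)) (toC h)) := by
  have hdF : Differentiable ℝ F := hF.differentiable one_ne_zero
  let P : ℝ × ℝ →L[ℝ] R3 := (ContinuousLinearMap.fst ℝ ℝ ℝ).smulRight h
    + (ContinuousLinearMap.snd ℝ ℝ ℝ).smulRight t
  have hP : ∀ p : ℝ × ℝ, x + P p = x + p.1 • h + p.2 • t := fun p => by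
    simp [P, add_assoc]
  have hder : ∀ (c : C3) (p : ℝ × ℝ), HasFDerivAt (fun p => dotL c (F (x + P p)))
      ((dotL c).comp ((fderiv ℝ F (x + P p)).comp P)) p := fun c p =>
    (dotL c).hasFDerivAt.comp p ((hdF _).hasFDerivAt.comp p (P.hasFDerivAt.const_add x))
  have hcont : ∀ c : C3, Continuous fun p => dotL c (F (x + P p)) := fun c =>
    (dotL c).continuous.comp (hF.continuous.comp (continuous_const.add P.continuous))
  have hcf : Continuous (fderiv ℝ F) := hF.continuous_fderiv one_ne_zero
  have key := integral2_divergence_prod_of_hasFDerivAt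
    (fun p => dotL (toC t) (F (x + P p))) (fun p => -dotL (toC h) (F (x + P p)))
    (fun p => (dotL (toC t)).comp ((fderiv ℝ F (x + P p)).comp P))
    (fun p => -(dotL (toC h)).comp ((fderiv ℝ F (x + P p)).comp P)) 0 0 1 1
    (hcont _).continuousOn (hcont _).neg.continuousOn
    (fun p _ => hder _ p) (fun p _ => (hder _ p).neg) (by
      refine ContinuousOn.integrableOn_compact (isCompact_uIcc.prod isCompact_uIcc) ?_
      refine Continuous.continuousOn ?_
      simp only [ContinuousLinearMap.comp_apply, neg_apply]
      fun_prop)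
  simp only [ContinuousLinearMap.comp_apply, neg_apply, dotL_apply, hP] at key
  have hP1 : P (1, 0) = h := by simp [P]
  have hP2 : P (0, 1) = t := by simp [P]
  simp only [hP1, hP2, one_smul, zero_smul, add_zero, intervalIntegral.integral_neg] at key
  simp only [sub_eq_add_neg] at key ⊢
  rw [key]
  ring

/-- The tangential components along two parallel segments differ by at most a multiple of their
distance, if the field and its weak curl are bounded. -/
theorem norm_tangential_sub_le {v w : R3 → C3} (hv : LocallyIntegrable v)
    (hw : LocallyIntegrable w) {U : Set R3} (hU : IsOpen U) (hUc : Convex ℝ U)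
    (hcurl : ∀ φ, IsTest U φ → ∫ x, dot (v x) (curl φ x) = ∫ x, dot (w x) (φ x))
    {M : ℝ} (hvM : ∀ᵐ x, x ∈ U → ‖v x‖ ≤ M) (hwM : ∀ᵐ x, x ∈ U → ‖w x‖ ≤ M)
    {V₀ V₁ : Set R3} (hV₀ : IsOpen V₀) (hV₁ : IsOpen V₁) (hVU₀ : V₀ ⊆ U) (hVU₁ : V₁ ⊆ U)
    {a₀ b₀ a₁ b₁ : C3} (hN₀ : ∀ᵐ x, x ∈ V₀ → v x = nedField a₀ b₀ x)
    (hN₁ : ∀ᵐ x, x ∈ V₁ → v x = nedField a₁ b₁ x) {x₀ x₁ t : R3}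
    (h₀ : ∀ r ∈ Set.Icc (0 : ℝ) 1, x₀ + r • t ∈ V₀) (h₁ : ∀ r ∈ Set.Icc (0 : ℝ) 1, x₁ + r • t ∈ V₁) :
    ‖dot (nedField a₁ b₁ x₁) (toC t) - dot (nedField a₀ b₀ x₀) (toC t)‖
      ≤ 3 * (M * ‖cross (toC (x₁ - x₀)) (toC t)‖) + 6 * (M * ‖x₁ - x₀‖) := by
  set h : R3 := x₁ - x₀ with hh
  -- the two segments and the parallelogram are compact, hence have a uniform distance to the
  -- complements of the open sets
  have hseg : ∀ x : R3, IsCompact ((fun r : ℝ => x + r • t) '' Set.Icc 0 1) := fun x =>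
    isCompact_Icc.image (by fun_prop)
  have hpar : IsCompact ((fun p : ℝ × ℝ => x₀ + p.1 • h + p.2 • t) ''
      (Set.Icc 0 1 ×ˢ Set.Icc 0 1)) :=
    (isCompact_Icc.prod isCompact_Icc).image (by fun_prop)
  have hparU : (fun p : ℝ × ℝ => x₀ + p.1 • h + p.2 • t) ''
      (Set.Icc 0 1 ×ˢ Set.Icc 0 1) ⊆ U := by
    rintro _ ⟨⟨s, r⟩, ⟨hs, hr⟩, rfl⟩
    have h2 := hUc (hVU₀ (h₀ r hr)) (hVU₁ (h₁ r hr)) (sub_nonneg.2 hs.2) hs.1 (by ring)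
    have e : (1 - s) • (x₀ + r • t) + s • (x₁ + r • t) = x₀ + s • h + r • t := by
      rw [hh]
      module
    rwa [e] at h2
  obtain ⟨δ₀, hδ₀, hd₀⟩ := (hseg x₀).exists_cthickening_subset_open hV₀
    (by rintro _ ⟨r, hr, rfl⟩; exact h₀ r hr)
  obtain ⟨δ₁, hδ₁, hd₁⟩ := (hseg x₁).exists_cthickening_subset_open hV₁
    (by rintro _ ⟨r, hr, rfl⟩; exact h₁ r hr)
  obtain ⟨δ₂, hδ₂, hd₂⟩ := hpar.exists_cthickening_subset_open hU hparU
  obtain ⟨ε, hε, hε₀, hε₁, hε₂⟩ : ∃ ε : ℝ, 0 < ε ∧ ε ≤ δ₀ ∧ ε ≤ δ₁ ∧ ε ≤ δ₂ :=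
    ⟨min δ₀ (min δ₁ δ₂), by positivity, min_le_left _ _,
      (min_le_right _ _).trans (min_le_left _ _), (min_le_right _ _).trans (min_le_right _ _)⟩
  have hball : ∀ {S T : Set R3} {δ : ℝ} {x : R3}, Metric.cthickening δ S ⊆ T → ε ≤ δ → x ∈ S →
      Metric.closedBall x ε ⊆ T := fun hS hδ hx =>
    ((Metric.closedBall_subset_cthickening hx ε).trans (Metric.cthickening_mono hδ _)).trans hS
  have hF₀ : ∀ r ∈ Set.Icc (0 : ℝ) 1, mollify hε v (x₀ + r • t) = nedField a₀ b₀ (x₀ + r • t) :=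
    fun r hr => by
      refine mollify_eq_of_ae_eq hε (continuous_nedField _ _) (nedField_symm _ _) ?_
      filter_upwards [hN₀] with y hy hyb
      exact hy (hball hd₀ hε₀ ⟨r, hr, rfl⟩ (Metric.ball_subset_closedBall hyb))
  have hF₁ : ∀ r ∈ Set.Icc (0 : ℝ) 1, mollify hε v (x₁ + r • t) = nedField a₁ b₁ (x₁ + r • t) :=
    fun r hr => by
      refine mollify_eq_of_ae_eq hε (continuous_nedField _ _) (nedField_symm _ _) ?_
      filter_upwards [hN₁] with y hy hyb
      exact hy (hball hd₁ hε₁ ⟨r, hr, rfl⟩ (Metric.ball_subset_closedBall hyb))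
  have hbU : ∀ s ∈ Set.Icc (0 : ℝ) 1, ∀ r ∈ Set.Icc (0 : ℝ) 1,
      Metric.closedBall (x₀ + s • h + r • t) ε ⊆ U := fun s hs r hr =>
    hball hd₂ hε₂ ⟨(s, r), ⟨hs, hr⟩, rfl⟩
  have hFM : ∀ s ∈ Set.Icc (0 : ℝ) 1, ∀ r ∈ Set.Icc (0 : ℝ) 1,
      ‖mollify hε v (x₀ + s • h + r • t)‖ ≤ M := fun s hs r hr => by
    refine norm_mollify_le hε ?_
    filter_upwards [hvM] with y hy hyb
    exact hy (hbU s hs r hr (Metric.ball_subset_closedBall hyb))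
  have hWM : ∀ s ∈ Set.Icc (0 : ℝ) 1, ∀ r ∈ Set.Icc (0 : ℝ) 1,
      ‖mollify hε w (x₀ + s • h + r • t)‖ ≤ M := fun s hs r hr => by
    refine norm_mollify_le hε ?_
    filter_upwards [hwM] with y hy hyb
    exact hy (hbU s hs r hr (Metric.ball_subset_closedBall hyb))
  have hcd : ContDiff ℝ 1 (mollify hε v) :=
    (contDiff_mollify hε hv).of_le (by norm_cast)
  have stokes := integral_parallelogram hcd x₀ h t
  have hI : Set.uIoc (0 : ℝ) 1 ⊆ Set.Icc 0 1 := by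
    rw [Set.uIoc_of_le zero_le_one]
    exact Set.Ioc_subset_Icc_self
  have e₀ : (∫ r in (0 : ℝ)..1, dot (mollify hε v (x₀ + r • t)) (toC t))
      = dot (nedField a₀ b₀ x₀) (toC t) := by
    rw [intervalIntegral.integral_congr (g := fun _ => dot (nedField a₀ b₀ x₀) (toC t))]
    · simp
    · intro r hr
      rw [Set.uIcc_of_le zero_le_one] at hr
      simp only [hF₀ r hr, dot_nedField_add_smul]
  have e₁ : (∫ r in (0 : ℝ)..1, dot (mollify hε v (x₀ + h + r • t)) (toC t))
      = dot (nedField a₁ b₁ x₁) (toC t) := by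
    have hx : x₀ + h = x₁ := by rw [hh]; abel
    rw [hx, intervalIntegral.integral_congr (g := fun _ => dot (nedField a₁ b₁ x₁) (toC t))]
    · simp
    · intro r hr
      rw [Set.uIcc_of_le zero_le_one] at hr
      simp only [hF₁ r hr, dot_nedField_add_smul]
  have b1 : ‖∫ s in (0 : ℝ)..1, ∫ r in (0 : ℝ)..1,
      (dot (fderiv ℝ (mollify hε v) (x₀ + s • h + r • t) h) (toC t)
        - dot (fderiv ℝ (mollify hε v) (x₀ + s • h + r • t) t) (toC h))‖
      ≤ 3 * (M * ‖cross (toC h) (toC t)‖) := by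
    have := intervalIntegral.norm_integral_le_of_norm_le_const (a := 0) (b := 1)
      (C := 3 * (M * ‖cross (toC h) (toC t)‖)) (f := fun s => ∫ r in (0 : ℝ)..1,
      (dot (fderiv ℝ (mollify hε v) (x₀ + s • h + r • t) h) (toC t)
        - dot (fderiv ℝ (mollify hε v) (x₀ + s • h + r • t) t) (toC h))) fun s hs => by
        have := intervalIntegral.norm_integral_le_of_norm_le_const (a := 0) (b := 1)
          (C := 3 * (M * ‖cross (toC h) (toC t)‖)) (f := fun r =>
          (dot (fderiv ℝ (mollify hε v) (x₀ + s • h + r • t) h) (toC t)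
            - dot (fderiv ℝ (mollify hε v) (x₀ + s • h + r • t) t) (toC h))) fun r hr => by
            rw [fderiv_mollify_antisymm hv hw hcurl hε (hbU s (hI hs) r (hI hr))]
            refine (norm_dot_le _ _).trans ?_
            gcongr
            exact hWM s (hI hs) r (hI hr)
        simpa using this
    simpa using this
  have b2 : ∀ r ∈ Set.Icc (0 : ℝ) 1,
      ‖∫ s in (0 : ℝ)..1, dot (mollify hε v (x₀ + s • h + r • t)) (toC h)‖ ≤ 3 * (M * ‖h‖) := by
    intro r hr
    have := intervalIntegral.norm_integral_le_of_norm_le_const (a := 0) (b := 1)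
      (C := 3 * (M * ‖h‖))
      (f := fun s => dot (mollify hε v (x₀ + s • h + r • t)) (toC h)) fun s hs => by
        refine (norm_dot_le _ _).trans ?_
        rw [norm_toC]
        gcongr
        exact hFM s (hI hs) r hr
    simpa using this
  have b3 := b2 1 (by simp)
  have b4 := b2 0 (by simp)
  simp only [one_smul, zero_smul, add_zero] at b3 b4
  rw [e₀, e₁] at stokes
  have e : dot (nedField a₁ b₁ x₁) (toC t) - dot (nedField a₀ b₀ x₀) (toC t)
      = (∫ s in (0 : ℝ)..1, ∫ r in (0 : ℝ)..1,
          (dot (fderiv ℝ (mollify hε v) (x₀ + s • h + r • t) h) (toC t)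
            - dot (fderiv ℝ (mollify hε v) (x₀ + s • h + r • t) t) (toC h)))
        + ((∫ s in (0 : ℝ)..1, dot (mollify hε v (x₀ + s • h + t)) (toC h))
          - ∫ s in (0 : ℝ)..1, dot (mollify hε v (x₀ + s • h)) (toC h)) := by
    rw [stokes]
    ring
  rw [e]
  refine (norm_add_le _ _).trans ?_
  have := norm_sub_le (∫ s in (0 : ℝ)..1, dot (mollify hε v (x₀ + s • h + t)) (toC h))
    (∫ s in (0 : ℝ)..1, dot (mollify hε v (x₀ + s • h)) (toC h))
  linarith

/-- Tangential continuity: if the segment from `p` in direction `t` is a limit of segments on both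
of two regions where the field is a Nédélec field, the two tangential components agree. -/
theorem tangential_eq {v w : R3 → C3} (hv : LocallyIntegrable v)
    (hw : LocallyIntegrable w) {U : Set R3} (hU : IsOpen U) (hUc : Convex ℝ U)
    (hcurl : ∀ φ, IsTest U φ → ∫ x, dot (v x) (curl φ x) = ∫ x, dot (w x) (φ x))
    {M : ℝ} (hvM : ∀ᵐ x, x ∈ U → ‖v x‖ ≤ M) (hwM : ∀ᵐ x, x ∈ U → ‖w x‖ ≤ M)
    {V₀ V₁ : Set R3} (hV₀ : IsOpen V₀) (hV₁ : IsOpen V₁) (hVU₀ : V₀ ⊆ U) (hVU₁ : V₁ ⊆ U)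
    {a₀ b₀ a₁ b₁ : C3} (hN₀ : ∀ᵐ x, x ∈ V₀ → v x = nedField a₀ b₀ x)
    (hN₁ : ∀ᵐ x, x ∈ V₁ → v x = nedField a₁ b₁ x) {p t : R3}
    (h₀ : p ∈ closure {x | ∀ r ∈ Set.Icc (0 : ℝ) 1, x + r • t ∈ V₀})
    (h₁ : p ∈ closure {x | ∀ r ∈ Set.Icc (0 : ℝ) 1, x + r • t ∈ V₁}) :
    dot (nedField a₁ b₁ p) (toC t) = dot (nedField a₀ b₀ p) (toC t) := by
  obtain ⟨x, hx, hxp⟩ := mem_closure_iff_seq_limit.1 h₀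
  obtain ⟨y, hy, hyp⟩ := mem_closure_iff_seq_limit.1 h₁
  have hle := fun n => norm_tangential_sub_le hv hw hU hUc hcurl hvM hwM hV₀ hV₁ hVU₀ hVU₁ hN₀ hN₁
    (hx n) (hy n)
  have hyx : Filter.Tendsto (fun n => y n - x n) Filter.atTop (nhds 0) := by
    simpa using hyp.sub hxp
  have hc : Continuous fun z : R3 =>
      3 * (M * ‖cross (toC z) (toC t)‖) + 6 * (M * ‖z‖) := by
    unfold cross toC
    fun_prop
  have hlim := (hc.tendsto 0).comp hyx
  have h0 : cross (toC 0) (toC t) = 0 := by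
    ext i
    fin_cases i <;> simp [cross]
  simp only [h0, norm_zero, mul_zero, add_zero] at hlim
  have hl : Filter.Tendsto (fun n => dot (nedField a₁ b₁ (y n)) (toC t)
      - dot (nedField a₀ b₀ (x n)) (toC t)) Filter.atTop
      (nhds (dot (nedField a₁ b₁ p) (toC t) - dot (nedField a₀ b₀ p) (toC t))) :=
    (((continuous_dot (continuous_nedField a₁ b₁) continuous_const).tendsto p).comp hyp).sub
      (((continuous_dot (continuous_nedField a₀ b₀) continuous_const).tendsto p).comp hxp)
  exact sub_eq_zero.1 (tendsto_nhds_unique hl (squeeze_zero_norm hle hlim))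

/-! ### Tetrahedra and barycentric coordinates -/

/-- `T` is the set of vertices of a nondegenerate tetrahedron. -/
structure IsTet (T : Finset R3) : Prop where
  card_eq : T.card = 4
  indep : AffineIndependent ℝ ((↑) : T → R3)

theorem TetMesh.isTet {Ω : Set R3} (𝒯 : TetMesh Ω) {T : Finset R3} (hT : T ∈ 𝒯.cells) : IsTet T :=
  ⟨𝒯.card_eq T hT, 𝒯.indep T hT⟩

/-- The vertices of a tetrahedron as an affine basis of the space. -/
def IsTet.basis {T : Finset R3} (h : IsTet T) : AffineBasis T ℝ R3 :=
  ⟨(↑), h.indep, by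
    rw [h.indep.affineSpan_eq_top_iff_card_eq_finrank_add_one]
    simp [h.card_eq]⟩

open Classical in
/-- The barycentric coordinate of `T` at the vertex `y`, an affine function on the whole space. It
is zero if `y` is not a vertex of `T`. -/
def bary (T : Finset R3) (y : R3) : R3 →ᵃ[ℝ] ℝ :=
  if h : IsTet T ∧ y ∈ T then h.1.basis.coord ⟨y, h.2⟩ else 0

theorem bary_of_notMem {T : Finset R3} {y : R3} (hy : y ∉ T) : bary T y = 0 :=
  dif_neg fun h => hy h.2

theorem continuous_bary (T : Finset R3) (y : R3) : Continuous (bary T y) :=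
  (bary T y).continuous_of_finiteDimensional

namespace IsTet

variable {T : Finset R3} (h : IsTet T)

include h

theorem bary_eq (y : T) : bary T y = h.basis.coord y := by
  rw [bary, dif_pos ⟨h, y.2⟩]

theorem bary_self {y : R3} (hy : y ∈ T) : bary T y y = 1 := by
  rw [h.bary_eq ⟨y, hy⟩]
  exact h.basis.coord_apply_eq ⟨y, hy⟩

theorem bary_ne {y z : R3} (hz : z ∈ T) (hyz : y ≠ z) : bary T y z = 0 := by
  by_cases hy : y ∈ T
  · rw [h.bary_eq ⟨y, hy⟩]
    exact h.basis.coord_apply_ne (i := ⟨y, hy⟩) (j := ⟨z, hz⟩) fun e => hyz (congrArg Subtype.val e)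
  · rw [bary_of_notMem hy]
    rfl

theorem sum_bary (x : R3) : ∑ y ∈ T, bary T y x = 1 := by
  rw [← Finset.sum_coe_sort T]
  simp only [h.bary_eq]
  exact h.basis.sum_coord_apply_eq_one x

theorem sum_bary_smul (x : R3) : ∑ y ∈ T, bary T y x • y = x := by
  rw [← Finset.sum_coe_sort T]
  simp only [h.bary_eq]
  exact h.basis.linear_combination_coord_eq_self x

theorem range_basis : Set.range h.basis = (T : Set R3) := Subtype.range_coe

theorem mem_convexHull_iff {x : R3} :
    x ∈ convexHull ℝ (T : Set R3) ↔ ∀ y ∈ T, 0 ≤ bary T y x := by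
  rw [← h.range_basis, h.basis.convexHull_eq_nonneg_coord]
  simp only [Set.mem_ofPred_eq, ← h.bary_eq]
  exact ⟨fun H y hy => H ⟨y, hy⟩, fun H y => H y y.2⟩

theorem mem_interior_iff {x : R3} :
    x ∈ interior (convexHull ℝ (T : Set R3)) ↔ ∀ y ∈ T, 0 < bary T y x := by
  rw [← h.range_basis, h.basis.interior_convexHull]
  simp only [Set.mem_ofPred_eq, ← h.bary_eq]
  exact ⟨fun H y hy => H ⟨y, hy⟩, fun H y => H y y.2⟩

theorem interior_nonempty : (interior (convexHull ℝ (T : Set R3))).Nonempty := by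
  rw [interior_convexHull_nonempty_iff_affineSpan_eq_top, ← h.range_basis]
  exact h.basis.tot

theorem bary_eq_zero {F : Set R3} (hF : F ⊆ T) {x y : R3} (hx : x ∈ convexHull ℝ F) (hy : y ∉ F) :
    bary T y x = 0 := by
  have hc : Convex ℝ ((bary T y) ⁻¹' {0}) := (convex_singleton 0).affine_preimage _
  exact convexHull_min (fun z hz => h.bary_ne (hF hz) (by rintro rfl; exact hy hz)) hc hx

end IsTet

theorem isCompact_tet (T : Finset R3) : IsCompact (convexHull ℝ (T : Set R3)) :=
  T.finite_toSet.isCompact_convexHull (𝕜 := ℝ)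

theorem isClosed_tet (T : Finset R3) : IsClosed (convexHull ℝ (T : Set R3)) :=
  (isCompact_tet T).isClosed

theorem IsTet.mem_closure_interior {T : Finset R3} (h : IsTet T) {x : R3}
    (hx : x ∈ convexHull ℝ (T : Set R3)) : x ∈ closure (interior (convexHull ℝ (T : Set R3))) := by
  rw [(convex_convexHull ℝ _).closure_interior_eq_closure_of_nonempty_interior h.interior_nonempty]
  exact subset_closure hx

/-- Two tetrahedra with a common face have the same barycentric coordinates on it. -/
theorem bary_eq_bary {T T' : Finset R3} (h : IsTet T) (h' : IsTet T') {x y : R3}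
    (hx : x ∈ convexHull ℝ ((T : Set R3) ∩ T')) (hy : y ∈ T) (hy' : y ∈ T') :
    bary T y x = bary T' y x := by
  have hc : Convex ℝ ((bary T y - bary T' y) ⁻¹' {0}) := (convex_singleton 0).affine_preimage _
  have := convexHull_min (t := (bary T y - bary T' y) ⁻¹' {0}) (fun z hz => by
    change bary T y z - bary T' y z = 0
    by_cases e : y = z
    · rw [← e, h.bary_self hy, h'.bary_self hy', sub_self]
    · rw [h.bary_ne hz.1 e, h'.bary_ne hz.2 e, sub_self]) hc hx
  exact sub_eq_zero.1 this

/-! ### Incidence in a mesh -/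

section Mesh

variable {Ω : Set R3} {𝒯 : TetMesh Ω}

/-- Every vertex at which a common point of two tetrahedra has a positive barycentric coordinate is
common to both. -/
theorem mem_of_bary_pos {T T' : Finset R3} (hT : T ∈ 𝒯.cells) (hT' : T' ∈ 𝒯.cells) {x y : R3}
    (hx : x ∈ convexHull ℝ (T : Set R3)) (hx' : x ∈ convexHull ℝ (T' : Set R3))
    (hy : 0 < bary T y x) : y ∈ T' := by
  by_contra hn
  have h : x ∈ convexHull ℝ ((T : Set R3) ∩ T') := by
    rw [← 𝒯.inter T hT T' hT']
    exact ⟨hx, hx'⟩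
  rw [(𝒯.isTet hT).bary_eq_zero Set.inter_subset_left h fun e => hn e.2] at hy
  exact lt_irrefl _ hy

theorem eq_of_mem_interior {T T' : Finset R3} (hT : T ∈ 𝒯.cells) (hT' : T' ∈ 𝒯.cells) {x : R3}
    (hx : x ∈ interior (convexHull ℝ (T : Set R3))) (hx' : x ∈ convexHull ℝ (T' : Set R3)) :
    T = T' := by
  refine Finset.eq_of_subset_of_card_le (fun y hy => ?_) ?_
  · exact mem_of_bary_pos hT hT' (interior_subset hx) hx'
      ((𝒯.isTet hT).mem_interior_iff.1 hx y hy)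
  · rw [𝒯.card_eq T hT, 𝒯.card_eq T' hT']

theorem mem_of_vertex_mem {T T' : Finset R3} (hT : T ∈ 𝒯.cells) (hT' : T' ∈ 𝒯.cells) {y : R3}
    (hy : y ∈ T) (hy' : y ∈ convexHull ℝ (T' : Set R3)) : y ∈ T' :=
  mem_of_bary_pos hT hT' (subset_convexHull ℝ _ hy) hy' (by
    rw [(𝒯.isTet hT).bary_self hy]
    exact one_pos)

theorem tet_subset_closure {T : Finset R3} (hT : T ∈ 𝒯.cells) :
    convexHull ℝ (T : Set R3) ⊆ closure Ω := by
  rw [← 𝒯.cover]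
  exact Set.subset_biUnion_of_mem (u := fun T : Finset R3 => convexHull ℝ (T : Set R3)) hT

theorem exists_tet_mem {x : R3} (hx : x ∈ closure Ω) :
    ∃ T ∈ 𝒯.cells, x ∈ convexHull ℝ (T : Set R3) := by
  rw [← 𝒯.cover] at hx
  simpa using hx

/-- Near `x` there are only tetrahedra that contain `x`. -/
theorem eventually_mem_tet (C : Finset (Finset R3)) (x : R3) :
    ∀ᶠ y in nhds x, ∀ T ∈ C, y ∈ convexHull ℝ (T : Set R3) → x ∈ convexHull ℝ (T : Set R3) := by
  rw [Filter.eventually_all_finset]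
  intro T _
  by_cases h : x ∈ convexHull ℝ (T : Set R3)
  · exact Filter.Eventually.of_forall fun _ _ => h
  · filter_upwards [(isClosed_tet T).isOpen_compl.mem_nhds h] with y hy hy'
    exact absurd hy' hy

theorem mem_cellsAt {z : R3} {T : Finset R3} : T ∈ cellsAt 𝒯 z ↔ T ∈ 𝒯.cells ∧ z ∈ T := by
  simp [cellsAt]

theorem mem_of_mem_nodalPatch {z x : R3} (hx : x ∈ nodalPatch 𝒯 z) {T : Finset R3}
    (hT : T ∈ 𝒯.cells) (hxT : x ∈ convexHull ℝ (T : Set R3)) : z ∈ T := by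
  obtain ⟨y, hy, hyT⟩ := mem_closure_iff.1 ((𝒯.isTet hT).mem_closure_interior hxT)
    (nodalPatch 𝒯 z) isOpen_interior hx
  have h := interior_subset hy
  simp only [Set.mem_iUnion] at h
  obtain ⟨T', hT', hyT'⟩ := h
  rw [mem_cellsAt] at hT'
  rw [eq_of_mem_interior hT hT'.1 hyT hyT']
  exact hT'.2

theorem mem_nodalPatch_of_eventually {z x : R3} (hx : x ∈ Ω) (hopen : IsOpen Ω)
    (h : ∀ T ∈ 𝒯.cells, x ∈ convexHull ℝ (T : Set R3) → z ∈ T) : x ∈ nodalPatch 𝒯 z := by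
  rw [nodalPatch, mem_interior_iff_mem_nhds]
  filter_upwards [hopen.mem_nhds hx, eventually_mem_tet 𝒯.cells x] with y hy hy'
  obtain ⟨T, hT, hyT⟩ := exists_tet_mem (𝒯 := 𝒯) (subset_closure hy)
  simp only [Set.mem_iUnion]
  exact ⟨T, mem_cellsAt.2 ⟨hT, h T hT (hy' T hT hyT)⟩, hyT⟩

theorem mem_nodalPatch_self {y : R3} (hy : y ∈ Ω) (hopen : IsOpen Ω) {T : Finset R3}
    (hT : T ∈ 𝒯.cells) (hyT : y ∈ T) : y ∈ nodalPatch 𝒯 y :=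
  mem_nodalPatch_of_eventually hy hopen fun _ hT' hy' => mem_of_vertex_mem hT hT' hyT hy'

/-- The set `G` is open and made up of the tetrahedra in `C`. -/
structure IsPatch (𝒯 : TetMesh Ω) (G : Set R3) (C : Finset (Finset R3)) : Prop where
  isOpen : IsOpen G
  subset : C ⊆ 𝒯.cells
  interior_tet_subset : ∀ T ∈ C, interior (convexHull ℝ (T : Set R3)) ⊆ G
  cover : ∀ x ∈ G, ∃ T ∈ C, x ∈ convexHull ℝ (T : Set R3)

theorem isPatch_nodalPatch (𝒯 : TetMesh Ω) (z : R3) :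
    IsPatch 𝒯 (nodalPatch 𝒯 z) (cellsAt 𝒯 z) where
  isOpen := isOpen_interior
  subset := Finset.filter_subset _ _
  interior_tet_subset T hT := interior_mono
    (Set.subset_biUnion_of_mem (u := fun T : Finset R3 => convexHull ℝ (T : Set R3)) hT)
  cover x hx := by simpa using interior_subset hx

theorem isPatch_edgePatch (o : EdgeOrientation 𝒯) (E : Finset R3) :
    IsPatch 𝒯 (edgePatch o E) (edgeCells o E) where
  isOpen := isOpen_interior.union isOpen_interior
  subset := Finset.union_subset (Finset.filter_subset _ _) (Finset.filter_subset _ _)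
  interior_tet_subset T hT := by
    rcases Finset.mem_union.1 hT with h | h
    · exact ((isPatch_nodalPatch 𝒯 _).interior_tet_subset T h).trans Set.subset_union_left
    · exact ((isPatch_nodalPatch 𝒯 _).interior_tet_subset T h).trans Set.subset_union_right
  cover x hx := by
    rcases hx with h | h
    · obtain ⟨T, hT, hx⟩ := (isPatch_nodalPatch 𝒯 _).cover x h
      exact ⟨T, Finset.mem_union_left _ hT, hx⟩
    · obtain ⟨T, hT, hx⟩ := (isPatch_nodalPatch 𝒯 _).cover x h
      exact ⟨T, Finset.mem_union_right _ hT, hx⟩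

theorem isPatch_domain (𝒯 : TetMesh Ω) (hopen : IsOpen Ω) (hint : interior (closure Ω) ⊆ Ω) :
    IsPatch 𝒯 Ω 𝒯.cells where
  isOpen := hopen
  subset := subset_rfl
  interior_tet_subset _ hT := (interior_mono (tet_subset_closure hT)).trans hint
  cover _ hx := exists_tet_mem (subset_closure hx)

theorem nodalPatch_subset (hint : interior (closure Ω) ⊆ Ω) (z : R3) : nodalPatch 𝒯 z ⊆ Ω := by
  refine (interior_mono ?_).trans hint
  refine Set.iUnion₂_subset fun T hT => tet_subset_closure (mem_cellsAt.1 hT).1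

theorem edgePatch_subset (hint : interior (closure Ω) ⊆ Ω) (o : EdgeOrientation 𝒯)
    (E : Finset R3) : edgePatch o E ⊆ Ω :=
  Set.union_subset (nodalPatch_subset hint _) (nodalPatch_subset hint _)

namespace IsPatch

variable {G : Set R3} {C : Finset (Finset R3)} (h : IsPatch 𝒯 G C)

include h

theorem isTet {T : Finset R3} (hT : T ∈ C) : IsTet T := 𝒯.isTet (h.subset hT)

theorem isBounded : Bornology.IsBounded G := by
  have hb : Bornology.IsBounded (⋃ T ∈ C, convexHull ℝ (T : Set R3)) :=
    (Bornology.isBounded_biUnion_finset C).2 fun T _ => (isCompact_tet T).isBounded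
  refine hb.subset fun x hx => ?_
  obtain ⟨T, hT, hxT⟩ := h.cover x hx
  exact Set.mem_biUnion hT hxT

theorem measure_lt_top : volume G < ⊤ := h.isBounded.measure_lt_top

theorem isFiniteMeasure : IsFiniteMeasure (volume.restrict G) :=
  ⟨by rw [Measure.restrict_apply_univ]; exact h.measure_lt_top⟩

theorem ae_mem_interior :
    ∀ᵐ x, x ∈ G → ∃ T ∈ C, x ∈ interior (convexHull ℝ (T : Set R3)) := by
  have hf : ∀ᵐ x, ∀ T ∈ C, x ∉ frontier (convexHull ℝ (T : Set R3)) := by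
    rw [Filter.eventually_all_finset]
    intro T _
    exact measure_eq_zero_iff_ae_notMem.1 ((convex_convexHull ℝ (T : Set R3)).addHaar_frontier volume)
  filter_upwards [hf] with x hx hxG
  obtain ⟨T, hT, hxT⟩ := h.cover x hxG
  refine ⟨T, hT, ?_⟩
  by_contra hn
  exact hx T hT ⟨subset_closure hxT, hn⟩

theorem ae_restrict_mem_interior :
    ∀ᵐ x ∂volume.restrict G, ∃ T ∈ C, x ∈ interior (convexHull ℝ (T : Set R3)) := by
  rw [ae_restrict_iff' h.isOpen.measurableSet]
  exact h.ae_mem_interior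

/-- Only the tetrahedra of the patch meet it. -/
theorem mem_cells {T : Finset R3} (hT : T ∈ 𝒯.cells) {x : R3} (hx : x ∈ G)
    (hxT : x ∈ convexHull ℝ (T : Set R3)) : T ∈ C := by
  obtain ⟨y, hy, hyT⟩ := mem_closure_iff.1 ((𝒯.isTet hT).mem_closure_interior hxT) G h.isOpen hx
  obtain ⟨T', hT', hyT'⟩ := h.cover y hy
  rwa [eq_of_mem_interior hT (h.subset hT') hyT hyT']

end IsPatch

/-! ### Edges -/

theorem mem_edges {E : Finset R3} : E ∈ edges 𝒯 ↔ ∃ T ∈ 𝒯.cells, E ⊆ T ∧ E.card = 2 := by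
  simp [edges, Finset.mem_powersetCard]

theorem EdgeOrientation.eq_pair (o : EdgeOrientation 𝒯) {E : Finset R3} (hE : E ∈ edges 𝒯) :
    E = {o.tail E, o.head E} := by
  have := o.spec E hE
  exact_mod_cast this

theorem EdgeOrientation.tail_mem (o : EdgeOrientation 𝒯) {E : Finset R3} (hE : E ∈ edges 𝒯) :
    o.tail E ∈ E := by
  have : o.tail E ∈ (E : Set R3) := by
    rw [o.spec E hE]
    simp
  exact this

theorem EdgeOrientation.head_mem (o : EdgeOrientation 𝒯) {E : Finset R3} (hE : E ∈ edges 𝒯) :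
    o.head E ∈ E := by
  have : o.head E ∈ (E : Set R3) := by
    rw [o.spec E hE]
    simp
  exact this

theorem EdgeOrientation.tail_ne_head (o : EdgeOrientation 𝒯) {E : Finset R3} (hE : E ∈ edges 𝒯) :
    o.tail E ≠ o.head E := by
  intro h
  obtain ⟨T, -, -, hc⟩ := mem_edges.1 hE
  rw [o.eq_pair hE, h] at hc
  simp at hc

theorem EdgeOrientation.subset_iff (o : EdgeOrientation 𝒯) {E : Finset R3} (hE : E ∈ edges 𝒯)
    {T : Finset R3} : E ⊆ T ↔ o.tail E ∈ T ∧ o.head E ∈ T := by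
  constructor
  · exact fun h => ⟨h (o.tail_mem hE), h (o.head_mem hE)⟩
  · rintro ⟨h1, h2⟩
    rw [o.eq_pair hE]
    intro x hx
    rcases Finset.mem_insert.1 hx with rfl | hx
    · exact h1
    · rw [Finset.mem_singleton.1 hx]
      exact h2

theorem IsTet.bary_lineMap {T : Finset R3} (h : IsTet T) {y₁ y₂ : R3} (h₁ : y₁ ∈ T) (h₂ : y₂ ∈ T)
    (hne : y₁ ≠ y₂) (θ : ℝ) :
    bary T y₁ (AffineMap.lineMap y₁ y₂ θ) = 1 - θ ∧ bary T y₂ (AffineMap.lineMap y₁ y₂ θ) = θ ∧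
      ∀ y, y ≠ y₁ → y ≠ y₂ → bary T y (AffineMap.lineMap y₁ y₂ θ) = 0 := by
  simp only [AffineMap.apply_lineMap]
  refine ⟨?_, ?_, fun y hy₁ hy₂ => ?_⟩
  · rw [h.bary_self h₁, h.bary_ne h₂ hne]
    simp [AffineMap.lineMap_apply]
    ring
  · rw [h.bary_self h₂, h.bary_ne h₁ hne.symm]
    simp [AffineMap.lineMap_apply]
  · rw [h.bary_ne h₁ hy₁, h.bary_ne h₂ hy₂]
    simp

/-- A tetrahedron that contains an inner point of an edge contains the edge. -/
theorem subset_of_lineMap_mem (o : EdgeOrientation 𝒯) {E : Finset R3} (hE : E ∈ edges 𝒯)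
    {θ : ℝ} (hθ : θ ∈ Set.Ioo (0 : ℝ) 1) {T : Finset R3} (hT : T ∈ 𝒯.cells)
    (hp : AffineMap.lineMap (o.tail E) (o.head E) θ ∈ convexHull ℝ (T : Set R3)) : E ⊆ T := by
  obtain ⟨T₀, hT₀, hET₀, -⟩ := mem_edges.1 hE
  have hm := (o.subset_iff hE).1 hET₀
  have hb := (𝒯.isTet hT₀).bary_lineMap hm.1 hm.2 (o.tail_ne_head hE) θ
  have hp₀ : AffineMap.lineMap (o.tail E) (o.head E) θ ∈ convexHull ℝ (T₀ : Set R3) :=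
    (convex_convexHull ℝ (T₀ : Set R3)).lineMap_mem (subset_convexHull ℝ _ hm.1)
      (subset_convexHull ℝ _ hm.2) ⟨hθ.1.le, hθ.2.le⟩
  rw [o.subset_iff hE]
  constructor
  · exact mem_of_bary_pos hT₀ hT hp₀ hp (by rw [hb.1]; linarith [hθ.2])
  · exact mem_of_bary_pos hT₀ hT hp₀ hp (by rw [hb.2.1]; exact hθ.1)

theorem lineMap_mem_tet (o : EdgeOrientation 𝒯) {E : Finset R3} (hE : E ∈ edges 𝒯)
    {θ : ℝ} (hθ : θ ∈ Set.Icc (0 : ℝ) 1) {T : Finset R3} (hET : E ⊆ T) :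
    AffineMap.lineMap (o.tail E) (o.head E) θ ∈ convexHull ℝ (T : Set R3) :=
  (convex_convexHull ℝ (T : Set R3)).lineMap_mem
    (subset_convexHull ℝ _ (hET (o.tail_mem hE)))
    (subset_convexHull ℝ _ (hET (o.head_mem hE))) hθ

theorem mem_interiorEdges {E : Finset R3} : E ∈ interiorEdges 𝒯 ↔
    E ∈ edges 𝒯 ∧ ¬ convexHull ℝ (E : Set R3) ⊆ frontier Ω := by
  simp [interiorEdges]

theorem mem_edges_of_mem_interiorEdges {E : Finset R3} (hE : E ∈ interiorEdges 𝒯) : E ∈ edges 𝒯 :=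
  (mem_interiorEdges.1 hE).1

/-- An interior edge has an inner point in the domain. -/
theorem exists_lineMap_mem (hopen : IsOpen Ω) (o : EdgeOrientation 𝒯) {E : Finset R3}
    (hE : E ∈ interiorEdges 𝒯) :
    ∃ θ ∈ Set.Ioo (0 : ℝ) 1, AffineMap.lineMap (o.tail E) (o.head E) θ ∈ Ω := by
  obtain ⟨hE', hn⟩ := mem_interiorEdges.1 hE
  obtain ⟨q, hq, hqf⟩ := Set.not_subset.1 hn
  obtain ⟨T, hT, hET, -⟩ := mem_edges.1 hE'
  have hqΩ : q ∈ Ω := by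
    by_contra h
    refine hqf ⟨tet_subset_closure hT (convexHull_mono (Finset.coe_subset.2 hET) hq), ?_⟩
    rwa [hopen.interior_eq]
  rw [o.spec E hE', convexHull_pair, ← closure_openSegment] at hq
  obtain ⟨p, hp, hp'⟩ := mem_closure_iff.1 hq Ω hopen hqΩ
  rw [openSegment_eq_image_lineMap] at hp'
  obtain ⟨θ, hθ, rfl⟩ := hp'
  exact ⟨θ, hθ, hp⟩

theorem lineMap_mem_nodalPatch (hopen : IsOpen Ω) (o : EdgeOrientation 𝒯) {E : Finset R3}
    (hE : E ∈ edges 𝒯) {θ : ℝ} (hθ : θ ∈ Set.Ioo (0 : ℝ) 1)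
    (hp : AffineMap.lineMap (o.tail E) (o.head E) θ ∈ Ω) :
    AffineMap.lineMap (o.tail E) (o.head E) θ ∈ nodalPatch 𝒯 (o.tail E) :=
  mem_nodalPatch_of_eventually hp hopen fun _ hT hpT =>
    subset_of_lineMap_mem o hE hθ hT hpT (o.tail_mem hE)

/-! ### The domain is the interior of its closure -/

/-- A domain with Lipschitz boundary does not lie on both sides of it. Without this the mesh, which
covers the closure, would not determine the domain. -/
theorem interior_closure_subset_of_lipschitz (hopen : IsOpen Ω) (hlip : HasLipschitzBoundary Ω) :
    interior (closure Ω) ⊆ Ω := by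
  intro p hp
  by_contra hpn
  obtain ⟨A, r, K, g, hr, hg, hgr⟩ := hlip p ⟨interior_subset hp, by rwa [hopen.interior_eq]⟩
  -- the points below `p` are not in the closure
  let q : ℝ → R3 := fun s => p - s • A.symm (EuclideanSpace.single 2 1)
  have hq : ∀ s, A (q s) = A p - s • EuclideanSpace.single 2 1 := fun s => by simp [q]
  have hqc : Filter.Tendsto q (nhdsWithin 0 (Set.Ioi 0)) (nhds p) := by
    have : Continuous q := by fun_prop
    have h := this.tendsto 0
    simp only [q, zero_smul, sub_zero] at h
    exact h.mono_left nhdsWithin_le_nhds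
  have hpos : ∀ᶠ s : ℝ in nhdsWithin 0 (Set.Ioi 0), 0 < s := self_mem_nhdsWithin
  have hex : ∃ s : ℝ, 0 < s ∧ q s ∈ closure Ω ∧ q s ∈ Metric.ball p r := by
    have h1 := hqc.eventually (mem_interior_iff_mem_nhds.1 hp)
    have h2 := hqc.eventually (Metric.ball_mem_nhds p hr)
    obtain ⟨s, hs⟩ := (hpos.and (h1.and h2)).exists
    exact ⟨s, hs.1, hs.2.1, hs.2.2⟩
  obtain ⟨s, hs, hsc, hsb⟩ := hex
  have hF : Continuous fun y : R3 => g !₂[A y 0, A y 1] - A y 2 := by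
    have := hg.continuous
    fun_prop
  have hopen' : IsOpen (Metric.ball p r ∩ {y | 0 < g !₂[A y 0, A y 1] - A y 2}) :=
    Metric.isOpen_ball.inter (isOpen_lt continuous_const hF)
  have hp0 : A p 2 ≤ g !₂[A p 0, A p 1] :=
    not_lt.1 fun h => hpn ((hgr p (Metric.mem_ball_self hr)).2 h)
  obtain ⟨y, hy, hyΩ⟩ := mem_closure_iff.1 hsc _ hopen' ⟨hsb, by
    simp only [Set.mem_ofPred_eq, hq]
    simp
    linarith⟩
  have := (hgr y hy.1).1 hyΩ
  have h2 : 0 < g !₂[A y 0, A y 1] - A y 2 := hy.2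
  linarith

/-- If the doubled segment lies in a convex set, the segment is a limit of segments in its
interior. -/
theorem mem_closure_segment_interior {C : Set R3} (hC : Convex ℝ C) (hne : (interior C).Nonempty)
    {U : Set R3} (hU : IsOpen U) (hUc : Convex ℝ U) {x t : R3} (hx : x ∈ C)
    (hxt : x + (2 : ℝ) • t ∈ C) (hxU : x ∈ U) (hxtU : x + t ∈ U) :
    x ∈ closure {y | ∀ r ∈ Set.Icc (0 : ℝ) 1, y + r • t ∈ interior C ∩ U} := by
  obtain ⟨c, hc⟩ := hne
  have hcont : Continuous fun κ : ℝ => x + κ • (c - x) := by fun_prop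
  have h0 : Filter.Tendsto (fun κ : ℝ => x + κ • (c - x)) (nhdsWithin 0 (Set.Ioi 0)) (nhds x) := by
    have h := hcont.tendsto 0
    simp only [zero_smul, add_zero] at h
    exact h.mono_left nhdsWithin_le_nhds
  refine mem_closure_of_tendsto h0 ?_
  have h1 : ∀ᶠ κ : ℝ in nhdsWithin 0 (Set.Ioi 0), 0 < κ := self_mem_nhdsWithin
  have h2 : ∀ᶠ κ : ℝ in nhdsWithin 0 (Set.Ioi 0), κ < 1 / 2 :=
    nhdsWithin_le_nhds (Iio_mem_nhds (by norm_num))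
  have h3 := h0.eventually (hU.mem_nhds hxU)
  have h4 := (h0.add_const t).eventually (hU.mem_nhds hxtU)
  filter_upwards [h1, h2, h3, h4] with κ k1 k2 k3 k4 r hr
  constructor
  · have hm : x + (r / (1 - κ)) • t ∈ C := by
      have h5 : r / (1 - κ) ≤ 2 := by
        rw [div_le_iff₀ (by linarith)]
        linarith [hr.2]
      have h6 : 0 ≤ r / (1 - κ) := div_nonneg hr.1 (by linarith)
      have h7 := hC hx hxt (a := 1 - r / (1 - κ) / 2) (b := r / (1 - κ) / 2) (by linarith)
        (by linarith) (by ring)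
      have e : (1 - r / (1 - κ) / 2) • x + (r / (1 - κ) / 2) • (x + (2 : ℝ) • t)
          = x + (r / (1 - κ)) • t := by module
      rwa [e] at h7
    have h8 := hC.combo_self_interior_mem_interior hm hc (a := 1 - κ) (b := κ) (by linarith) k1
      (by ring)
    have hk : (1 - κ) * (r / (1 - κ)) = r := by
      have : 1 - κ ≠ 0 := by linarith
      field_simp
    have e : (1 - κ) • (x + (r / (1 - κ)) • t) + κ • c = x + κ • (c - x) + r • t := by
      rw [smul_add, smul_smul, hk]
      module
    rwa [e] at h8
  · have h5 := hUc k3 k4 (a := 1 - r) (b := r) (by linarith [hr.2]) hr.1 (by ring)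
    have e : (1 - r) • (x + κ • (c - x)) + r • (x + κ • (c - x) + t)
        = x + κ • (c - x) + r • t := by module
    rwa [e] at h5

end Mesh

/-! ### Weak curls -/

theorem IsTest.continuous {F : Type*} [NormedAddCommGroup F] [NormedSpace ℝ F]
    {G : Set R3} {φ : R3 → F} (h : IsTest G φ) : Continuous φ := h.smooth.continuous

theorem continuous_pd {f : R3 → ℂ} (hf : ContDiff ℝ 1 f) (i : Fin 3) : Continuous (pd i f) :=
  (hf.continuous_fderiv one_ne_zero).clm_apply continuous_const

theorem contDiff_coord {F : R3 → C3} {n : ℕ∞} (hF : ContDiff ℝ n F) (i : Fin 3) :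
    ContDiff ℝ n fun x => F x i :=
  ((EuclideanSpace.proj i : C3 →L[ℂ] ℂ).restrictScalars ℝ).contDiff.comp hF

/-- Integration by parts against a test function. -/
theorem integral_mul_pd {G : Set R3} {f g : R3 → ℂ} (hf : ContDiff ℝ 1 f) (hg : IsTest G g)
    (i : Fin 3) : ∫ x, f x * pd i g x = -∫ x, pd i f x * g x := by
  have hg1 : ContDiff ℝ 1 g := hg.smooth.of_le (by norm_cast)
  have hs : HasCompactSupport (pd i g) := hg.compact.fderiv_apply ℝ _
  refine integral_mul_fderiv_eq_neg_fderiv_mul_of_integrable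
    (v := EuclideanSpace.single i 1) ?_ ?_ ?_ (fun x _ => hf.differentiable one_ne_zero x)
    (fun x _ => hg1.differentiable one_ne_zero x)
  · exact ((continuous_pd hf i).mul hg.continuous).integrable_of_hasCompactSupport hg.compact.mul_left
  · exact (hf.continuous.mul (continuous_pd hg1 i)).integrable_of_hasCompactSupport hs.mul_left
  · exact (hf.continuous.mul hg.continuous).integrable_of_hasCompactSupport hg.compact.mul_left

theorem integral_three_sub {f₁ f₂ f₃ f₄ f₅ f₆ : R3 → ℂ} (h₁ : Integrable f₁) (h₂ : Integrable f₂)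
    (h₃ : Integrable f₃) (h₄ : Integrable f₄) (h₅ : Integrable f₅) (h₆ : Integrable f₆) :
    ∫ x, ((f₁ x - f₂ x) + (f₃ x - f₄ x) + (f₅ x - f₆ x))
      = ((∫ x, f₁ x) - ∫ x, f₂ x) + ((∫ x, f₃ x) - ∫ x, f₄ x) + ((∫ x, f₅ x) - ∫ x, f₆ x) := by
  have h12 : Integrable fun x => f₁ x - f₂ x := h₁.sub h₂
  have h34 : Integrable fun x => f₃ x - f₄ x := h₃.sub h₄
  have h56 : Integrable fun x => f₅ x - f₆ x := h₅.sub h₆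
  have h14 : Integrable fun x => (f₁ x - f₂ x) + (f₃ x - f₄ x) := h12.add h34
  rw [integral_add h14 h56, integral_add h12 h34, integral_sub h₁ h₂, integral_sub h₃ h₄,
    integral_sub h₅ h₆]

/-- The classical curl of a smooth field is its weak curl. -/
theorem integral_dot_curl {G : Set R3} {F φ : R3 → C3} (hF : ContDiff ℝ 1 F) (hφ : IsTest G φ) :
    ∫ x, dot (F x) (curl φ x) = ∫ x, dot (curl F x) (φ x) := by
  have hFc := fun i => contDiff_coord (n := 1) hF i
  have hφ1 : ∀ k, ContDiff ℝ 1 fun x => φ x k := fun k => (hφ.coord k).smooth.of_le (by norm_cast)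
  have i1 : ∀ j i k, Integrable fun x => F x j * pd i (fun y => φ y k) x := fun j i k =>
    ((hFc j).continuous.mul (continuous_pd (hφ1 k) i)).integrable_of_hasCompactSupport
      ((hφ.coord k).compact.fderiv_apply ℝ _).mul_left
  have i2 : ∀ j i k, Integrable fun x => pd i (fun y => F y j) x * φ x k := fun j i k =>
    ((continuous_pd (hFc j) i).mul (hφ.coord k).continuous).integrable_of_hasCompactSupport
      (hφ.coord k).compact.mul_left
  have e : ∀ j i k, ∫ x, F x j * pd i (fun y => φ y k) x
      = -∫ x, pd i (fun y => F y j) x * φ x k := fun j i k =>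
    integral_mul_pd (hFc j) (hφ.coord k) i
  have l : ∫ x, dot (F x) (curl φ x)
      = ((∫ x, F x 0 * pd 1 (fun y => φ y 2) x) - ∫ x, F x 0 * pd 2 (fun y => φ y 1) x)
      + ((∫ x, F x 1 * pd 2 (fun y => φ y 0) x) - ∫ x, F x 1 * pd 0 (fun y => φ y 2) x)
      + ((∫ x, F x 2 * pd 0 (fun y => φ y 1) x) - ∫ x, F x 2 * pd 1 (fun y => φ y 0) x) := by
    rw [← integral_three_sub (i1 _ _ _) (i1 _ _ _) (i1 _ _ _) (i1 _ _ _) (i1 _ _ _) (i1 _ _ _)]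
    refine integral_congr_ae (Filter.Eventually.of_forall fun x => ?_)
    simp [dot, curl, Fin.sum_univ_three]
    ring
  have r : ∫ x, dot (curl F x) (φ x)
      = ((∫ x, pd 1 (fun y => F y 2) x * φ x 0) - ∫ x, pd 2 (fun y => F y 1) x * φ x 0)
      + ((∫ x, pd 2 (fun y => F y 0) x * φ x 1) - ∫ x, pd 0 (fun y => F y 2) x * φ x 1)
      + ((∫ x, pd 0 (fun y => F y 1) x * φ x 2) - ∫ x, pd 1 (fun y => F y 0) x * φ x 2) := by
    rw [← integral_three_sub (i2 _ _ _) (i2 _ _ _) (i2 _ _ _) (i2 _ _ _) (i2 _ _ _) (i2 _ _ _)]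
    refine integral_congr_ae (Filter.Eventually.of_forall fun x => ?_)
    simp [dot, curl, Fin.sum_univ_three]
    ring
  rw [l, r]
  simp only [e]
  ring

theorem contDiff_nedField (a b : C3) {n : ℕ∞} : ContDiff ℝ n (nedField a b) := by
  rw [contDiff_piLp]
  intro i
  have hc : ∀ j : Fin 3, ContDiff ℝ n fun x : R3 => ((x j : ℝ) : ℂ) := fun j =>
    Complex.ofRealCLM.contDiff.comp (EuclideanSpace.proj j : R3 →L[ℝ] ℝ).contDiff
  fin_cases i
  · exact ((contDiff_const.mul (hc 2)).sub (contDiff_const.mul (hc 1))).add contDiff_const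
  · exact ((contDiff_const.mul (hc 0)).sub (contDiff_const.mul (hc 2))).add contDiff_const
  · exact ((contDiff_const.mul (hc 1)).sub (contDiff_const.mul (hc 0))).add contDiff_const

theorem fderiv_nedField (a b : C3) (x h : R3) :
    fderiv ℝ (nedField a b) x h = cross a (toC h) := by
  have hd : Differentiable ℝ (nedField a b) := (contDiff_nedField (n := 1) a b).differentiable one_ne_zero
  have hl : HasLineDerivAt ℝ (nedField a b) (fderiv ℝ (nedField a b) x h) x h :=
    (hd x).hasFDerivAt.hasLineDerivAt h
  have hl' : HasLineDerivAt ℝ (nedField a b) (cross a (toC h)) x h := by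
    have e : (fun r : ℝ => nedField a b (x + r • h))
        = fun r : ℝ => nedField a b x + r • cross a (toC h) := by
      funext r
      ext i
      fin_cases i <;> simp [nedField, cross, toC] <;> ring
    rw [HasLineDerivAt, e]
    have := ((hasDerivAt_id (0 : ℝ)).smul_const (cross a (toC h))).const_add (nedField a b x)
    simpa using this
  exact hl.unique hl'

theorem curl_nedField (a b : C3) (x : R3) : curl (nedField a b) x = (2 : ℂ) • a := by
  have hd := (contDiff_nedField (n := 1) a b).differentiable one_ne_zero x
  rw [curl]
  simp only [pd_apply hd, fderiv_nedField]
  ext i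
  fin_cases i <;> simp [cross, toC] <;> ring

/-! ### Extension by zero -/

theorem integral_dot_indicator {G : Set R3} (hG : MeasurableSet G) (v g : R3 → C3) :
    ∫ x, dot (G.indicator v x) (g x) = ∫ x in G, dot (v x) (g x) := by
  rw [← integral_indicator hG]
  refine integral_congr_ae (Filter.Eventually.of_forall fun x => ?_)
  by_cases hx : x ∈ G <;> simp [hx]

theorem integrable_indicator_of_memLp {G : Set R3} (hG : MeasurableSet G)
    (hfin : IsFiniteMeasure (volume.restrict G)) {v : R3 → C3}
    (hv : MemLp v 2 (volume.restrict G)) : Integrable (G.indicator v) := by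
  rw [integrable_indicator_iff hG]
  exact hv.integrable (by norm_num)

theorem IsTest.mono {F : Type*} [NormedAddCommGroup F] [NormedSpace ℝ F] {G G' : Set R3}
    (h : G ⊆ G') {φ : R3 → F} (hφ : IsTest G φ) : IsTest G' φ :=
  ⟨hφ.smooth, hφ.compact, hφ.supp.trans h⟩

theorem IsTest.contDiff_one {F : Type*} [NormedAddCommGroup F] [NormedSpace ℝ F] {G : Set R3}
    {φ : R3 → F} (hφ : IsTest G φ) : ContDiff ℝ 1 φ := hφ.smooth.of_le (by norm_cast)

theorem IsTest.curl_eq_zero {G : Set R3} {φ : R3 → C3} (hφ : IsTest G φ) {x : R3} (hx : x ∉ G) :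
    curl φ x = 0 := by
  have h : ∀ i k, pd i (fun y => φ y k) x = 0 := fun i k => by
    have h0 : x ∉ tsupport fun y => φ y k := fun hn => hx ((hφ.coord k).supp hn)
    have : x ∉ tsupport (fderiv ℝ fun y => φ y k) := fun hn => h0 (tsupport_fderiv_subset ℝ hn)
    rw [pd, image_eq_zero_of_notMem_tsupport this]
    rfl
  rw [curl]
  simp only [h, sub_zero]
  ext i
  fin_cases i <;> rfl

theorem IsTest.eq_zero {F : Type*} [NormedAddCommGroup F] [NormedSpace ℝ F] {G : Set R3}
    {φ : R3 → F} (hφ : IsTest G φ) {x : R3} (hx : x ∉ G) : φ x = 0 :=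
  image_eq_zero_of_notMem_tsupport fun h => hx (hφ.supp h)

/-- The bilinear product with a fixed square integrable field is a continuous functional. -/
theorem exists_dotCLM {G : Set R3} {g : R3 → C3} (hg : MemLp g 2 (volume.restrict G)) :
    ∃ L : L2V G →L[ℂ] ℂ, ∀ v, L v = ∫ x in G, dot (v x) (g x) := by
  have hs : MemLp (fun x => (WithLp.toLp 2 fun i => star (g x i) : C3)) 2 (volume.restrict G) :=
    MemLp.of_eval_piLp fun i => (hg.eval_piLp i).star
  refine ⟨innerSL ℂ (hs.toLp _), fun v => ?_⟩
  rw [innerSL_apply_apply, L2.inner_def]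
  refine integral_congr_ae ?_
  filter_upwards [hs.coeFn_toLp] with x hx
  rw [hx]
  simp [dot, PiLp.inner_apply]

theorem isClosed_weakCurl_test {G : Set R3} {φ : R3 → C3} {G' : Set R3} (hφ : IsTest G' φ) :
    IsClosed {p : CurlPair G | ∫ x in G, dot (p.fst x) (curl φ x) = ∫ x in G, dot (p.snd x) (φ x)} := by
  have h1 : MemLp (curl φ) 2 (volume.restrict G) := by
    have := (hφ.mono (Set.subset_univ _)).memLp_curl
    rw [Measure.restrict_univ] at this
    exact this.restrict G
  have h2 : MemLp φ 2 (volume.restrict G) := by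
    have := (hφ.mono (Set.subset_univ _)).memLp
    rw [Measure.restrict_univ] at this
    exact this.restrict G
  obtain ⟨L₁, hL₁⟩ := exists_dotCLM h1
  obtain ⟨L₂, hL₂⟩ := exists_dotCLM h2
  simp only [← hL₁, ← hL₂]
  exact isClosed_eq (L₁.continuous.comp (WithLp.fstL 2 ℂ _ _).continuous)
    (L₂.continuous.comp (WithLp.sndL 2 ℂ _ _).continuous)

/-- The extension by zero of a field of `H₀(curl)` has a weak curl on the whole space. -/
theorem weakCurl_of_mem_H0curl {G : Set R3} {p : CurlPair G} (hp : p ∈ H0curl G) {φ : R3 → C3}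
    (hφ : IsTest Set.univ φ) :
    ∫ x in G, dot (p.fst x) (curl φ x) = ∫ x in G, dot (p.snd x) (φ x) := by
  have h1 : MemLp (curl φ) 2 (volume.restrict G) := by
    have := hφ.memLp_curl
    rw [Measure.restrict_univ] at this
    exact this.restrict G
  have h2 : MemLp φ 2 (volume.restrict G) := by
    have := hφ.memLp
    rw [Measure.restrict_univ] at this
    exact this.restrict G
  let S : Submodule ℂ (CurlPair G) :=
    { carrier := {p | ∫ x in G, dot (p.fst x) (curl φ x) = ∫ x in G, dot (p.snd x) (φ x)}
      add_mem' := fun {p q} hp hq => by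
        rw [Set.mem_ofPred_eq, WithLp.add_fst, WithLp.add_snd, integral_dot_add _ _ h1,
          integral_dot_add _ _ h2]
        exact congrArg₂ (· + ·) hp hq
      zero_mem' := by
        rw [Set.mem_ofPred_eq, WithLp.zero_fst, WithLp.zero_snd, integral_dot_zero,
          integral_dot_zero]
      smul_mem' := fun c p hp => by
        rw [Set.mem_ofPred_eq, WithLp.smul_fst, WithLp.smul_snd, integral_dot_smul,
          integral_dot_smul]
        exact congrArg (c * ·) hp }
  refine Submodule.topologicalClosure_minimal _ (t := S) (Submodule.span_le.2 ?_)
    (isClosed_weakCurl_test hφ) hp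
  rintro q ⟨ψ, hψ, hq1, hq2⟩
  change ∫ x in G, dot (q.fst x) (curl φ x) = ∫ x in G, dot (q.snd x) (φ x)
  have e1 : ∫ x in G, dot (q.fst x) (curl φ x) = ∫ x in G, dot (ψ x) (curl φ x) :=
    integral_congr_ae (by filter_upwards [hq1] with x hx; rw [hx])
  have e2 : ∫ x in G, dot (q.snd x) (φ x) = ∫ x in G, dot (curl ψ x) (φ x) :=
    integral_congr_ae (by filter_upwards [hq2] with x hx; rw [hx])
  rw [e1, e2, setIntegral_eq_integral_of_forall_compl_eq_zero,
    setIntegral_eq_integral_of_forall_compl_eq_zero]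
  · exact integral_dot_curl hψ.contDiff_one hφ
  · intro x hx
    rw [hψ.curl_eq_zero hx, dot_zero_left]
  · intro x hx
    rw [hψ.eq_zero hx, dot_zero_left]

theorem H0curl_le_Hcurl (G : Set R3) : H0curl G ≤ Hcurl G := fun _ hp _ hφ =>
  weakCurl_of_mem_H0curl hp (hφ.mono (Set.subset_univ _))

/-! ### Piecewise Nédélec fields on a patch -/

theorem nedField_sub (a b a' b' : C3) (x : R3) :
    nedField (a - a') (b - b') x = nedField a b x - nedField a' b' x := by
  ext i
  fin_cases i <;> simp [nedField, cross] <;> ring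

theorem nedField_add_add (a b a' b' : C3) (x : R3) :
    nedField (a + a') (b + b') x = nedField a b x + nedField a' b' x := by
  ext i
  fin_cases i <;> simp [nedField, cross] <;> ring

theorem nedField_smul (z : ℂ) (a b : C3) (x : R3) :
    nedField (z • a) (z • b) x = z • nedField a b x := by
  ext i
  fin_cases i <;> simp [nedField, cross] <;> ring

theorem eq_zero_of_cross_eq_zero {a : C3}
    (h : ∀ i, cross a (toC (EuclideanSpace.single i 1)) = 0) : a = 0 := by
  have h0 := congrArg (fun v : C3 => v 1) (h 0)
  have h0' := congrArg (fun v : C3 => v 2) (h 0)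
  have h1 := congrArg (fun v : C3 => v 2) (h 1)
  simp [cross, toC] at h0 h0' h1
  ext i
  fin_cases i
  · simpa using h1
  · simpa using h0'
  · simpa using h0

theorem nedField_eq_zero {V : Set R3} (hV : IsOpen V) (hne : V.Nonempty) {a b : C3}
    (h : ∀ x ∈ V, nedField a b x = 0) : a = 0 ∧ b = 0 := by
  obtain ⟨c, hc⟩ := hne
  have ha : a = 0 := by
    refine eq_zero_of_cross_eq_zero fun i => ?_
    have e : fderiv ℝ (nedField a b) c = 0 := by
      have : nedField a b =ᶠ[nhds c] fun _ => 0 := by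
        filter_upwards [hV.mem_nhds hc] with x hx using h x hx
      rw [this.fderiv_eq]
      simp
    rw [← fderiv_nedField a b c, e]
    rfl
  refine ⟨ha, ?_⟩
  have := h c hc
  rwa [ha, nedField_zero_left] at this

theorem IsNedOn.add {G : Set R3} {T : Finset R3} {v w : L2V G} {a b a' b' : C3}
    (h : IsNedOn G T v a b) (h' : IsNedOn G T w a' b') :
    IsNedOn G T (v + w : L2V G) (a + a') (b + b') := by
  filter_upwards [h, h', Lp.coeFn_add v w] with x hx hx' hs hxT
  rw [hs, Pi.add_apply, hx hxT, hx' hxT, nedField_add_add]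

theorem IsNedOn.sub {G : Set R3} {T : Finset R3} {v w : L2V G} {a b a' b' : C3}
    (h : IsNedOn G T v a b) (h' : IsNedOn G T w a' b') :
    IsNedOn G T (v - w : L2V G) (a - a') (b - b') := by
  filter_upwards [h, h', Lp.coeFn_sub v w] with x hx hx' hs hxT
  rw [hs, Pi.sub_apply, hx hxT, hx' hxT, nedField_sub]

theorem IsNedOn.smul {G : Set R3} {T : Finset R3} {v : L2V G} {a b : C3}
    (h : IsNedOn G T v a b) (z : ℂ) : IsNedOn G T (z • v : L2V G) (z • a) (z • b) := by
  filter_upwards [h, Lp.coeFn_smul z v] with x hx hs hxT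
  rw [hs, Pi.smul_apply, hx hxT, nedField_smul]

/-- The fields that are Nédélec fields on every tetrahedron of `C`, without any continuity. -/
def piecewiseNed (G : Set R3) (C : Finset (Finset R3)) : Submodule ℂ (L2V G) where
  carrier := {v | ∀ T ∈ C, ∃ a b, IsNedOn G T v a b}
  add_mem' := by
    intro v w hv hw T hT
    obtain ⟨a, b, h⟩ := hv T hT
    obtain ⟨a', b', h'⟩ := hw T hT
    exact ⟨_, _, h.add h'⟩
  zero_mem' := by
    intro T _
    refine ⟨0, 0, ?_⟩
    filter_upwards [Lp.coeFn_zero C3 2 (volume.restrict G)] with x hx _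
    rw [hx, nedField_zero_left]
    rfl
  smul_mem' := by
    intro z v hv T hT
    obtain ⟨a, b, h⟩ := hv T hT
    exact ⟨_, _, h.smul z⟩

namespace IsPatch

variable {Ω : Set R3} {𝒯 : TetMesh Ω} {G : Set R3} {C : Finset (Finset R3)} (h : IsPatch 𝒯 G C)

include h

theorem ae_eq_of_isNedOn {T : Finset R3} (hT : T ∈ C) {v : R3 → C3} {a b : C3}
    (hv : IsNedOn G T v a b) :
    ∀ᵐ x, x ∈ interior (convexHull ℝ (T : Set R3)) → v x = nedField a b x := by
  rw [IsNedOn, ae_restrict_iff' h.isOpen.measurableSet] at hv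
  filter_upwards [hv] with x hx hxT
  exact hx (h.interior_tet_subset T hT hxT) (interior_subset hxT)

theorem isNedOn_unique {T : Finset R3} (hT : T ∈ C) {v : R3 → C3} {a b a' b' : C3}
    (h₁ : IsNedOn G T v a b) (h₂ : IsNedOn G T v a' b') : a = a' ∧ b = b' := by
  have hae : nedField a b =ᵐ[volume.restrict (interior (convexHull ℝ (T : Set R3)))]
      nedField a' b' := by
    rw [Filter.EventuallyEq, ae_restrict_iff' isOpen_interior.measurableSet]
    filter_upwards [h.ae_eq_of_isNedOn hT h₁, h.ae_eq_of_isNedOn hT h₂] with x h1 h2 hx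
    rw [← h1 hx, ← h2 hx]
  have heq := Measure.eqOn_open_of_ae_eq hae isOpen_interior (continuous_nedField _ _).continuousOn
    (continuous_nedField _ _).continuousOn
  have := nedField_eq_zero isOpen_interior (h.isTet hT).interior_nonempty (a := a - a')
    (b := b - b') fun x hx => by rw [nedField_sub, heq hx, sub_self]
  exact ⟨sub_eq_zero.1 this.1, sub_eq_zero.1 this.2⟩

/-- The coefficients of the Nédélec fields as a linear map. -/
theorem exists_coeff : ∃ L : piecewiseNed G C →ₗ[ℂ] ((T : C) → C3 × C3),
    ∀ (v : piecewiseNed G C) (T : C), IsNedOn G T (v : L2V G) (L v T).1 (L v T).2 := by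
  choose a b hab using fun (v : piecewiseNed G C) (T : C) => v.2 T T.2
  refine ⟨{ toFun := fun v T => (a v T, b v T), map_add' := fun v w => ?_,
            map_smul' := fun z v => ?_ }, hab⟩
  · funext T
    have := h.isNedOn_unique T.2 (hab (v + w) T) ((hab v T).add (hab w T))
    exact Prod.ext this.1 this.2
  · funext T
    have := h.isNedOn_unique T.2 (hab (z • v) T) ((hab v T).smul z)
    exact Prod.ext this.1 this.2

theorem eq_zero_of_isNedOn_zero {v : L2V G} (hv : ∀ T ∈ C, IsNedOn G T v 0 0) : v = 0 := by
  refine Lp.ext ?_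
  have h1 : ∀ᵐ x ∂volume.restrict G, ∀ T ∈ C,
      x ∈ convexHull ℝ (T : Set R3) → v x = nedField 0 0 x := by
    rw [Filter.eventually_all_finset]
    exact hv
  filter_upwards [h1, h.ae_restrict_mem_interior, Lp.coeFn_zero C3 2 (volume.restrict G)]
    with x hx hxi hx0
  obtain ⟨T, hT, hxT⟩ := hxi
  rw [hx0, hx T hT (interior_subset hxT), nedField_zero_left]
  rfl

theorem finiteDimensional_piecewiseNed : FiniteDimensional ℂ (piecewiseNed G C) := by
  obtain ⟨L, hL⟩ := h.exists_coeff
  refine FiniteDimensional.of_injective L ((injective_iff_map_eq_zero L).2 fun v hv => ?_)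
  refine Subtype.ext (h.eq_zero_of_isNedOn_zero fun T hT => ?_)
  have := hL v ⟨T, hT⟩
  rw [hv] at this
  exact this

/-- The curl of a piecewise Nédélec field `a × x + b` in `H(curl)` is `2 a`. -/
theorem snd_ae_eq {q : CurlPair G} (hq : q ∈ Hcurl G) {T : Finset R3} (hT : T ∈ C) {a b : C3}
    (hab : IsNedOn G T q.fst a b) :
    ∀ᵐ x, x ∈ interior (convexHull ℝ (T : Set R3)) → q.snd x = (2 : ℂ) • a := by
  have hfin := h.isFiniteMeasure
  set V := interior (convexHull ℝ (T : Set R3)) with hV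
  have hVo : IsOpen V := isOpen_interior
  have hVG : V ⊆ G := h.interior_tet_subset T hT
  have hconst : ∀ c : C3, MemLp (fun _ : R3 => c) 2 (volume.restrict G) := fun c => memLp_const c
  have key : ∀ k : Fin 3, ∀ᵐ x, x ∈ V → q.snd x k - ((2 : ℂ) • a) k = 0 := by
    intro k
    have hint : IntegrableOn (fun x => q.snd x k - ((2 : ℂ) • a) k) G :=
      (((Lp.memLp q.snd).eval_piLp k).integrable (by norm_num)).sub (integrable_const _)
    refine hVo.ae_eq_zero_of_integral_contDiff_smul_eq_zero
      ((hint.mono_set hVG).locallyIntegrableOn) fun g hg hgc hgs => ?_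
    let φ : R3 → C3 := fun x => (g x) • EuclideanSpace.single k (1 : ℂ)
    have hsub : Function.support φ ⊆ Function.support g := fun x hx hn => hx (by simp [φ, hn])
    have hφ : IsTest V φ := ⟨hg.smul contDiff_const,
      hgc.mono hsub, (closure_mono hsub).trans hgs⟩
    have hφG := hφ.mono hVG
    have hdot : ∀ (w : C3) x, dot w (φ x) = g x • w k := fun w x => by
      simp only [φ, dot_real_smul_right]
      simp [dot]
    have e1 : ∫ x in G, dot (q.fst x) (curl φ x) = ∫ x in G, dot ((2 : ℂ) • a) (φ x) := by
      have e2 : ∫ x in G, dot (q.fst x) (curl φ x) = ∫ x in G, dot (nedField a b x) (curl φ x) := by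
        refine integral_congr_ae ?_
        filter_upwards [hab] with x hx
        by_cases hxV : x ∈ V
        · rw [hx (interior_subset hxV)]
        · rw [hφ.curl_eq_zero hxV, dot_zero_right, dot_zero_right]
      rw [e2, setIntegral_eq_integral_of_forall_compl_eq_zero,
        setIntegral_eq_integral_of_forall_compl_eq_zero, integral_dot_curl (contDiff_nedField a b) hφ]
      · simp only [curl_nedField]
      · intro x hx
        rw [hφG.eq_zero hx, dot_zero_right]
      · intro x hx
        rw [hφG.curl_eq_zero hx, dot_zero_right]
    rw [hq φ hφG, ← sub_eq_zero, ← integral_sub (integrable_dot (Lp.memLp _) hφG.memLp)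
      (integrable_dot (hconst _) hφG.memLp)] at e1
    rw [← e1, eq_comm, setIntegral_eq_integral_of_forall_compl_eq_zero]
    · refine integral_congr_ae (Filter.Eventually.of_forall fun x => ?_)
      simp only [hdot, smul_sub]
    · intro x hx
      rw [hφG.eq_zero hx, dot_zero_right, dot_zero_right, sub_zero]
  filter_upwards [ae_all_iff.2 key] with x hx hxV
  ext k
  exact sub_eq_zero.1 (hx k hxV)

theorem snd_eq_zero_of_isNedOn {q : CurlPair G} (hq : q ∈ Hcurl G)
    (hab : ∀ T ∈ C, ∃ b, IsNedOn G T q.fst 0 b) : q.snd = 0 := by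
  refine Lp.ext ?_
  have h1 : ∀ᵐ x, ∀ T ∈ C, x ∈ interior (convexHull ℝ (T : Set R3)) → q.snd x = 0 := by
    rw [Filter.eventually_all_finset]
    intro T hT
    obtain ⟨b, hb⟩ := hab T hT
    filter_upwards [h.snd_ae_eq hq hT hb] with x hx hxT
    rw [hx hxT, smul_zero]
  filter_upwards [ae_restrict_of_ae h1, h.ae_restrict_mem_interior,
    Lp.coeFn_zero C3 2 (volume.restrict G)] with x hx hxi hx0
  obtain ⟨T, hT, hxT⟩ := hxi
  rw [hx0, hx T hT hxT]
  rfl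

theorem isNedOn_zero_of_snd_eq_zero {q : CurlPair G} (hq : q ∈ Hcurl G) (hs : q.snd = 0)
    {T : Finset R3} (hT : T ∈ C) {a b : C3} (hab : IsNedOn G T q.fst a b) : a = 0 := by
  have h0 : ∀ᵐ x, x ∈ G → q.snd x = 0 := by
    rw [← ae_restrict_iff' h.isOpen.measurableSet, hs]
    filter_upwards [Lp.coeFn_zero C3 2 (volume.restrict G)] with x hx
    rw [hx]
    rfl
  have h1 := h.snd_ae_eq hq hT hab
  have hpos : volume (interior (convexHull ℝ (T : Set R3))) ≠ 0 :=
    (isOpen_interior.measure_pos volume (h.isTet hT).interior_nonempty).ne'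
  by_contra hn
  refine hpos (measure_mono_null (fun x hx => ?_) (ae_iff.1 (h0.and h1)))
  rintro ⟨h2, h3⟩
  rw [h2 (h.interior_tet_subset T hT hx)] at h3
  have h4 := h3 hx
  exact hn ((smul_eq_zero.1 h4.symm).resolve_left two_ne_zero)

/-- A piecewise Nédélec field in `H(curl)` is determined by its field. -/
theorem eq_zero_of_fst_eq_zero {q : CurlPair G} (hq : q ∈ Hcurl G) (hf : q.fst = 0) : q = 0 := by
  have hs : q.snd = 0 := h.snd_eq_zero_of_isNedOn hq fun T _ => ⟨0, by
    rw [hf]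
    filter_upwards [Lp.coeFn_zero C3 2 (volume.restrict G)] with x hx _
    rw [hx, nedField_zero_left]
    rfl⟩
  rw [← WithLp.toLp_ofLp 2 q]
  have : q.ofLp = 0 := Prod.ext hf hs
  rw [this, WithLp.toLp_zero]

theorem finiteDimensional_nedelec {V : Submodule ℂ (CurlPair G)} (hV : V ≤ Hcurl G) :
    FiniteDimensional ℂ (nedelec C V) := by
  have := h.finiteDimensional_piecewiseNed
  let L : nedelec C V →ₗ[ℂ] piecewiseNed G C :=
    { toFun := fun q => ⟨(q : CurlPair G).fst, q.2.2⟩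
      map_add' := fun _ _ => rfl
      map_smul' := fun _ _ => rfl }
  refine FiniteDimensional.of_injective L ((injective_iff_map_eq_zero L).2 fun q hq => ?_)
  exact Subtype.ext (h.eq_zero_of_fst_eq_zero (hV q.2.1) (congrArg Subtype.val hq))

omit h in
theorem exists_norm_nedField_le (a b : C3) {S : Set R3} (hS : Bornology.IsBounded S) :
    ∃ M, ∀ x ∈ S, ‖nedField a b x‖ ≤ M := by
  obtain ⟨M, hM⟩ := (hS.isCompact_closure).exists_bound_of_continuousOn
    (continuous_nedField a b).continuousOn
  exact ⟨M, fun x hx => hM x (subset_closure hx)⟩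

/-- A piecewise Nédélec field in `H(curl)` and its curl are bounded. -/
theorem exists_bound {q : CurlPair G} (hq : q ∈ nedelec C (Hcurl G)) :
    ∃ M, (∀ᵐ x, x ∈ G → ‖q.fst x‖ ≤ M) ∧ ∀ᵐ x, x ∈ G → ‖q.snd x‖ ≤ M := by
  choose! a b hab using hq.2
  choose! B hB using fun T (_ : T ∈ C) =>
    exists_norm_nedField_le (a T) (b T) (isCompact_tet T).isBounded
  have hle : ∀ T ∈ C, |B T| + ‖(2 : ℂ) • a T‖ ≤ ∑ T ∈ C, (|B T| + ‖(2 : ℂ) • a T‖) := fun T hT =>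
    Finset.single_le_sum (f := fun T => |B T| + ‖(2 : ℂ) • a T‖) (fun _ _ => by positivity) hT
  have h1 : ∀ᵐ x, ∀ T ∈ C, x ∈ interior (convexHull ℝ (T : Set R3)) →
      q.fst x = nedField (a T) (b T) x := by
    rw [Filter.eventually_all_finset]
    exact fun T hT => h.ae_eq_of_isNedOn hT (hab T hT)
  have h2 : ∀ᵐ x, ∀ T ∈ C, x ∈ interior (convexHull ℝ (T : Set R3)) →
      q.snd x = (2 : ℂ) • a T := by
    rw [Filter.eventually_all_finset]
    exact fun T hT => h.snd_ae_eq hq.1 hT (hab T hT)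
  refine ⟨∑ T ∈ C, (|B T| + ‖(2 : ℂ) • a T‖), ?_, ?_⟩
  · filter_upwards [h1, h.ae_mem_interior] with x hx hxi hxG
    obtain ⟨T, hT, hxT⟩ := hxi hxG
    rw [hx T hT hxT]
    have := hB T hT x (interior_subset hxT)
    have := le_abs_self (B T)
    have := hle T hT
    have := norm_nonneg ((2 : ℂ) • a T)
    linarith
  · filter_upwards [h2, h.ae_mem_interior] with x hx hxi hxG
    obtain ⟨T, hT, hxT⟩ := hxi hxG
    rw [hx T hT hxT]
    have := abs_nonneg (B T)
    have := hle T hT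
    linarith

/-- The tangential components of a piecewise Nédélec field in `H(curl)` along a common segment of
two tetrahedra agree, near points of the patch. -/
theorem tangential_eq_of_mem {q : CurlPair G} (hq : q ∈ nedelec C (Hcurl G)) {T T' : Finset R3}
    (hT : T ∈ C) (hT' : T' ∈ C) {a b a' b' : C3} (hab : IsNedOn G T q.fst a b)
    (hab' : IsNedOn G T' q.fst a' b') {x t : R3} (hx : x ∈ G)
    (hxT : x ∈ convexHull ℝ (T : Set R3)) (hxT' : x ∈ convexHull ℝ (T' : Set R3))
    (htT : x + t ∈ convexHull ℝ (T : Set R3)) (htT' : x + t ∈ convexHull ℝ (T' : Set R3)) :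
    dot (nedField a b x) (toC t) = dot (nedField a' b' x) (toC t) := by
  have hfin := h.isFiniteMeasure
  have hGm := h.isOpen.measurableSet
  obtain ⟨ρ, hρ, hball⟩ := Metric.isOpen_iff.1 h.isOpen x hx
  obtain ⟨s, hs0, hs1, hs2⟩ : ∃ s : ℝ, 0 < s ∧ s ≤ 1 / 2 ∧ s * ‖t‖ < ρ := by
    refine ⟨min (1 / 2) (ρ / (2 * (‖t‖ + 1))), by positivity, min_le_left _ _, ?_⟩
    calc min (1 / 2) (ρ / (2 * (‖t‖ + 1))) * ‖t‖ ≤ ρ / (2 * (‖t‖ + 1)) * ‖t‖ := by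
          gcongr
          exact min_le_right _ _
      _ < ρ := by
          rw [div_mul_eq_mul_div, div_lt_iff₀ (by positivity)]
          nlinarith [norm_nonneg t]
  have hxU : x ∈ Metric.ball x ρ := Metric.mem_ball_self hρ
  have hxtU : x + s • t ∈ Metric.ball x ρ := by
    rw [mem_ball_iff_norm, add_sub_cancel_left, norm_smul, Real.norm_of_nonneg hs0.le]
    exact hs2
  have h2t : ∀ {T : Finset R3}, x ∈ convexHull ℝ (T : Set R3) → x + t ∈ convexHull ℝ (T : Set R3) →
      x + (2 : ℝ) • s • t ∈ convexHull ℝ (T : Set R3) := fun h1 h2 => by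
    have := (convex_convexHull ℝ _) h1 h2 (a := 1 - 2 * s) (b := 2 * s) (by linarith)
      (by linarith) (by ring)
    have e : (1 - 2 * s) • x + (2 * s) • (x + t) = x + (2 : ℝ) • s • t := by module
    rwa [e] at this
  obtain ⟨M, hM1, hM2⟩ := h.exists_bound hq
  have hae : ∀ {T : Finset R3} {a b : C3}, T ∈ C → IsNedOn G T q.fst a b → ∀ᵐ y,
      y ∈ interior (convexHull ℝ (T : Set R3)) ∩ Metric.ball x ρ →
        G.indicator q.fst y = nedField a b y := fun hT hab => by
    filter_upwards [h.ae_eq_of_isNedOn hT hab] with y hy hyV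
    rw [Set.indicator_of_mem (hball hyV.2), hy hyV.1]
  have key := tangential_eq (v := G.indicator q.fst) (w := G.indicator q.snd)
    (integrable_indicator_of_memLp hGm hfin (Lp.memLp _)).locallyIntegrable
    (integrable_indicator_of_memLp hGm hfin (Lp.memLp _)).locallyIntegrable
    (U := Metric.ball x ρ) Metric.isOpen_ball (convex_ball x ρ)
    (fun φ hφ => by
      rw [integral_dot_indicator hGm, integral_dot_indicator hGm]
      exact hq.1 φ (hφ.mono hball)) (M := M)
    (by
      filter_upwards [hM1] with y hy hyU
      rw [Set.indicator_of_mem (hball hyU)]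
      exact hy (hball hyU))
    (by
      filter_upwards [hM2] with y hy hyU
      rw [Set.indicator_of_mem (hball hyU)]
      exact hy (hball hyU))
    (isOpen_interior.inter Metric.isOpen_ball) (isOpen_interior.inter Metric.isOpen_ball)
    Set.inter_subset_right Set.inter_subset_right (hae hT' hab') (hae hT hab) (t := s • t)
    (mem_closure_segment_interior (convex_convexHull ℝ _) (h.isTet hT').interior_nonempty
      Metric.isOpen_ball (convex_ball x ρ) hxT' (h2t hxT' htT') hxU hxtU)
    (mem_closure_segment_interior (convex_convexHull ℝ _) (h.isTet hT).interior_nonempty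
      Metric.isOpen_ball (convex_ball x ρ) hxT (h2t hxT htT) hxU hxtU)
  rw [toC_smul, dot_smul_right, dot_smul_right] at key
  exact mul_left_cancel₀ (by exact_mod_cast hs0.ne') key

end IsPatch

/-! ### Piecewise Lipschitz functions -/

/-- A function that is continuous on a convex set and Lipschitz on each of finitely many pieces
that cover it is Lipschitz. -/
theorem lipschitzOnWith_of_cover {ι E F : Type*} [NormedAddCommGroup E] [NormedSpace ℝ E]
    [NormedAddCommGroup F] {U : Set E} (hU : Convex ℝ U) {f : E → F} (hf : ContinuousOn f U)
    (C : Finset ι) (S : ι → Set E) (hcov : ∀ x ∈ U, ∃ i ∈ C, x ∈ S i) {L : ℝ≥0}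
    (hL : ∀ i ∈ C, LipschitzOnWith L f (S i ∩ U)) : LipschitzOnWith L f U := by
  refine LipschitzOnWith.of_dist_le_mul fun x hx y hy => ?_
  let γ : ℝ → E := fun t => AffineMap.lineMap x y t
  have hγU : ∀ t ∈ Set.Icc (0 : ℝ) 1, γ t ∈ U := fun t ht => hU.lineMap_mem hx hy ht
  have hγc : Continuous γ := AffineMap.lineMap_continuous
  have hγd : ∀ s t, dist (γ s) (γ t) = dist s t * dist x y := fun s t =>
    dist_lineMap_lineMap x y s t
  have hgc : ContinuousOn (fun t => f (γ t)) (Set.Icc 0 1) :=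
    hf.comp hγc.continuousOn hγU
  let A : Set ℝ := {t | dist (f (γ t)) (f (γ 0)) ≤ L * (t * dist x y)}
  have hA : Set.Icc (0 : ℝ) 1 ⊆ A := by
    refine IsClosed.Icc_subset_of_forall_exists_gt ?_ ?_ ?_
    · have h1 : ContinuousOn (fun t => dist (f (γ t)) (f (γ 0)) - L * (t * dist x y))
          (Set.Icc 0 1) :=
        (continuous_dist.comp_continuousOn (hgc.prodMk continuousOn_const)).sub (by fun_prop)
      have h2 := h1.preimage_isClosed_of_isClosed isClosed_Icc (isClosed_Iic (a := 0))
      convert h2 using 1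
      ext t
      simp [A, and_comm]
    · simp [A]
    · intro t ht y' hy'
      -- one of the pieces contains points of the segment that accumulate at `t` from the right
      have hfreq : ∃ i ∈ C, ∃ᶠ s in nhdsWithin t (Set.Ioi t), γ s ∈ S i := by
        by_contra hcon
        push Not at hcon
        have h1 : ∀ᶠ s in nhdsWithin t (Set.Ioi t), ∀ i ∈ C, γ s ∉ S i := by
          rw [Filter.eventually_all_finset]
          exact fun i hi => hcon i hi
        have h2 : ∀ᶠ s in nhdsWithin t (Set.Ioi t), s ∈ Set.Ioo t 1 := Ioo_mem_nhdsGT ht.2.2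
        obtain ⟨s, hs1, hs2⟩ := (h1.and h2).exists
        obtain ⟨i, hi, hs⟩ := hcov (γ s) (hγU s ⟨ht.2.1.trans hs2.1.le, hs2.2.le⟩)
        exact hs1 i hi hs
      obtain ⟨i, hi, hfr⟩ := hfreq
      have hmin : t < min y' 1 := lt_min hy' ht.2.2
      have h2 : ∀ᶠ s in nhdsWithin t (Set.Ioi t), s ∈ Set.Ioo t (min y' 1) := Ioo_mem_nhdsGT hmin
      obtain ⟨s, hs1, hs2⟩ := (hfr.and_eventually h2).exists
      have hs01 : s ∈ Set.Icc (0 : ℝ) 1 :=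
        ⟨ht.2.1.trans hs2.1.le, (hs2.2.trans_le (min_le_right _ _)).le⟩
      have ht01 : t ∈ Set.Icc (0 : ℝ) 1 := ⟨ht.2.1, ht.2.2.le⟩
      refine ⟨s, ?_, hs2.1, (hs2.2.trans_le (min_le_left _ _)).le⟩
      have key : dist (f (γ s)) (f (γ t)) ≤ L * ((s - t) * dist x y) := by
        have hlim : Filter.Tendsto (fun r => dist (f (γ s)) (f (γ r)))
            (nhdsWithin t (Set.Ioi t)) (nhds (dist (f (γ s)) (f (γ t)))) := by
          have h3 : nhdsWithin t (Set.Ioi t) ≤ nhdsWithin t (Set.Icc 0 1) := by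
            rw [← nhdsWithin_Ioo_eq_nhdsGT ht.2.2]
            exact nhdsWithin_mono _ fun r hr => ⟨ht.2.1.trans hr.1.le, hr.2.le⟩
          exact tendsto_const_nhds.dist ((hgc t ht01).mono_left h3)
        have hlim2 : Filter.Tendsto (fun r => L * (dist s r * dist x y))
            (nhdsWithin t (Set.Ioi t)) (nhds (L * (dist s t * dist x y))) := by
          refine Filter.Tendsto.mono_left ?_ nhdsWithin_le_nhds
          exact Continuous.tendsto (by fun_prop) t
        have hst : dist s t = s - t := by
          rw [Real.dist_eq, abs_of_pos (sub_pos.2 hs2.1)]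
        rw [← hst]
        have h4 : ∀ᶠ r in nhdsWithin t (Set.Ioi t), r ∈ Set.Ioo t 1 := Ioo_mem_nhdsGT ht.2.2
        refine le_of_tendsto_of_frequently (f := fun r => dist (f (γ s)) (f (γ r)) -
          L * (dist s r * dist x y)) (a := dist (f (γ s)) (f (γ t)) - L * (dist s t * dist x y))
          (b := 0) (x := nhdsWithin t (Set.Ioi t)) (hlim.sub hlim2) ?_ |> sub_nonpos.1
        refine (hfr.and_eventually h4).mono fun r hr => sub_nonpos.2 ?_
        have := (hL i hi).dist_le_mul (γ s) ⟨hs1, hγU s hs01⟩ (γ r)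
          ⟨hr.1, hγU r ⟨ht.2.1.trans hr.2.1.le, hr.2.2.le⟩⟩
        rwa [hγd] at this
      have ht' : dist (f (γ t)) (f (γ 0)) ≤ L * (t * dist x y) := ht.1
      change dist (f (γ s)) (f (γ 0)) ≤ L * (s * dist x y)
      calc dist (f (γ s)) (f (γ 0)) ≤ dist (f (γ s)) (f (γ t)) + dist (f (γ t)) (f (γ 0)) :=
            dist_triangle _ _ _
        _ ≤ L * ((s - t) * dist x y) + L * (t * dist x y) := add_le_add key ht'
        _ = L * (s * dist x y) := by ring
  have h1 : dist (f (γ 1)) (f (γ 0)) ≤ L * (1 * dist x y) := hA (Set.right_mem_Icc.2 zero_le_one)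
  simpa [γ, dist_comm] using h1

/-- Continuous functions on finitely many closed pieces that agree on the overlaps in `G` define a
continuous function on `G`. -/
theorem continuousOn_of_closed_cover {ι X F : Type*} [TopologicalSpace X] [TopologicalSpace F]
    {G : Set X} (C : Finset ι) {S : ι → Set X} (hS : ∀ i ∈ C, IsClosed (S i))
    (hcov : ∀ x ∈ G, ∃ i ∈ C, x ∈ S i) {ℓ : ι → X → F} (hℓ : ∀ i ∈ C, Continuous (ℓ i))
    {f : X → F} (hf : ∀ x ∈ G, ∀ i ∈ C, x ∈ S i → f x = ℓ i x) : ContinuousOn f G := by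
  intro x hx
  rw [ContinuousWithinAt, tendsto_nhds]
  intro V hV hxV
  have h1 : ∀ᶠ y in nhds x, ∀ i ∈ C, y ∈ S i → ℓ i y ∈ V := by
    rw [Filter.eventually_all_finset]
    intro i hi
    by_cases hxi : x ∈ S i
    · have : ℓ i x ∈ V := by rwa [← hf x hx i hi hxi]
      filter_upwards [(hℓ i hi).continuousAt.preimage_mem_nhds (hV.mem_nhds this)] with y hy _
      exact hy
    · filter_upwards [(hS i hi).isOpen_compl.mem_nhds hxi] with y hy hy'
      exact absurd hy' hy
  filter_upwards [nhdsWithin_le_nhds h1, self_mem_nhdsWithin] with y hy hyG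
  obtain ⟨i, hi, hyi⟩ := hcov y hyG
  change f y ∈ V
  rw [hf y hyG i hi hyi]
  exact hy i hi hyi

/-! ### Mollification of Lipschitz functions -/

theorem lipschitzWith_mollify {F : Type*} [NormedAddCommGroup F] [NormedSpace ℝ F]
    {ε : ℝ} (hε : 0 < ε) {f : R3 → F} {L : ℝ≥0} (hf : LipschitzWith L f) :
    LipschitzWith L (mollify hε f) := by
  refine LipschitzWith.of_dist_le_mul fun x y => ?_
  have hi : ∀ x, Integrable fun z => eta hε z • f (x - z) :=
    fun x => integrable_eta_smul hε hf.continuous.locallyIntegrable x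
  rw [dist_eq_norm, mollify, mollify, ← integral_sub (hi x) (hi y)]
  have hint : Integrable fun z => eta hε z * (L * dist x y) := (integrable_eta hε).mul_const _
  refine (norm_integral_le_of_norm_le hint (Filter.Eventually.of_forall fun z => ?_)).trans ?_
  · rw [← smul_sub, norm_smul, Real.norm_of_nonneg (eta_nonneg hε z), ← dist_eq_norm]
    refine mul_le_mul_of_nonneg_left ?_ (eta_nonneg hε z)
    have := hf.dist_le_mul (x - z) (y - z)
    rwa [dist_sub_right] at this
  · rw [integral_mul_const, integral_eta, one_mul]

theorem dist_mollify_le {F : Type*} [NormedAddCommGroup F] [NormedSpace ℝ F] [CompleteSpace F]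
    {ε : ℝ} (hε : 0 < ε) {f : R3 → F} {L : ℝ≥0} (hf : LipschitzWith L f) (x : R3) :
    dist (mollify hε f x) (f x) ≤ L * ε := by
  rw [mollify_eq_convolution]
  refine ContDiffBump.dist_normed_convolution_le hf.continuous.aestronglyMeasurable
    fun y hy => (hf.dist_le_mul y x).trans ?_
  gcongr
  exact (Metric.mem_ball.1 hy).le

/-- Where a function coincides with an affine one, so do its mollifications near inner points. -/
theorem mollify_eventuallyEq {F : Type*} [NormedAddCommGroup F] [NormedSpace ℝ F]
    [CompleteSpace F] {f N : R3 → F} (hN : Continuous N)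
    (hsym : ∀ x z, N (x + z) + N (x - z) = (2 : ℝ) • N x) {x : R3} {ρ ε : ℝ}
    (h : ∀ y ∈ Metric.ball x ρ, f y = N y) (hε : 0 < ε) (hερ : ε < ρ) :
    mollify hε f =ᶠ[nhds x] N := by
  filter_upwards [Metric.ball_mem_nhds x (sub_pos.2 hερ)] with y hy
  refine mollify_eq_of_ae_eq hε hN hsym (Filter.Eventually.of_forall fun z hz => h z ?_)
  rw [Metric.mem_ball] at hy hz ⊢
  linarith [dist_triangle z y x]

/-! ### Gradients -/

theorem dot_toC_symm (g : C3) (s : ℂ) (x z : R3) :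
    (dot g (toC (x + z)) + s) + (dot g (toC (x - z)) + s) = (2 : ℝ) • (dot g (toC x) + s) := by
  rw [toC_add, toC_sub, dot_add_right, dot_sub_right, Complex.real_smul]
  push_cast
  ring

theorem hasFDerivAt_dot_toC (g : C3) (s : ℂ) (x : R3) :
    ∃ D : R3 →L[ℝ] ℂ, HasFDerivAt (fun x => dot g (toC x) + s) D x ∧ ∀ h, D h = dot g (toC h) := by
  let l : R3 →ₗ[ℝ] ℂ :=
    { toFun := fun h => dot g (toC h)
      map_add' := fun a b => by rw [toC_add, dot_add_right]
      map_smul' := fun r a => by rw [toC_smul, dot_smul_right]; rfl }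
  refine ⟨l.toContinuousLinearMap, ?_, fun h => rfl⟩
  exact (l.toContinuousLinearMap.hasFDerivAt (x := x)).add_const s

theorem continuous_dot_toC (g : C3) (s : ℂ) : Continuous fun x => dot g (toC x) + s :=
  (continuous_dot continuous_const continuous_toC).add continuous_const

theorem grad_congr {f f' : R3 → ℂ} {x : R3} (h : f =ᶠ[nhds x] f') : grad f x = grad f' x := by
  unfold grad pd
  rw [h.fderiv_eq]

theorem grad_dot_toC (g : C3) (s : ℂ) (x : R3) : grad (fun x => dot g (toC x) + s) x = g := by
  obtain ⟨D, hD, hDh⟩ := hasFDerivAt_dot_toC g s x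
  ext i
  change fderiv ℝ (fun x => dot g (toC x) + s) x (EuclideanSpace.single i 1) = g i
  rw [hD.fderiv, hDh]
  simp only [dot, toC, PiLp.single_apply]
  rw [Finset.sum_eq_single i]
  · simp
  · intro j _ hj
    simp [hj]
  · simp

theorem grad_eq_of_eqOn {f : R3 → ℂ} {V : Set R3} (hV : IsOpen V) {g : C3} {s : ℂ}
    (h : ∀ x ∈ V, f x = dot g (toC x) + s) {x : R3} (hx : x ∈ V) : grad f x = g := by
  rw [← grad_dot_toC g s x]
  refine grad_congr ?_
  filter_upwards [hV.mem_nhds hx] with y hy using h y hy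

theorem norm_grad_le {f : R3 → ℂ} {L : ℝ≥0} (hf : LipschitzWith L f) (x : R3) :
    ‖grad f x‖ ≤ 3 * L := by
  have h1 : ∀ i, ‖grad f x i‖ ≤ L := fun i => by
    have := (fderiv ℝ f x).le_opNorm (EuclideanSpace.single i 1)
    have h2 := norm_fderiv_le_of_lipschitz ℝ hf (x₀ := x)
    simp only [PiLp.norm_single, norm_one, mul_one] at this
    exact this.trans h2
  have h2 : grad f x = ∑ i, EuclideanSpace.single i (grad f x i) := by
    ext k
    simp [Pi.single_apply]
  rw [h2]
  refine (norm_sum_le _ _).trans ?_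
  calc ∑ i, ‖EuclideanSpace.single i (grad f x i)‖ ≤ ∑ _i : Fin 3, (L : ℝ) :=
        Finset.sum_le_sum fun i _ => by rw [PiLp.norm_single]; exact h1 i
    _ = 3 * L := by simp

theorem contDiff_pd {f : R3 → ℂ} (hf : ContDiff ℝ ∞ f) (i : Fin 3) : ContDiff ℝ ∞ (pd i f) :=
  (hf.fderiv_right (m := ∞) (by simp)).clm_apply contDiff_const

theorem contDiff_grad {f : R3 → ℂ} (hf : ContDiff ℝ ∞ f) : ContDiff ℝ ∞ (grad f) :=
  (contDiff_piLp 2).2 fun i => contDiff_pd hf i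

theorem pd_pd_comm {f : R3 → ℂ} (hf : ContDiff ℝ ∞ f) (i k : Fin 3) (x : R3) :
    pd i (pd k f) x = pd k (pd i f) x := by
  have hd : Differentiable ℝ (fderiv ℝ f) :=
    (hf.fderiv_right (m := ∞) (by simp)).differentiable (by simp)
  have e : ∀ i k, pd i (pd k f) x = fderiv ℝ (fderiv ℝ f) x (EuclideanSpace.single i 1)
      (EuclideanSpace.single k 1) := fun i k => by
    have := (hd x).hasFDerivAt.clm_apply (hasFDerivAt_const (EuclideanSpace.single k (1 : ℝ)) x)
    change fderiv ℝ (fun y => fderiv ℝ f y (EuclideanSpace.single k 1)) x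
      (EuclideanSpace.single i 1) = _
    rw [this.fderiv]
    simp
  rw [e, e]
  have hs : IsSymmSndFDerivAt ℝ f x := by
    refine (hf.contDiffAt).isSymmSndFDerivAt ?_
    rw [minSmoothness_of_isRCLikeNormedField]
    exact WithTop.coe_le_coe.2 (le_top : (2 : ℕ∞) ≤ ⊤)
  exact hs _ _

theorem curl_grad {f : R3 → ℂ} (hf : ContDiff ℝ ∞ f) (x : R3) : curl (grad f) x = 0 := by
  have h : ∀ i k, pd i (fun y => grad f y k) x = pd k (fun y => grad f y i) x :=
    fun i k => pd_pd_comm hf i k x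
  rw [curl, h 1 2, h 2 0, h 0 1]
  ext i
  fin_cases i <;> simp

/-! ### Lagrange functions and their gradients -/

namespace IsPatch

variable {Ω : Set R3} {𝒯 : TetMesh Ω} {G : Set R3} {C : Finset (Finset R3)} (h : IsPatch 𝒯 G C)

include h

/-- A continuous function that is affine in the interior of a tetrahedron is given by the same
formula at the boundary points in the patch. -/
theorem eq_of_mem_tet {τ : R3 → ℂ} (hτ : ContinuousOn τ G) {T : Finset R3} (hT : T ∈ C) {g : C3}
    {s : ℂ} (hgs : ∀ x ∈ interior (convexHull ℝ (T : Set R3)), τ x = dot g (toC x) + s) {x : R3}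
    (hx : x ∈ G) (hxT : x ∈ convexHull ℝ (T : Set R3)) : τ x = dot g (toC x) + s := by
  have hne : (nhdsWithin x (interior (convexHull ℝ (T : Set R3)))).NeBot :=
    mem_closure_iff_nhdsWithin_neBot.1 ((h.isTet hT).mem_closure_interior hxT)
  have h1 : Filter.Tendsto τ (nhdsWithin x (interior (convexHull ℝ (T : Set R3)))) (nhds (τ x)) :=
    (hτ.continuousAt (h.isOpen.mem_nhds hx)).tendsto.mono_left nhdsWithin_le_nhds
  have h2 : Filter.Tendsto (fun x => dot g (toC x) + s)
      (nhdsWithin x (interior (convexHull ℝ (T : Set R3)))) (nhds (dot g (toC x) + s)) :=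
    ((continuous_dot_toC g s).tendsto x).mono_left nhdsWithin_le_nhds
  refine tendsto_nhds_unique h1 (h2.congr' ?_)
  filter_upwards [self_mem_nhdsWithin] with y hy using (hgs y hy).symm

/-- Continuous fields prescribed on the tetrahedra of a patch define a square integrable field. -/
theorem exists_piecewise {f : Finset R3 → R3 → C3} (hf : ∀ T, Continuous (f T)) :
    ∃ v : L2V G, ∀ᵐ x ∂volume.restrict G, ∀ T ∈ C,
      x ∈ interior (convexHull ℝ (T : Set R3)) → v x = f T x := by
  have hfin := h.isFiniteMeasure
  let F : R3 → C3 := fun x =>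
    ∑ T ∈ C, (interior (convexHull ℝ (T : Set R3))).indicator (f T) x
  have hfT : ∀ T, MemLp (f T) 2 (volume.restrict G) := fun T => by
    obtain ⟨M, hM⟩ := h.isBounded.isCompact_closure.exists_bound_of_continuousOn (hf T).continuousOn
    refine MemLp.of_bound (hf T).aestronglyMeasurable M ?_
    filter_upwards [ae_restrict_mem h.isOpen.measurableSet] with x hx using hM x (subset_closure hx)
  have hF : MemLp F 2 (volume.restrict G) :=
    memLp_finsetSum _ fun T _ => (hfT T).indicator isOpen_interior.measurableSet
  refine ⟨hF.toLp F, ?_⟩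
  filter_upwards [hF.coeFn_toLp] with x hx T hT hxT
  rw [hx]
  change ∑ T' ∈ C, _ = _
  rw [Finset.sum_eq_single T]
  · rw [Set.indicator_of_mem hxT]
  · intro T' hT' hne
    refine Set.indicator_of_notMem (fun hn => hne ?_) _
    exact (eq_of_mem_interior (h.subset hT) (h.subset hT') hxT (interior_subset hn)).symm
  · exact fun hn => absurd hT hn

omit h in
theorem isNedOn_of_ae {v : R3 → C3} {T : Finset R3} {a b : C3}
    (hv : ∀ᵐ x ∂volume.restrict G, x ∈ interior (convexHull ℝ (T : Set R3)) →
      v x = nedField a b x) : IsNedOn G T v a b := by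
  have hf : ∀ᵐ x ∂volume.restrict G, x ∉ frontier (convexHull ℝ (T : Set R3)) :=
    ae_restrict_of_ae (measure_eq_zero_iff_ae_notMem.1
      ((convex_convexHull ℝ (T : Set R3)).addHaar_frontier volume))
  filter_upwards [hv, hf] with x hx hxf hxT
  refine hx ?_
  by_contra hn
  exact hxf ⟨subset_closure hxT, hn⟩

theorem exists_grad {τ : R3 → ℂ} (hτ : τ ∈ lagrange G C) :
    ∃ v : L2V G, v =ᵐ[volume.restrict G] grad τ ∧ ∃ g : Finset R3 → C3, ∀ T ∈ C,
      IsNedOn G T v 0 (g T) ∧ ∀ x ∈ interior (convexHull ℝ (T : Set R3)), grad τ x = g T := by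
  choose! g s hgs using hτ.2
  obtain ⟨v, hv⟩ := h.exists_piecewise (f := fun T _ => g T) fun _ => continuous_const
  have hgrad : ∀ T ∈ C, ∀ x ∈ interior (convexHull ℝ (T : Set R3)), grad τ x = g T :=
    fun T hT x hx => grad_eq_of_eqOn isOpen_interior (hgs T hT) hx
  refine ⟨v, ?_, g, fun T hT => ⟨isNedOn_of_ae ?_, hgrad T hT⟩⟩
  · filter_upwards [hv, h.ae_restrict_mem_interior] with x hx hxi
    obtain ⟨T, hT, hxT⟩ := hxi
    rw [hx T hT hxT, hgrad T hT x hxT]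
  · filter_upwards [hv] with x hx hxT
    rw [nedField_zero_left]
    exact hx T hT hxT

omit h in
theorem lagrange_add {τ τ' : R3 → ℂ} (hτ : τ ∈ lagrange G C) (hτ' : τ' ∈ lagrange G C) :
    τ + τ' ∈ lagrange G C := by
  refine ⟨hτ.1.add hτ'.1, fun T hT => ?_⟩
  obtain ⟨g, s, hgs⟩ := hτ.2 T hT
  obtain ⟨g', s', hgs'⟩ := hτ'.2 T hT
  refine ⟨g + g', s + s', fun x hx => ?_⟩
  rw [Pi.add_apply, hgs x hx, hgs' x hx, dot_add_left]
  ring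

omit h in
theorem lagrange_smul {τ : R3 → ℂ} (hτ : τ ∈ lagrange G C) (z : ℂ) : z • τ ∈ lagrange G C := by
  refine ⟨hτ.1.const_smul z, fun T hT => ?_⟩
  obtain ⟨g, s, hgs⟩ := hτ.2 T hT
  refine ⟨z • g, z * s, fun x hx => ?_⟩
  rw [Pi.smul_apply, hgs x hx, dot_smul_left, smul_eq_mul]
  ring

omit h in
theorem lagrange_const (z : ℂ) : (fun _ => z) ∈ lagrange G C :=
  ⟨continuousOn_const, fun _ _ => ⟨0, z, fun _ _ => by simp⟩⟩

theorem grad_add_ae {τ τ' : R3 → ℂ} (hτ : τ ∈ lagrange G C) (hτ' : τ' ∈ lagrange G C) :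
    grad (τ + τ') =ᵐ[volume.restrict G] grad τ + grad τ' := by
  filter_upwards [h.ae_restrict_mem_interior] with x ⟨T, hT, hxT⟩
  obtain ⟨g, s, hgs⟩ := hτ.2 T hT
  obtain ⟨g', s', hgs'⟩ := hτ'.2 T hT
  rw [Pi.add_apply, grad_eq_of_eqOn isOpen_interior hgs hxT,
    grad_eq_of_eqOn isOpen_interior hgs' hxT]
  refine grad_eq_of_eqOn isOpen_interior (s := s + s') (fun y hy => ?_) hxT
  rw [Pi.add_apply, hgs y hy, hgs' y hy, dot_add_left]
  ring

theorem grad_smul_ae {τ : R3 → ℂ} (hτ : τ ∈ lagrange G C) (z : ℂ) :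
    grad (z • τ) =ᵐ[volume.restrict G] z • grad τ := by
  filter_upwards [h.ae_restrict_mem_interior] with x ⟨T, hT, hxT⟩
  obtain ⟨g, s, hgs⟩ := hτ.2 T hT
  rw [Pi.smul_apply, grad_eq_of_eqOn isOpen_interior hgs hxT]
  refine grad_eq_of_eqOn isOpen_interior (s := z * s) (fun y hy => ?_) hxT
  rw [Pi.smul_apply, hgs y hy, dot_smul_left, smul_eq_mul]
  ring

/-- The gradients of the Lagrange functions on a patch. -/
def gradSpace : Submodule ℂ (L2V G) where
  carrier := {v | ∃ τ ∈ lagrange G C, v =ᵐ[volume.restrict G] grad τ}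
  add_mem' := by
    rintro v w ⟨τ, hτ, hv⟩ ⟨τ', hτ', hw⟩
    refine ⟨τ + τ', lagrange_add hτ hτ', ?_⟩
    filter_upwards [Lp.coeFn_add v w, hv, hw, h.grad_add_ae hτ hτ'] with x h1 h2 h3 h4
    rw [h1, h4, Pi.add_apply, Pi.add_apply, h2, h3]
  zero_mem' := by
    refine ⟨fun _ => 0, lagrange_const 0, ?_⟩
    filter_upwards [Lp.coeFn_zero C3 2 (volume.restrict G)] with x hx
    rw [hx]
    ext i
    simp [grad, pd]
  smul_mem' := by
    rintro z v ⟨τ, hτ, hv⟩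
    refine ⟨z • τ, lagrange_smul hτ z, ?_⟩
    filter_upwards [Lp.coeFn_smul z v, hv, h.grad_smul_ae hτ z] with x h1 h2 h3
    rw [h1, h3, Pi.smul_apply, Pi.smul_apply, h2]

theorem gradSpace_le : h.gradSpace ≤ piecewiseNed G C := by
  rintro v ⟨τ, hτ, hv⟩ T hT
  obtain ⟨w, hw, g, hg⟩ := h.exists_grad hτ
  have : v = w := Lp.ext (hv.trans hw.symm)
  exact ⟨0, g T, this ▸ (hg T hT).1⟩

theorem finiteDimensional_gradSpace : FiniteDimensional ℂ h.gradSpace := by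
  have := h.finiteDimensional_piecewiseNed
  exact Submodule.finiteDimensional_of_le h.gradSpace_le

/-- A Lagrange function is Lipschitz near every point of the patch. -/
theorem locallyLipschitzOn {τ : R3 → ℂ} (hτ : τ ∈ lagrange G C) : LocallyLipschitzOn G τ := by
  choose! g s hgs using hτ.2
  intro x hx
  obtain ⟨ρ, hρ, hball⟩ := Metric.isOpen_iff.1 h.isOpen x hx
  let L : ℝ≥0 := ∑ T ∈ C, 3 * ‖g T‖₊
  refine ⟨L, Metric.ball x ρ, nhdsWithin_le_nhds (Metric.ball_mem_nhds x hρ), ?_⟩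
  refine lipschitzOnWith_of_cover (convex_ball x ρ) (hτ.1.mono hball) C
    (fun T => convexHull ℝ (T : Set R3)) (fun y hy => h.cover y (hball hy)) fun T hT => ?_
  refine LipschitzOnWith.of_dist_le_mul fun y hy z hz => ?_
  rw [h.eq_of_mem_tet hτ.1 hT (hgs T hT) (hball hy.2) hy.1,
    h.eq_of_mem_tet hτ.1 hT (hgs T hT) (hball hz.2) hz.1, dist_add_right, dist_eq_norm,
    ← dot_sub_right, ← toC_sub, dist_eq_norm]
  refine (norm_dot_le _ _).trans ?_
  rw [norm_toC, ← mul_assoc]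
  gcongr
  have := Finset.single_le_sum (f := fun T => 3 * ‖g T‖₊) (fun _ _ => by positivity) hT
  exact_mod_cast this

/-- The gradient of a Lagrange function has weak curl zero: on the support of a test function it is
the bounded limit of gradients of mollifications. -/
theorem grad_mem_Hcurl {v : L2V G} (hv : v ∈ h.gradSpace) : WithLp.toLp 2 (v, 0) ∈ Hcurl G := by
  obtain ⟨τ, hτ, hvτ⟩ := hv
  intro φ hφ
  rw [WithLp.toLp_fst, WithLp.toLp_snd, integral_dot_zero]
  have hvg : ∫ x in G, dot (v x) (curl φ x) = ∫ x in G, dot (grad τ x) (curl φ x) :=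
    integral_congr_ae (by filter_upwards [hvτ] with x hx; rw [hx])
  rw [hvg, setIntegral_eq_integral_of_forall_compl_eq_zero fun x hx => by
    rw [hφ.curl_eq_zero hx, dot_zero_right]]
  obtain ⟨K, hK, hφK, hKG⟩ := exists_compact_between hφ.compact h.isOpen hφ.supp
  obtain ⟨L, hL⟩ := ((h.locallyLipschitzOn hτ).mono hKG).exists_lipschitzOnWith_of_compact hK
  obtain ⟨f, hf, hfτ⟩ := hL.extend_finite_dimension
  set L' := lipschitzExtensionConstant ℂ * L
  have hε : ∀ n : ℕ, (0 : ℝ) < 1 / (n + 1) := fun n => by positivity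
  have hsm : ∀ n, ContDiff ℝ ∞ (mollify (hε n) f) := fun n =>
    contDiff_mollify (hε n) hf.continuous.locallyIntegrable
  have hzero : ∀ n, ∫ x, dot (grad (mollify (hε n) f) x) (curl φ x) = 0 := fun n => by
    rw [integral_dot_curl ((contDiff_grad (hsm n)).of_le (by norm_cast)) hφ]
    simp [curl_grad (hsm n)]
  have hφ' := hφ.mono (Set.subset_univ _)
  have hcurl : MemLp (curl φ) 2 volume := by
    have := hφ'.memLp_curl
    rwa [Measure.restrict_univ] at this
  have hcc : Continuous (curl φ) := by
    have : ∀ i k, Continuous (pd i fun y => φ y k) := fun i k =>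
      continuous_pd (hφ.coord k).contDiff_one i
    unfold curl
    fun_prop
  have hcs : HasCompactSupport (curl φ) :=
    hφ.compact.mono' (Function.support_subset_iff'.2 fun x hx =>
      IsTest.curl_eq_zero (G := tsupport φ) ⟨hφ.smooth, hφ.compact, subset_rfl⟩ hx)
  have hlim : Filter.Tendsto (fun n : ℕ => ∫ x, dot (grad (mollify (hε n) f) x) (curl φ x))
      Filter.atTop (nhds (∫ x, dot (grad τ x) (curl φ x))) := by
    refine tendsto_integral_of_dominated_convergence
      (fun x => 3 * (3 * L' * ‖curl φ x‖)) (fun n => ?_) ?_ (fun n => ?_) ?_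
    · exact (continuous_dot (contDiff_grad (hsm n)).continuous hcc).aestronglyMeasurable
    · exact ((hcc.integrable_of_hasCompactSupport hcs).norm.const_mul _).const_mul _
    · refine Filter.Eventually.of_forall fun x => (norm_dot_le _ _).trans ?_
      gcongr
      exact norm_grad_le (lipschitzWith_mollify (hε n) hf) x
    · filter_upwards [h.ae_mem_interior] with x hxi
      by_cases hx : x ∈ tsupport φ
      · have hxK := hφK hx
        obtain ⟨T, hT, hxT⟩ := hxi (hφ.supp hx)
        obtain ⟨g, s, hgs⟩ := hτ.2 T hT
        obtain ⟨ρ, hρ, hball⟩ := Metric.isOpen_iff.1 (isOpen_interior.inter isOpen_interior) x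
          ⟨hxK, hxT⟩
        have hfx : ∀ y ∈ Metric.ball x ρ, f y = dot g (toC y) + s := fun y hy => by
          rw [← hfτ (interior_subset (hball hy).1), hgs y (hball hy).2]
        refine Filter.Tendsto.congr' ?_ tendsto_const_nhds
        have hev : ∀ᶠ n : ℕ in Filter.atTop, 1 / ((n : ℝ) + 1) < ρ :=
          tendsto_one_div_add_atTop_nhds_zero_nat.eventually (gt_mem_nhds hρ)
        filter_upwards [hev] with n hn
        rw [grad_congr (mollify_eventuallyEq (continuous_dot_toC g s) (dot_toC_symm g s) hfx
          (hε n) hn), grad_dot_toC, grad_eq_of_eqOn isOpen_interior hgs hxT]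
      · have : curl φ x = 0 :=
          IsTest.curl_eq_zero (G := tsupport φ) ⟨hφ.smooth, hφ.compact, subset_rfl⟩ hx
        simp [this]
  simp only [hzero] at hlim
  exact tendsto_nhds_unique hlim tendsto_const_nhds

theorem grad_mem_nedelec {v : L2V G} (hv : v ∈ h.gradSpace) :
    WithLp.toLp 2 (v, 0) ∈ nedelec C (Hcurl G) :=
  ⟨h.grad_mem_Hcurl hv, h.gradSpace_le hv⟩

end IsPatch

/-! ### Finite-dimensional projections -/

/-- A linear map that vanishes on the complement of a finite-dimensional space is continuous. -/
theorem exists_clm_of_forall_orthogonal {H F : Type*} [NormedAddCommGroup H]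
    [InnerProductSpace ℂ H] [NormedAddCommGroup F] [NormedSpace ℂ F] (D : Submodule ℂ H)
    [FiniteDimensional ℂ D] (f : H →ₗ[ℂ] F) (hf : ∀ x ∈ Dᗮ, f x = 0) :
    ∃ Λ : H →L[ℂ] F, ∀ x, Λ x = f x := by
  refine ⟨(f.domRestrict D).toContinuousLinearMap ∘L D.orthogonalProjectionOnto, fun x => ?_⟩
  have h := hf (x - D.orthogonalProjectionOnto x) (D.sub_starProjection_mem_orthogonal x)
  rw [map_sub, sub_eq_zero] at h
  exact h.symm

/-- The mixed projection onto a finite-dimensional space `N` of pairs `(v, curl v)` that contains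
the pairs `(g, 0)`, `g ∈ D`: match the curls, and match the fields against `D`. -/
theorem exists_mixed_projection {H₁ H₂ : Type*} [NormedAddCommGroup H₁] [InnerProductSpace ℂ H₁]
    [NormedAddCommGroup H₂] [InnerProductSpace ℂ H₂] (N : Submodule ℂ (WithLp 2 (H₁ × H₂)))
    (D : Submodule ℂ H₁) [FiniteDimensional ℂ N] [FiniteDimensional ℂ D]
    (hD : ∀ g ∈ D, WithLp.toLp 2 (g, 0) ∈ N)
    (hinj : ∀ q ∈ N, q.snd = 0 → (∀ g ∈ D, inner ℂ g q.fst = 0) → q = 0) :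
    ∃ Λ : WithLp 2 (H₁ × H₂) →L[ℂ] WithLp 2 (H₁ × H₂), ∀ p q,
      (q ∈ N ∧ (∀ g ∈ D, inner ℂ g (p.fst - q.fst) = 0) ∧
        ∀ v ∈ N, inner ℂ v.snd (p.snd - q.snd) = 0) ↔ q = Λ p := by
  let P : WithLp 2 (H₁ × H₂) → WithLp 2 (H₁ × H₂) → Prop := fun p q =>
    q ∈ N ∧ (∀ g ∈ D, inner ℂ g (p.fst - q.fst) = 0) ∧
      ∀ v ∈ N, inner ℂ v.snd (p.snd - q.snd) = 0
  have hadd : ∀ {p p' q q'}, P p q → P p' q' → P (p + p') (q + q') := by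
    intro p p' q q' h h'
    refine ⟨N.add_mem h.1 h'.1, fun g hg => ?_, fun v hv => ?_⟩
    · rw [WithLp.add_fst, WithLp.add_fst, add_sub_add_comm, inner_add_right, h.2.1 g hg,
        h'.2.1 g hg, add_zero]
    · rw [WithLp.add_snd, WithLp.add_snd, add_sub_add_comm, inner_add_right, h.2.2 v hv,
        h'.2.2 v hv, add_zero]
  have hsmul : ∀ {p q} (z : ℂ), P p q → P (z • p) (z • q) := by
    intro p q z h
    refine ⟨N.smul_mem z h.1, fun g hg => ?_, fun v hv => ?_⟩
    · rw [WithLp.smul_fst, WithLp.smul_fst, ← smul_sub, inner_smul_right, h.2.1 g hg, mul_zero]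
    · rw [WithLp.smul_snd, WithLp.smul_snd, ← smul_sub, inner_smul_right, h.2.2 v hv, mul_zero]
  have huniq : ∀ {p q q'}, P p q → P p q' → q = q' := by
    intro p q q' h h'
    have hd : P 0 (q - q') := by
      have := hadd h (hsmul (-1) h')
      simpa [sub_eq_add_neg] using this
    refine sub_eq_zero.1 (hinj _ hd.1 ?_ fun g hg => ?_)
    · have := hd.2.2 _ hd.1
      rw [WithLp.zero_snd, zero_sub, inner_neg_right, neg_eq_zero] at this
      exact inner_self_eq_zero.1 this
    · have := hd.2.1 g hg
      rwa [WithLp.zero_fst, zero_sub, inner_neg_right, neg_eq_zero] at this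
  -- a field with the right curl exists by projection onto the curls, and is then corrected in `D`
  let S : Submodule ℂ H₂ := N.map (WithLp.sndL 2 ℂ H₁ H₂).toLinearMap
  have hSfin : FiniteDimensional ℂ S := inferInstanceAs (FiniteDimensional ℂ (N.map _))
  have hex : ∀ p, ∃ q, P p q := by
    intro p
    obtain ⟨q₁, hq₁, hq₁s⟩ := (S.orthogonalProjectionOnto p.snd).2
    let g : H₁ := D.orthogonalProjectionOnto (p.fst - q₁.fst)
    have hg : g ∈ D := (D.orthogonalProjectionOnto (p.fst - q₁.fst)).2
    refine ⟨q₁ + WithLp.toLp 2 (g, 0), N.add_mem hq₁ (hD g hg), fun g' hg' => ?_, fun v hv => ?_⟩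
    · have := D.sub_starProjection_mem_orthogonal (p.fst - q₁.fst) g' hg'
      rw [sub_sub] at this
      exact this
    · have := S.sub_starProjection_mem_orthogonal p.snd v.snd ⟨v, hv, rfl⟩
      change inner ℂ v.snd (p.snd - (q₁.snd + 0)) = 0
      rw [add_zero]
      rw [Submodule.starProjection_apply, ← hq₁s] at this
      exact this
  choose f hf using hex
  let fl : WithLp 2 (H₁ × H₂) →ₗ[ℂ] WithLp 2 (H₁ × H₂) :=
    { toFun := f
      map_add' := fun p p' => huniq (hf _) (hadd (hf p) (hf p'))
      map_smul' := fun z p => huniq (hf _) (hsmul z (hf p)) }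
  let j : H₂ →ₗ[ℂ] WithLp 2 (H₁ × H₂) :=
    (WithLp.prodContinuousLinearEquiv 2 ℂ H₁ H₂).symm.toLinearMap ∘ₗ LinearMap.inr ℂ H₁ H₂
  have hMfin : FiniteDimensional ℂ (N ⊔ S.map j : Submodule ℂ (WithLp 2 (H₁ × H₂))) :=
    inferInstance
  -- the solution depends only on the products of `p` with `N` and with the curls of `N`
  obtain ⟨Λ, hΛ⟩ := exists_clm_of_forall_orthogonal (N ⊔ S.map j) fl fun p hp => by
    refine huniq (hf p) ⟨N.zero_mem, fun g hg => ?_, fun v hv => ?_⟩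
    · have := hp _ (Submodule.mem_sup_left (hD g hg))
      rw [WithLp.prod_inner_apply] at this
      simpa using this
    · have := hp (j v.snd) (Submodule.mem_sup_right ⟨v.snd, ⟨v, hv, rfl⟩, rfl⟩)
      rw [WithLp.prod_inner_apply] at this
      simpa [j] using this
  refine ⟨Λ, fun p q => ⟨fun hq => ?_, fun hq => ?_⟩⟩
  · rw [hΛ]
    exact huniq hq (hf p)
  · rw [hq, hΛ]
    exact hf p

/-! ### Tangential means over edges -/

section EdgeMean

variable {Ω : Set R3} {𝒯 : TetMesh Ω} (o : EdgeOrientation 𝒯) {E : Finset R3}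

theorem edgeLength_pos (hE : E ∈ edges 𝒯) : 0 < edgeLength o E :=
  dist_pos.2 (o.tail_ne_head hE)

theorem edgeLength_smul_tangent (hE : E ∈ edges 𝒯) :
    edgeLength o E • tangent o E = o.head E - o.tail E := by
  rw [tangent, smul_inv_smul₀ (edgeLength_pos o hE).ne']

/-- The tangential component of a Nédélec field along the edge is constant. -/
theorem dot_nedField_lineMap (hE : E ∈ edges 𝒯) (a b : C3) (s r : ℝ) :
    dot (nedField a b (AffineMap.lineMap (o.tail E) (o.head E) s)) (toC (tangent o E))
      = dot (nedField a b (AffineMap.lineMap (o.tail E) (o.head E) r)) (toC (tangent o E)) := by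
  have e : ∀ s : ℝ, (AffineMap.lineMap (o.tail E) (o.head E) s : R3)
      = o.tail E + (s * edgeLength o E) • tangent o E := fun s => by
    rw [mul_smul, edgeLength_smul_tangent o hE, AffineMap.lineMap_apply, vsub_eq_sub, vadd_eq_add,
      add_comm]
  rw [e, e, dot_nedField_add_smul, dot_nedField_add_smul]

theorem integral_dot_nedField_lineMap (hE : E ∈ edges 𝒯) (a b : C3) (r : ℝ) :
    ∫ s in (0 : ℝ)..1,
        dot (nedField a b (AffineMap.lineMap (o.tail E) (o.head E) s)) (toC (tangent o E))
      = dot (nedField a b (AffineMap.lineMap (o.tail E) (o.head E) r)) (toC (tangent o E)) := by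
  rw [intervalIntegral.integral_congr fun s _ => dot_nedField_lineMap o hE a b s r]
  simp

variable {G : Set R3} {C : Finset (Finset R3)}

/-- The tangential component on an edge with an inner point in the patch does not depend on the
tetrahedron it is evaluated from. -/
theorem IsPatch.dot_tangent_eq (h : IsPatch 𝒯 G C) (hE : E ∈ edges 𝒯) {θ : ℝ}
    (hθ : θ ∈ Set.Ioo (0 : ℝ) 1) (hp : AffineMap.lineMap (o.tail E) (o.head E) θ ∈ G)
    {q : CurlPair G} (hq : q ∈ nedelec C (Hcurl G)) {T T' : Finset R3} (hT : T ∈ C) (hT' : T' ∈ C)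
    (hET : E ⊆ T) (hET' : E ⊆ T') {a b a' b' : C3} (hab : IsNedOn G T q.fst a b)
    (hab' : IsNedOn G T' q.fst a' b') :
    dot (nedField a b (AffineMap.lineMap (o.tail E) (o.head E) θ)) (toC (tangent o E))
      = dot (nedField a' b' (AffineMap.lineMap (o.tail E) (o.head E) θ)) (toC (tangent o E)) := by
  have hθ' := Set.Ioo_subset_Icc_self hθ
  have hL := edgeLength_pos o hE
  have e : (AffineMap.lineMap (o.tail E) (o.head E) θ : R3)
      + ((1 - θ) * edgeLength o E) • tangent o E = o.head E := by
    rw [mul_smul, edgeLength_smul_tangent o hE, AffineMap.lineMap_apply, vsub_eq_sub, vadd_eq_add]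
    module
  have key := h.tangential_eq_of_mem hq hT hT' hab hab' hp (lineMap_mem_tet o hE hθ' hET)
    (lineMap_mem_tet o hE hθ' hET') (t := ((1 - θ) * edgeLength o E) • tangent o E)
    (by rw [e]; exact subset_convexHull ℝ _ (hET (o.head_mem hE)))
    (by rw [e]; exact subset_convexHull ℝ _ (hET' (o.head_mem hE)))
  rw [toC_smul, dot_smul_right, dot_smul_right] at key
  refine mul_left_cancel₀ ?_ key
  have := sub_pos.2 hθ.2
  exact_mod_cast (mul_pos this hL).ne'

/-- The coefficients of the fields of a Nédélec space on one tetrahedron, as a linear map. -/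
theorem IsPatch.exists_coeff_nedelec (h : IsPatch 𝒯 G C) {V : Submodule ℂ (CurlPair G)}
    {T : Finset R3} (hT : T ∈ C) : ∃ L : nedelec C V →ₗ[ℂ] C3 × C3,
      ∀ q : nedelec C V, IsNedOn G T (q : CurlPair G).fst (L q).1 (L q).2 := by
  obtain ⟨L, hL⟩ := h.exists_coeff
  let j : nedelec C V →ₗ[ℂ] piecewiseNed G C :=
    { toFun := fun q => ⟨(q : CurlPair G).fst, q.2.2⟩
      map_add' := fun _ _ => rfl
      map_smul' := fun _ _ => rfl }
  exact ⟨LinearMap.proj (⟨T, hT⟩ : C) ∘ₗ L ∘ₗ j, fun q => hL (j q) ⟨T, hT⟩⟩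

/-- The value at `p` of the component in direction `t`, as a function of the coefficients. -/
def coeffFunctional (p : R3) (t : C3) : C3 × C3 →ₗ[ℂ] ℂ where
  toFun ab := dot (nedField ab.1 ab.2 p) t
  map_add' ab ab' := by rw [Prod.fst_add, Prod.snd_add, nedField_add_add, dot_add_left]
  map_smul' z ab := by
    rw [Prod.smul_fst, Prod.smul_snd, nedField_smul, dot_smul_left, RingHom.id_apply, smul_eq_mul]

/-- The edge mean is a linear functional on the Nédélec space of a patch that contains an inner
point of the edge. -/
theorem IsPatch.exists_edgeMean (h : IsPatch 𝒯 G C) (hE : E ∈ edges 𝒯) {θ : ℝ}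
    (hθ : θ ∈ Set.Ioo (0 : ℝ) 1) (hp : AffineMap.lineMap (o.tail E) (o.head E) θ ∈ G) :
    ∃ Λ : nedelec C (Hcurl G) →ₗ[ℂ] ℂ, ∀ (q : nedelec C (Hcurl G)) (m : ℂ),
      HasEdgeMean o E G (q : CurlPair G).fst m ↔ m = Λ q := by
  have hmem : ∀ {T}, T ∈ 𝒯.cells → E ⊆ T → T ∈ C := fun hT hET =>
    h.mem_cells hT hp (lineMap_mem_tet o hE (Set.Ioo_subset_Icc_self hθ) hET)
  obtain ⟨T₀, hT₀, hET₀, -⟩ := mem_edges.1 hE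
  obtain ⟨L, hL⟩ := h.exists_coeff_nedelec (V := Hcurl G) (hmem hT₀ hET₀)
  refine ⟨coeffFunctional (AffineMap.lineMap (o.tail E) (o.head E) θ) (toC (tangent o E)) ∘ₗ L,
    fun q m => ⟨fun H => ?_, fun hm T hT hET => ?_⟩⟩
  · obtain ⟨a, b, hab, hm⟩ := H T₀ hT₀ hET₀
    have hu := h.isNedOn_unique (hmem hT₀ hET₀) hab (hL q)
    rw [hm, integral_dot_nedField_lineMap o hE a b θ, hu.1, hu.2]
    rfl
  · obtain ⟨a, b, hab⟩ := q.2.2 T (hmem hT hET)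
    refine ⟨a, b, hab, ?_⟩
    rw [integral_dot_nedField_lineMap o hE _ _ θ, hm]
    exact h.dot_tangent_eq o hE hθ hp q.2 (hmem hT₀ hET₀) (hmem hT hET) hET₀ hET (hL q) hab

theorem edgeMean_eq {v : R3 → C3} {m : ℂ} (hm : HasEdgeMean o E G v m)
    (hu : ∀ m', HasEdgeMean o E G v m' → m' = m) : edgeMean o E G v = m :=
  hu _ (Classical.epsilon_spec (p := fun m => HasEdgeMean o E G v m) ⟨m, hm⟩)

end EdgeMean

/-! ### Restriction to a patch -/

theorem exists_restrictCLM_measure {F : Type*} [NormedAddCommGroup F] [NormedSpace ℂ F]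
    {μ ν : Measure R3} {s : Set R3} (hν : ν = μ.restrict s) :
    ∃ R : Lp F 2 μ →L[ℂ] Lp F 2 ν, ∀ v, R v =ᵐ[ν] v := by
  subst hν
  exact ⟨LpToLpRestrictCLM R3 F ℂ μ 2 s, fun v => LpToLpRestrictCLM_coeFn ℂ s v⟩

theorem exists_restrictCLM {G G' : Set R3} (hsub : G' ⊆ G) :
    ∃ R : L2V G →L[ℂ] L2V G', ∀ v, R v =ᵐ[volume.restrict G'] v :=
  exists_restrictCLM_measure (Measure.restrict_restrict_of_subset hsub).symm

theorem exists_restrictCLM_pair {G G' : Set R3} (hsub : G' ⊆ G) :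
    ∃ R : CurlPair G →L[ℂ] CurlPair G', ∀ p, (R p).fst =ᵐ[volume.restrict G'] p.fst ∧
      (R p).snd =ᵐ[volume.restrict G'] p.snd := by
  obtain ⟨R, hR⟩ := exists_restrictCLM hsub
  exact ⟨(WithLp.prodContinuousLinearEquiv 2 ℂ (L2V G') (L2V G')).symm.toContinuousLinearMap ∘L
    (R ∘L WithLp.fstL 2 ℂ (L2V G) (L2V G)).prod (R ∘L WithLp.sndL 2 ℂ (L2V G) (L2V G)),
    fun p => ⟨hR p.fst, hR p.snd⟩⟩

theorem IsNedOn.restrict {G G' : Set R3} (hsub : G' ⊆ G) {T : Finset R3} {v v' : R3 → C3}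
    (hv : v' =ᵐ[volume.restrict G'] v) {a b : C3} (h : IsNedOn G T v a b) : IsNedOn G' T v' a b := by
  have h' : ∀ᵐ x ∂volume.restrict G', x ∈ convexHull ℝ (T : Set R3) → v x = nedField a b x :=
    ae_mono (Measure.restrict_mono hsub le_rfl) h
  filter_upwards [hv, h'] with x hx hx' hxT
  rw [hx, hx' hxT]

theorem HasEdgeMean.restrict {Ω : Set R3} {𝒯 : TetMesh Ω} {o : EdgeOrientation 𝒯} {E : Finset R3}
    {G G' : Set R3} (hsub : G' ⊆ G) {v v' : R3 → C3} (hv : v' =ᵐ[volume.restrict G'] v) {m : ℂ}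
    (h : HasEdgeMean o E G v m) : HasEdgeMean o E G' v' m := fun T hT hET => by
  obtain ⟨a, b, hab, hm⟩ := h T hT hET
  exact ⟨a, b, hab.restrict hsub hv, hm⟩

theorem mem_Hcurl_restrict {G G' : Set R3} (hG : MeasurableSet G) (hsub : G' ⊆ G)
    {p : CurlPair G} (hp : p ∈ Hcurl G) {p' : CurlPair G'}
    (h1 : p'.fst =ᵐ[volume.restrict G'] p.fst) (h2 : p'.snd =ᵐ[volume.restrict G'] p.snd) :
    p' ∈ Hcurl G' := by
  intro φ hφ
  have e1 : ∫ x in G', dot (p'.fst x) (curl φ x) = ∫ x in G', dot (p.fst x) (curl φ x) :=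
    integral_congr_ae (by filter_upwards [h1] with x hx; rw [hx])
  have e2 : ∫ x in G', dot (p'.snd x) (φ x) = ∫ x in G', dot (p.snd x) (φ x) :=
    integral_congr_ae (by filter_upwards [h2] with x hx; rw [hx])
  rw [e1, e2, ← setIntegral_eq_of_subset_of_forall_sdiff_eq_zero hG hsub
    (fun x hx => by rw [hφ.curl_eq_zero hx.2, dot_zero_right]),
    ← setIntegral_eq_of_subset_of_forall_sdiff_eq_zero hG hsub
    (fun x hx => by rw [hφ.eq_zero hx.2, dot_zero_right])]
  exact hp φ (hφ.mono hsub)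

theorem mem_nedelec_restrict {G G' : Set R3} (hG : MeasurableSet G) (hsub : G' ⊆ G)
    {C C' : Finset (Finset R3)} (hC : C' ⊆ C) {p : CurlPair G}
    (hp : p ∈ nedelec C (Hcurl G)) {p' : CurlPair G'}
    (h1 : p'.fst =ᵐ[volume.restrict G'] p.fst) (h2 : p'.snd =ᵐ[volume.restrict G'] p.snd) :
    p' ∈ nedelec C' (Hcurl G') := by
  refine ⟨mem_Hcurl_restrict hG hsub hp.1 h1 h2, fun T hT => ?_⟩
  obtain ⟨a, b, hab⟩ := hp.2 T (hC hT)
  exact ⟨a, b, hab.restrict hsub h1⟩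

/-! ### The local projections -/

namespace IsPatch

variable {Ω : Set R3} {𝒯 : TetMesh Ω} {G : Set R3} {C : Finset (Finset R3)} (h : IsPatch 𝒯 G C)

include h

/-- A piecewise constant field with a continuous piecewise affine potential. -/
theorem mem_gradSpace {v : L2V G} {b : Finset R3 → C3} (s : Finset R3 → ℂ)
    (hv : ∀ T ∈ C, IsNedOn G T v 0 (b T))
    (hcons : ∀ x ∈ G, ∀ T ∈ C, ∀ T' ∈ C, x ∈ convexHull ℝ (T : Set R3) →
      x ∈ convexHull ℝ (T' : Set R3) → dot (b T) (toC x) + s T = dot (b T') (toC x) + s T') :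
    v ∈ h.gradSpace := by
  classical
  choose! c hcC hc using h.cover
  let τ : R3 → ℂ := fun x => dot (b (c x)) (toC x) + s (c x)
  have hτ : ∀ x ∈ G, ∀ T ∈ C, x ∈ convexHull ℝ (T : Set R3) → τ x = dot (b T) (toC x) + s T :=
    fun x hx T hT hxT => hcons x hx _ (hcC x hx) T hT (hc x hx) hxT
  have hτL : ∀ T ∈ C, ∀ x ∈ interior (convexHull ℝ (T : Set R3)),
      τ x = dot (b T) (toC x) + s T := fun T hT x hx =>
    hτ x (h.interior_tet_subset T hT hx) T hT (interior_subset hx)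
  refine ⟨τ, ⟨continuousOn_of_closed_cover C (fun T _ => isClosed_tet T) h.cover
    (ℓ := fun T x => dot (b T) (toC x) + s T) (fun T _ => continuous_dot_toC _ _) hτ,
    fun T hT => ⟨b T, s T, hτL T hT⟩⟩, ?_⟩
  have h1 : ∀ᵐ x ∂volume.restrict G, ∀ T ∈ C,
      x ∈ convexHull ℝ (T : Set R3) → v x = nedField 0 (b T) x := by
    rw [Filter.eventually_all_finset]
    exact hv
  filter_upwards [h1, h.ae_restrict_mem_interior] with x hx ⟨T, hT, hxT⟩
  rw [hx T hT (interior_subset hxT), nedField_zero_left,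
    grad_eq_of_eqOn isOpen_interior (hτL T hT) hxT]

end IsPatch

section EdgeProjection

variable {Ω : Set R3} {𝒯 : TetMesh Ω} (o : EdgeOrientation 𝒯) {E : Finset R3}

theorem mem_edgeCells {T : Finset R3} :
    T ∈ edgeCells o E ↔ T ∈ 𝒯.cells ∧ (o.tail E ∈ T ∨ o.head E ∈ T) := by
  simp [edgeCells, mem_cellsAt, and_or_left]

/-- The curl-free Nédélec fields on an extended edge patch are gradients. -/
theorem fst_mem_gradSpace (hopen : IsOpen Ω) (hE : E ∈ interiorEdges 𝒯)
    {q : CurlPair (edgePatch o E)}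
    (hq : q ∈ nedelec (edgeCells o E) (Hcurl (edgePatch o E))) (hs : q.snd = 0) :
    q.fst ∈ (isPatch_edgePatch o E).gradSpace := by
  classical
  have h := isPatch_edgePatch o E
  have hE' := mem_edges_of_mem_interiorEdges hE
  have hb : ∀ T ∈ edgeCells o E, ∃ b, IsNedOn (edgePatch o E) T q.fst 0 b := fun T hT => by
    obtain ⟨a, b, hab⟩ := hq.2 T hT
    have ha := h.isNedOn_zero_of_snd_eq_zero hq.1 hs hT hab
    exact ⟨b, ha ▸ hab⟩
  choose! b hb using hb
  obtain ⟨θ, hθ, hp⟩ := exists_lineMap_mem hopen o hE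
  have hpG : AffineMap.lineMap (o.tail E) (o.head E) θ ∈ edgePatch o E :=
    Or.inl (lineMap_mem_nodalPatch hopen o hE' hθ hp)
  obtain ⟨T₀, hT₀, hET₀, -⟩ := mem_edges.1 hE'
  have hT₀' : T₀ ∈ edgeCells o E := (mem_edgeCells o).2 ⟨hT₀, Or.inl (hET₀ (o.tail_mem hE'))⟩
  -- the increment of the potential along the edge
  let c : ℂ := dot (b T₀) (toC (o.head E - o.tail E))
  have hc : ∀ T ∈ edgeCells o E, o.tail E ∈ T → o.head E ∈ T →
      dot (b T) (toC (o.head E - o.tail E)) = c := fun T hT ht hh => by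
    have := h.dot_tangent_eq o hE' hθ hpG hq hT hT₀' ((o.subset_iff hE').2 ⟨ht, hh⟩) hET₀
      (hb T hT) (hb T₀ hT₀')
    rw [nedField_zero_left, nedField_zero_left] at this
    change _ = dot (b T₀) (toC (o.head E - o.tail E))
    rw [← edgeLength_smul_tangent o hE', toC_smul, dot_smul_right, dot_smul_right, this]
  have hdot : ∀ {x z : R3} {T T' : Finset R3}, x ∈ edgePatch o E → T ∈ edgeCells o E →
      T' ∈ edgeCells o E → x ∈ convexHull ℝ (T : Set R3) → x ∈ convexHull ℝ (T' : Set R3) →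
      z ∈ T → z ∈ T' → dot (b T) (toC (z - x)) = dot (b T') (toC (z - x)) := by
    intro x z T T' hx hT hT' hxT hxT' hz hz'
    have := h.tangential_eq_of_mem hq hT hT' (hb T hT) (hb T' hT') hx hxT hxT' (t := z - x)
      (by rw [add_sub_cancel]; exact subset_convexHull ℝ _ hz)
      (by rw [add_sub_cancel]; exact subset_convexHull ℝ _ hz')
    rwa [nedField_zero_left, nedField_zero_left] at this
  -- the potential vanishes at the tail and equals `c` at the head
  let s : Finset R3 → ℂ := fun T =>
    if o.tail E ∈ T then -dot (b T) (toC (o.tail E)) else c - dot (b T) (toC (o.head E))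
  have hs1 : ∀ T, o.tail E ∈ T → s T = -dot (b T) (toC (o.tail E)) := fun T ht => if_pos ht
  have hs2 : ∀ T ∈ edgeCells o E, o.head E ∈ T → s T = c - dot (b T) (toC (o.head E)) := by
    intro T hT hh
    by_cases ht : o.tail E ∈ T
    · rw [hs1 T ht, ← hc T hT ht hh, toC_sub, dot_sub_right]
      ring
    · exact if_neg ht
  refine h.mem_gradSpace s hb fun x hx T hT T' hT' hxT hxT' => ?_
  have hx₀ := hx
  rcases hx₀ with hx' | hx'
  · have ht := mem_of_mem_nodalPatch hx' (h.subset hT) hxT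
    have ht' := mem_of_mem_nodalPatch hx' (h.subset hT') hxT'
    have := hdot hx hT hT' hxT hxT' ht ht'
    rw [toC_sub, dot_sub_right, dot_sub_right] at this
    rw [hs1 T ht, hs1 T' ht']
    linear_combination -this
  · have ht := mem_of_mem_nodalPatch hx' (h.subset hT) hxT
    have ht' := mem_of_mem_nodalPatch hx' (h.subset hT') hxT'
    have := hdot hx hT hT' hxT hxT' ht ht'
    rw [toC_sub, dot_sub_right, dot_sub_right] at this
    rw [hs2 T hT ht, hs2 T' hT' ht']
    linear_combination -this

theorem integral_inner_sub_eq {G : Set R3} {v w z : L2V G} {f u r : R3 → C3}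
    (hf : v =ᵐ[volume.restrict G] f) (hu : w =ᵐ[volume.restrict G] u)
    (hr : z =ᵐ[volume.restrict G] r) :
    ∫ x in G, inner ℂ (f x) (u x - r x) = inner ℂ v (w - z) := by
  rw [L2.inner_def]
  refine integral_congr_ae ?_
  filter_upwards [hf, hu, hr, Lp.coeFn_sub w z] with x h1 h2 h3 h4
  rw [h4, Pi.sub_apply, h1, h2, h3]

/-- The local problem on an extended edge patch is uniquely solvable. -/
theorem exists_edgeProjection (hopen : IsOpen Ω) (hE : E ∈ interiorEdges 𝒯) :
    ∃ Λ : CurlPair (edgePatch o E) →L[ℂ] CurlPair (edgePatch o E), ∀ p u cu,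
      p.fst =ᵐ[volume.restrict (edgePatch o E)] u → p.snd =ᵐ[volume.restrict (edgePatch o E)] cu →
      ∀ q, IsEdgeProjection o E u cu q ↔ q = Λ p := by
  have h := isPatch_edgePatch o E
  have := h.finiteDimensional_nedelec le_rfl
  have := h.finiteDimensional_gradSpace
  obtain ⟨Λ, hΛ⟩ := exists_mixed_projection (nedelec (edgeCells o E) (Hcurl (edgePatch o E)))
    h.gradSpace (fun g hg => h.grad_mem_nedelec hg) fun q hq hs hg =>
      h.eq_zero_of_fst_eq_zero hq.1
        (inner_self_eq_zero.1 (hg q.fst (fst_mem_gradSpace o hopen hE hq hs)))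
  refine ⟨Λ, fun p u cu hu hcu q => ?_⟩
  rw [← hΛ]
  refine and_congr_right fun _ => and_congr ⟨fun H g hg => ?_, fun H τ hτ => ?_⟩
    ⟨fun H v hv => ?_, fun H v hv => ?_⟩
  · obtain ⟨τ, hτ, hgτ⟩ := hg
    rw [← H τ hτ]
    exact (integral_inner_sub_eq hgτ hu (Filter.EventuallyEq.refl _ _)).symm
  · obtain ⟨g, hgτ, -⟩ := h.exists_grad hτ
    rw [← H g ⟨τ, hτ, hgτ⟩]
    exact integral_inner_sub_eq hgτ hu (Filter.EventuallyEq.refl _ _)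
  · rw [← H v hv]
    exact (integral_inner_sub_eq (Filter.EventuallyEq.refl _ _) hcu (Filter.EventuallyEq.refl _ _)).symm
  · rw [← H v hv]
    exact integral_inner_sub_eq (Filter.EventuallyEq.refl _ _) hcu (Filter.EventuallyEq.refl _ _)

end EdgeProjection

/-! ### Nodal potentials -/

namespace IsPatch

variable {Ω : Set R3} {𝒯 : TetMesh Ω} {G : Set R3} {C : Finset (Finset R3)} (h : IsPatch 𝒯 G C)

include h

theorem integrable_lagrange {τ : R3 → ℂ} (hτ : τ ∈ lagrange G C) :
    Integrable τ (volume.restrict G) := by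
  have hfin := h.isFiniteMeasure
  choose! g s hgs using hτ.2
  choose! B hB using fun T (_ : T ∈ C) => (isCompact_tet T).exists_bound_of_continuousOn
    (continuous_dot_toC (g T) (s T)).continuousOn
  refine Integrable.of_bound (hτ.1.aestronglyMeasurable h.isOpen.measurableSet) (∑ T ∈ C, |B T|) ?_
  filter_upwards [ae_restrict_mem h.isOpen.measurableSet] with x hx
  obtain ⟨T, hT, hxT⟩ := h.cover x hx
  rw [h.eq_of_mem_tet hτ.1 hT (hgs T hT) hx hxT]
  exact (hB T hT x hxT).trans ((le_abs_self _).trans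
    (Finset.single_le_sum (f := fun T => |B T|) (fun _ _ => abs_nonneg _) hT))

/-- On a patch whose tetrahedra have a common point, the gradient determines a Lagrange function up
to a constant. -/
theorem eq_of_grad_ae_eq_zero {τ : R3 → ℂ} (hτ : τ ∈ lagrange G C)
    (hg : grad τ =ᵐ[volume.restrict G] 0) {y : R3} (hy : y ∈ G)
    (hyC : ∀ T ∈ C, y ∈ convexHull ℝ (T : Set R3)) {x : R3} (hx : x ∈ G) : τ x = τ y := by
  obtain ⟨T, hT, hxT⟩ := h.cover x hx
  obtain ⟨g, s, hgs⟩ := hτ.2 T hT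
  have hg0 : g = 0 := by
    by_contra hn
    have hpos : volume (interior (convexHull ℝ (T : Set R3))) ≠ 0 :=
      (isOpen_interior.measure_pos volume (h.isTet hT).interior_nonempty).ne'
    rw [Filter.EventuallyEq, ae_restrict_iff' h.isOpen.measurableSet] at hg
    refine hpos (measure_mono_null (fun z hz => ?_) (ae_iff.1 hg))
    intro h2
    have h3 := h2 (h.interior_tet_subset T hT hz)
    rw [grad_eq_of_eqOn isOpen_interior hgs hz] at h3
    exact hn h3
  rw [h.eq_of_mem_tet hτ.1 hT hgs hx hxT, h.eq_of_mem_tet hτ.1 hT hgs hy (hyC T hT), hg0,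
    dot_zero_left, dot_zero_left]

/-- The value at `y` of the potential with mean zero is a linear functional of the gradient. -/
theorem exists_potentialValue {y : R3} (hy : y ∈ G)
    (hyC : ∀ T ∈ C, y ∈ convexHull ℝ (T : Set R3)) :
    ∃ ν : h.gradSpace →ₗ[ℂ] ℂ, ∀ (w : h.gradSpace), ∀ τ ∈ lagrange G C,
      (w : L2V G) =ᵐ[volume.restrict G] grad τ →
        ν w = τ y - ((volume G).toReal : ℂ)⁻¹ * ∫ x in G, τ x := by
  have hpos : ((volume G).toReal : ℂ) ≠ 0 := by
    exact_mod_cast (ENNReal.toReal_pos (h.isOpen.measure_pos volume ⟨y, hy⟩).ne'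
      h.measure_lt_top.ne).ne'
  let N : (R3 → ℂ) → ℂ := fun τ => τ y - ((volume G).toReal : ℂ)⁻¹ * ∫ x in G, τ x
  have hadd : ∀ {τ τ'}, τ ∈ lagrange G C → τ' ∈ lagrange G C → N (τ + τ') = N τ + N τ' := by
    intro τ τ' hτ hτ'
    simp only [N, Pi.add_apply]
    rw [integral_add (h.integrable_lagrange hτ) (h.integrable_lagrange hτ')]
    ring
  have hsmul : ∀ {τ} (z : ℂ), N (z • τ) = z * N τ := by
    intro τ z
    simp only [N, Pi.smul_apply, smul_eq_mul]
    rw [integral_const_mul]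
    ring
  have hzero : ∀ {τ}, τ ∈ lagrange G C → grad τ =ᵐ[volume.restrict G] 0 → N τ = 0 := by
    intro τ hτ hg
    have e : ∫ x in G, τ x = ∫ x in G, τ y :=
      setIntegral_congr_fun h.isOpen.measurableSet fun x hx => h.eq_of_grad_ae_eq_zero hτ hg hy hyC hx
    simp only [N]
    rw [e, setIntegral_const, Complex.real_smul, measureReal_def, inv_mul_cancel_left₀ hpos, sub_self]
  have huniq : ∀ {τ τ'}, τ ∈ lagrange G C → τ' ∈ lagrange G C →
      grad τ =ᵐ[volume.restrict G] grad τ' → N τ = N τ' := by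
    intro τ τ' hτ hτ' hg
    have h1 := hzero (lagrange_add hτ (lagrange_smul hτ' (-1))) (by
      filter_upwards [h.grad_add_ae hτ (lagrange_smul hτ' (-1)), h.grad_smul_ae hτ' (-1), hg]
        with x h1 h2 h3
      rw [h1, Pi.add_apply, h2, Pi.smul_apply, h3]
      simp)
    rw [hadd hτ (lagrange_smul hτ' (-1)), hsmul] at h1
    linear_combination h1
  choose τ hτ hwτ using fun w : h.gradSpace => w.2
  refine ⟨{ toFun := fun w => N (τ w), map_add' := fun w w' => ?_, map_smul' := fun z w => ?_ },
    fun w τ' hτ' hw' => huniq (hτ w) hτ' ((hwτ w).symm.trans hw')⟩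
  · rw [← hadd (hτ w) (hτ w')]
    refine huniq (hτ _) (lagrange_add (hτ w) (hτ w')) ?_
    filter_upwards [hwτ (w + w'), hwτ w, hwτ w', h.grad_add_ae (hτ w) (hτ w'),
      Lp.coeFn_add (w : L2V G) w'] with x h1 h2 h3 h4 h5
    rw [← h1, h4, Pi.add_apply, ← h2, ← h3]
    exact h5
  · rw [RingHom.id_apply, smul_eq_mul, ← hsmul]
    refine huniq (hτ _) (lagrange_smul (hτ w) z) ?_
    filter_upwards [hwτ (z • w), hwτ w, h.grad_smul_ae (hτ w) z,
      Lp.coeFn_smul z (w : L2V G)] with x h1 h2 h3 h4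
    rw [← h1, h3, Pi.smul_apply, ← h2]
    exact h4

end IsPatch

/-- A linear functional on a finite-dimensional space, composed with the orthogonal projection. -/
theorem exists_clm_starProjection {H : Type*} [NormedAddCommGroup H] [InnerProductSpace ℂ H]
    {D : Submodule ℂ H} [FiniteDimensional ℂ D] (ν : D →ₗ[ℂ] ℂ) :
    ∃ Φ : H →L[ℂ] ℂ, ∀ v, ∃ w : D, (w : H) = D.starProjection v ∧ Φ v = ν w :=
  ⟨ν.toContinuousLinearMap ∘L D.orthogonalProjectionOnto, fun v =>
    ⟨D.orthogonalProjectionOnto v, (Submodule.starProjection_apply D v).symm, rfl⟩⟩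

theorem exists_clm_add_sub {H P N V : Type*} [NormedAddCommGroup H] [NormedSpace ℂ H]
    [NormedAddCommGroup P] [NormedSpace ℂ P] [NormedAddCommGroup N] [NormedSpace ℂ N]
    [NormedAddCommGroup V] [NormedSpace ℂ V] (R : H →L[ℂ] P) (F : P →L[ℂ] V) (S : V →L[ℂ] ℂ)
    (Λ : P →L[ℂ] N) (ι : N →L[ℂ] P) (μ : N →L[ℂ] ℂ) :
    ∃ m : H →L[ℂ] ℂ, ∀ u, m u = S (F (R u)) + (μ (Λ (R u)) - S (F (ι (Λ (R u))))) :=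
  ⟨S ∘L F ∘L R + (μ ∘L Λ ∘L R - S ∘L F ∘L ι ∘L Λ ∘L R), fun _ => rfl⟩

section Coefficients

variable {Ω : Set R3} {𝒯 : TetMesh Ω}

/-- The mean-free potential of the projection onto the gradients solves the discrete Neumann
problem. -/
theorem exists_isNodalPotential {y : R3} (hyG : y ∈ nodalPatch 𝒯 y)
    [FiniteDimensional ℂ (isPatch_nodalPatch 𝒯 y).gradSpace] {v : L2V (nodalPatch 𝒯 y)}
    {u : R3 → C3} (hvu : v =ᵐ[volume.restrict (nodalPatch 𝒯 y)] u) :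
    ∃ q, IsNodalPotential 𝒯 y u q := by
  have h := isPatch_nodalPatch 𝒯 y
  have hfin := h.isFiniteMeasure
  have hpos : ((volume (nodalPatch 𝒯 y)).toReal : ℂ) ≠ 0 := by
    exact_mod_cast (ENNReal.toReal_pos (h.isOpen.measure_pos volume ⟨y, hyG⟩).ne'
      h.measure_lt_top.ne).ne'
  obtain ⟨τ, hτ, hvτ⟩ := h.gradSpace.starProjection_apply_mem v
  set m := ((volume (nodalPatch 𝒯 y)).toReal : ℂ)⁻¹ * ∫ x in nodalPatch 𝒯 y, τ x with hm
  have hc := IsPatch.lagrange_const (G := nodalPatch 𝒯 y) (C := cellsAt 𝒯 y) (-m)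
  have hg0 : grad (fun _ : R3 => -m) = 0 := by
    funext x
    ext i
    simp [grad, pd]
  refine ⟨τ + fun _ => -m, IsPatch.lagrange_add hτ hc, fun τ' hτ' => ?_, ?_⟩
  · obtain ⟨g, hg, -⟩ := h.exists_grad hτ'
    have e : h.gradSpace.starProjection v
        =ᵐ[volume.restrict (nodalPatch 𝒯 y)] grad (τ + fun _ => -m) := by
      filter_upwards [hvτ, h.grad_add_ae hτ hc] with x h1 h2
      rw [h1, h2, Pi.add_apply, hg0]
      simp
    rw [integral_inner_sub_eq hg hvu e]
    exact h.gradSpace.sub_starProjection_mem_orthogonal v g ⟨τ', hτ', hg⟩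
  · change ∫ x in nodalPatch 𝒯 y, (τ x + -m) = 0
    rw [integral_add (h.integrable_lagrange hτ) (integrable_const _), setIntegral_const,
      Complex.real_smul, measureReal_def, hm, mul_neg, mul_inv_cancel_left₀ hpos, add_neg_cancel]

theorem IsNodalPotential.grad_ae_eq {y : R3}
    [FiniteDimensional ℂ (isPatch_nodalPatch 𝒯 y).gradSpace] {v : L2V (nodalPatch 𝒯 y)}
    {u : R3 → C3} (hvu : v =ᵐ[volume.restrict (nodalPatch 𝒯 y)] u) {q : R3 → ℂ}
    (hq : IsNodalPotential 𝒯 y u q) :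
    (isPatch_nodalPatch 𝒯 y).gradSpace.starProjection v
      =ᵐ[volume.restrict (nodalPatch 𝒯 y)] grad q := by
  have h := isPatch_nodalPatch 𝒯 y
  obtain ⟨w, hw, -⟩ := h.exists_grad hq.1
  rw [h.gradSpace.eq_starProjection_of_mem_orthogonal (v := w) ⟨q, hq.1, hw⟩]
  · exact hw
  · rintro g ⟨τ', hτ', hg⟩
    rw [← hq.2.1 τ' hτ']
    exact (integral_inner_sub_eq hg hvu hw).symm

/-- The nodal value is a continuous functional, because the discrete Neumann problem is uniquely
solvable. -/
theorem exists_nodalValueCLM (hopen : IsOpen Ω) {y : R3} (hy : ∃ T ∈ 𝒯.cells, y ∈ T) :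
    ∃ Φ : L2V (nodalPatch 𝒯 y) →L[ℂ] ℂ, ∀ (v : L2V (nodalPatch 𝒯 y)) (u : R3 → C3),
      v =ᵐ[volume.restrict (nodalPatch 𝒯 y)] u → nodalValue 𝒯 y u = Φ v := by
  by_cases hyΩ : y ∈ Ω
  swap
  · exact ⟨0, fun v u _ => by rw [nodalValue, if_neg hyΩ]; rfl⟩
  obtain ⟨T₀, hT₀, hyT₀⟩ := hy
  have h := isPatch_nodalPatch 𝒯 y
  have hyG := mem_nodalPatch_self hyΩ hopen hT₀ hyT₀
  have := h.finiteDimensional_gradSpace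
  obtain ⟨ν, hν⟩ := h.exists_potentialValue hyG fun T hT =>
    subset_convexHull ℝ _ (mem_cellsAt.1 hT).2
  obtain ⟨Φ, hΦ⟩ := exists_clm_starProjection ν
  refine ⟨Φ, fun v u hvu => ?_⟩
  rw [nodalValue, if_pos hyΩ]
  have hq : IsNodalPotential 𝒯 y u (nodalPotential 𝒯 y u) :=
    Classical.epsilon_spec (p := fun q => IsNodalPotential 𝒯 y u q)
      (exists_isNodalPotential hyG hvu)
  obtain ⟨w, hw, hΦv⟩ := hΦ v
  rw [hΦv, hν w _ hq.1 (by rw [hw]; exact hq.grad_ae_eq hvu), hq.2.2, mul_zero, sub_zero]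

variable (o : EdgeOrientation 𝒯) {E : Finset R3}

/-- The coefficients of `S¹` are continuous on `L²` of the extended edge patch. The weight `z_E^1`
enters only as a square integrable field. -/
theorem exists_sCoeffCLM (hopen : IsOpen Ω) (hE : E ∈ edges 𝒯) :
    ∃ S : L2V (edgePatch o E) →L[ℂ] ℂ, ∀ (v : L2V (edgePatch o E)) (u : R3 → C3),
      v =ᵐ[volume.restrict (edgePatch o E)] u → sCoeff o E u = S v := by
  obtain ⟨T, hT, hET, -⟩ := mem_edges.1 hE
  obtain ⟨Φ₁, hΦ₁⟩ := exists_nodalValueCLM hopen ⟨T, hT, hET (o.tail_mem hE)⟩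
  obtain ⟨Φ₂, hΦ₂⟩ := exists_nodalValueCLM hopen ⟨T, hT, hET (o.head_mem hE)⟩
  have hs₁ : nodalPatch 𝒯 (o.tail E) ⊆ edgePatch o E := Set.subset_union_left
  have hs₂ : nodalPatch 𝒯 (o.head E) ⊆ edgePatch o E := Set.subset_union_right
  obtain ⟨R₁, hR₁⟩ := exists_restrictCLM hs₁
  obtain ⟨R₂, hR₂⟩ := exists_restrictCLM hs₂
  obtain ⟨I, hI⟩ := exists_dotCLM (Lp.memLp (edgeWeight o E).fst)
  refine ⟨(edgeLength o E : ℂ)⁻¹ • (I + (Φ₂ ∘L R₂ - Φ₁ ∘L R₁)), fun v u hvu => ?_⟩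
  have e1 := hΦ₁ (R₁ v) u ((hR₁ v).trans (ae_mono (Measure.restrict_mono hs₁ le_rfl) hvu))
  have e2 := hΦ₂ (R₂ v) u ((hR₂ v).trans (ae_mono (Measure.restrict_mono hs₂ le_rfl) hvu))
  have e3 : ∫ x in edgePatch o E, dot (u x) ((edgeWeight o E).fst x) = I v := by
    rw [hI]
    exact integral_congr_ae (by filter_upwards [hvu] with x hx; rw [hx])
  rw [sCoeff, e1, e2, e3]
  rfl

theorem coarse_mem_nedelec {v : H0curl Ω} (hv : v ∈ coarse 𝒯) :
    (v : CurlPair Ω) ∈ nedelec 𝒯.cells (Hcurl Ω) :=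
  ⟨H0curl_le_Hcurl Ω v.2, hv.2⟩

/-- The local projection on an extended edge patch as a continuous map into the Nédélec space. It
is the identity on that space. -/
theorem exists_edgeProjectionCLM (hopen : IsOpen Ω) (hE : E ∈ interiorEdges 𝒯) :
    ∃ Λ : CurlPair (edgePatch o E) →L[ℂ] nedelec (edgeCells o E) (Hcurl (edgePatch o E)),
      (∀ (p : CurlPair (edgePatch o E)) (u cu : R3 → C3),
        p.fst =ᵐ[volume.restrict (edgePatch o E)] u →
        p.snd =ᵐ[volume.restrict (edgePatch o E)] cu → edgeProjection o E u cu = Λ p) ∧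
      ∀ p (hp : p ∈ nedelec (edgeCells o E) (Hcurl (edgePatch o E))), Λ p = ⟨p, hp⟩ := by
  obtain ⟨Λ, hΛ⟩ := exists_edgeProjection o hopen hE
  have hspec : ∀ p, IsEdgeProjection o E p.fst p.snd (Λ p) := fun p =>
    (hΛ p p.fst p.snd (Filter.EventuallyEq.refl _ _) (Filter.EventuallyEq.refl _ _) _).2 rfl
  refine ⟨Λ.codRestrict _ fun p => (hspec p).1, fun p u cu hu hcu => ?_, fun p hp => ?_⟩
  · exact (hΛ p u cu hu hcu _).1 (Classical.epsilon_spec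
      (p := fun q => IsEdgeProjection o E u cu q) ⟨_, (hΛ p u cu hu hcu _).2 rfl⟩)
  · refine Subtype.ext ((hΛ p p.fst p.snd (Filter.EventuallyEq.refl _ _)
      (Filter.EventuallyEq.refl _ _) p).1 ⟨hp, ?_, ?_⟩).symm <;> simp

/-- The edge mean exists and is continuous on the finite-dimensional local Nédélec space. -/
theorem exists_edgeMeanCLM (hopen : IsOpen Ω) (hE : E ∈ interiorEdges 𝒯) :
    ∃ μ : nedelec (edgeCells o E) (Hcurl (edgePatch o E)) →L[ℂ] ℂ,
      ∀ q : nedelec (edgeCells o E) (Hcurl (edgePatch o E)),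
        edgeMean o E (edgePatch o E) (q : CurlPair (edgePatch o E)).fst = μ q ∧
        ∀ m, HasEdgeMean o E (edgePatch o E) (q : CurlPair (edgePatch o E)).fst m ↔ m = μ q := by
  have hE' := mem_edges_of_mem_interiorEdges hE
  have h := isPatch_edgePatch o E
  have := h.finiteDimensional_nedelec (V := Hcurl (edgePatch o E)) le_rfl
  obtain ⟨θ, hθ, hp⟩ := exists_lineMap_mem hopen o hE
  obtain ⟨μ, hμ⟩ := h.exists_edgeMean o hE' hθ (Or.inl (lineMap_mem_nodalPatch hopen o hE' hθ hp))
  exact ⟨μ.toContinuousLinearMap, fun q =>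
    ⟨edgeMean_eq o ((hμ q _).2 rfl) fun m' hm' => (hμ q m').1 hm', hμ q⟩⟩

/-- A global Nédélec field has a mean over every interior edge, the same from all tetrahedra around
the edge. -/
theorem exists_hasEdgeMean (hopen : IsOpen Ω) (hint : interior (closure Ω) ⊆ Ω)
    (hE : E ∈ interiorEdges 𝒯) {u : CurlPair Ω} (hu : u ∈ nedelec 𝒯.cells (Hcurl Ω)) :
    ∃ m, HasEdgeMean o E Ω u.fst m := by
  obtain ⟨θ, hθ, hp⟩ := exists_lineMap_mem hopen o hE
  obtain ⟨μ, hμ⟩ := (isPatch_domain 𝒯 hopen hint).exists_edgeMean o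
    (mem_edges_of_mem_interiorEdges hE) hθ hp
  exact ⟨μ ⟨u, hu⟩, (hμ ⟨u, hu⟩ _).2 rfl⟩

set_option maxHeartbeats 1000000 in
/-- The coefficients of the Falk-Winther interpolant are continuous functionals, and on the coarse
space they are the edge means: there the local projections act as the identity, so that the two
contributions of `S¹` cancel. -/
theorem exists_coefficientCLM (hopen : IsOpen Ω) (hint : interior (closure Ω) ⊆ Ω)
    (hE : E ∈ interiorEdges 𝒯) :
    ∃ m : H0curl Ω →L[ℂ] ℂ,
      (∀ u : H0curl Ω, sCoeff o E (u : CurlPair Ω).fst + (edgeMean o E (edgePatch o E)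
          (edgeProjection o E (u : CurlPair Ω).fst (u : CurlPair Ω).snd).fst
        - sCoeff o E (edgeProjection o E (u : CurlPair Ω).fst (u : CurlPair Ω).snd).fst) = m u) ∧
      ∀ u ∈ coarse 𝒯, HasEdgeMean o E Ω (u : CurlPair Ω).fst (m u) := by
  obtain ⟨S, hS⟩ := exists_sCoeffCLM o hopen (mem_edges_of_mem_interiorEdges hE)
  obtain ⟨Λ, hΛ, hfix⟩ := exists_edgeProjectionCLM o hopen hE
  obtain ⟨μ, hμ⟩ := exists_edgeMeanCLM o hopen hE
  have hsub := edgePatch_subset hint o E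
  obtain ⟨R, hR⟩ := exists_restrictCLM_pair hsub
  obtain ⟨m, hm⟩ := exists_clm_add_sub (R ∘L (H0curl Ω).subtypeL)
    (WithLp.fstL 2 ℂ (L2V (edgePatch o E)) (L2V (edgePatch o E))) S Λ (Submodule.subtypeL _) μ
  have hm' : ∀ u : H0curl Ω, m u = S (R u).fst
      + (μ (Λ (R u)) - S (Λ (R u) : CurlPair (edgePatch o E)).fst) := hm
  refine ⟨m, fun u => ?_, fun u hu => ?_⟩
  · rw [hm', hΛ _ _ _ (hR u).1 (hR u).2, hS _ _ (hR u).1, hS _ _ (Filter.EventuallyEq.refl _ _),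
      (hμ _).1]
  · have hmem := coarse_mem_nedelec hu
    have hpN : R u ∈ nedelec (edgeCells o E) (Hcurl (edgePatch o E)) :=
      mem_nedelec_restrict hopen.measurableSet hsub (isPatch_edgePatch o E).subset hmem (hR u).1
        (hR u).2
    obtain ⟨c, hc⟩ := exists_hasEdgeMean o hopen hint hE hmem
    have h2 := ((hμ ⟨R u, hpN⟩).2 _).1 (hc.restrict hsub (hR u).1)
    have h4 : m u = c := by
      rw [hm', hfix _ hpN, ← h2, add_sub_cancel]
    rw [h4]
    exact hc

/-- The Falk-Winther operator in terms of its coefficients. -/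
theorem falkWinther_eq {m : Finset R3 → H0curl Ω →L[ℂ] ℂ}
    (hm : ∀ E ∈ interiorEdges 𝒯, ∀ u : H0curl Ω, sCoeff o E (u : CurlPair Ω).fst
      + (edgeMean o E (edgePatch o E)
          (edgeProjection o E (u : CurlPair Ω).fst (u : CurlPair Ω).snd).fst
        - sCoeff o E (edgeProjection o E (u : CurlPair Ω).fst (u : CurlPair Ω).snd).fst) = m E u)
    (u : H0curl Ω) :
    falkWinther o u = ∑ E ∈ interiorEdges 𝒯, m E u • edgeBasis o E := by
  rw [falkWinther, opS, ← Finset.sum_add_distrib]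
  refine Finset.sum_congr rfl fun E hE => ?_
  rw [← hm E hE u, add_smul]

end Coefficients

/-! ### Whitney fields as limits of test fields -/

/-- A field that is, together with its curl, the bounded pointwise limit of test fields belongs to
`H₀(curl)`. -/
theorem mem_H0curl_of_tendsto {G : Set R3} (hG : MeasurableSet G)
    [IsFiniteMeasure (volume.restrict G)] {p : CurlPair G} {φ : ℕ → R3 → C3}
    (hφ : ∀ n, IsTest G (φ n)) {M : ℝ} (hM : ∀ n, ∀ x ∈ G, ‖φ n x‖ ≤ M)
    (hM' : ∀ n, ∀ x ∈ G, ‖curl (φ n) x‖ ≤ M)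
    (hlim : ∀ᵐ x ∂volume.restrict G, Filter.Tendsto (fun n => φ n x) Filter.atTop (nhds (p.fst x)) ∧
      Filter.Tendsto (fun n => curl (φ n) x) Filter.atTop (nhds (p.snd x))) : p ∈ H0curl G := by
  have key : ∀ (z : L2V G) (w : L2V G) (ψ : ℕ → R3 → C3)
      (hψ : ∀ n, MemLp (ψ n) 2 (volume.restrict G)), (∀ n, ∀ x ∈ G, ‖ψ n x‖ ≤ M) →
      (∀ᵐ x ∂volume.restrict G, Filter.Tendsto (fun n => ψ n x) Filter.atTop (nhds (w x))) →
      Filter.Tendsto (fun n => (inner ℂ z ((hψ n).toLp (ψ n)) : ℂ)) Filter.atTop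
        (nhds (inner ℂ z w)) := by
    intro z w ψ hψ hb hl
    simp only [← fun n => integral_inner_eq (hψ n) z, L2.inner_def]
    refine tendsto_integral_of_dominated_convergence (fun x => ‖z x‖ * M) (fun n => ?_) ?_
      (fun n => ?_) ?_
    · exact (Lp.memLp z).aestronglyMeasurable.inner (hψ n).aestronglyMeasurable
    · exact ((Lp.memLp z).integrable (by norm_num)).norm.mul_const M
    · filter_upwards [ae_restrict_mem hG] with x hx
      exact (norm_inner_le_norm _ _).trans (mul_le_mul_of_nonneg_left (hb n x hx) (norm_nonneg _))
    · filter_upwards [hl] with x hx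
      exact tendsto_const_nhds.inner hx
  rw [H0curl, ← Submodule.orthogonal_orthogonal_eq_closure]
  intro z hz
  have h0 : ∀ n, (inner ℂ z.fst ((hφ n).memLp.toLp (φ n))
      + inner ℂ z.snd ((hφ n).memLp_curl.toLp (curl (φ n))) : ℂ) = 0 := by
    intro n
    have h1 := hz (WithLp.toLp 2 ((hφ n).memLp.toLp (φ n), (hφ n).memLp_curl.toLp (curl (φ n))))
      (Submodule.subset_span ⟨φ n, hφ n, (hφ n).memLp.coeFn_toLp, (hφ n).memLp_curl.coeFn_toLp⟩)
    rw [← inner_conj_symm, map_eq_zero, WithLp.prod_inner_apply] at h1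
    exact h1
  have h1 := (key z.fst p.fst φ (fun n => (hφ n).memLp) hM (hlim.mono fun x hx => hx.1)).add
    (key z.snd p.snd (fun n => curl (φ n)) (fun n => (hφ n).memLp_curl) hM'
      (hlim.mono fun x hx => hx.2))
  simp only [h0] at h1
  rw [WithLp.prod_inner_apply]
  exact tendsto_nhds_unique h1 tendsto_const_nhds

theorem curl_whitney {a b : R3 → ℂ} (ha : ContDiff ℝ ∞ a) (hb : ContDiff ℝ ∞ b) (x : R3) :
    curl (fun x => a x • grad b x - b x • grad a x) x = (2 : ℂ) • cross (grad a x) (grad b x) := by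
  have hd : ∀ {f : R3 → ℂ}, ContDiff ℝ ∞ f → DifferentiableAt ℝ f x := fun hf =>
    hf.differentiable (by simp) x
  have hpd : ∀ {f : R3 → ℂ}, ContDiff ℝ ∞ f → ∀ k, DifferentiableAt ℝ (pd k f) x := fun hf k =>
    hd (contDiff_pd hf k)
  have hmul : ∀ {f g : R3 → ℂ} (i : Fin 3), DifferentiableAt ℝ f x → DifferentiableAt ℝ g x →
      pd i (fun y => f y * g y) x = f x * pd i g x + g x * pd i f x := by
    intro f g i hf hg
    simp only [pd]
    rw [fderiv_fun_mul hf hg]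
    simp
  have hsub : ∀ {f g : R3 → ℂ} (i : Fin 3), DifferentiableAt ℝ f x → DifferentiableAt ℝ g x →
      pd i (fun y => f y - g y) x = pd i f x - pd i g x := by
    intro f g i hf hg
    simp only [pd]
    rw [fderiv_fun_sub hf hg]
    rfl
  have h : ∀ i k, pd i (fun y => (a y • grad b y - b y • grad a y) k) x
      = a x * pd i (pd k b) x + pd k b x * pd i a x
        - (b x * pd i (pd k a) x + pd k a x * pd i b x) := by
    intro i k
    have e : (fun y => (a y • grad b y - b y • grad a y) k)
        = fun y => a y * pd k b y - b y * pd k a y := rfl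
    rw [e, ← hmul i (hd ha) (hpd hb k), ← hmul i (hd hb) (hpd ha k)]
    exact hsub i ((hd ha).mul (hpd hb k)) ((hd hb).mul (hpd ha k))
  rw [curl]
  simp only [h]
  rw [pd_pd_comm ha 1 2, pd_pd_comm ha 2 0, pd_pd_comm ha 0 1, pd_pd_comm hb 1 2,
    pd_pd_comm hb 2 0, pd_pd_comm hb 0 1]
  ext i
  fin_cases i <;> simp [cross, grad] <;> ring

/-- The mollification radius is so small that the mollification of the part of an `L`-Lipschitz
function above the level `1 / (n + 1)` vanishes below half this level. -/
def approxRadius (L : ℝ≥0) (n : ℕ) : ℝ := 1 / ((n : ℝ) + 1) / (2 * ((L : ℝ) + 1))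

theorem approxRadius_pos (L : ℝ≥0) (n : ℕ) : 0 < approxRadius L n := by
  unfold approxRadius
  positivity

theorem mul_approxRadius_le (L : ℝ≥0) (n : ℕ) :
    L * approxRadius L n ≤ 1 / ((n : ℝ) + 1) / 2 := by
  unfold approxRadius
  have hn : (0 : ℝ) < n + 1 := by positivity
  have hL : (0 : ℝ) < L + 1 := by positivity
  have e : (L : ℝ) * (1 / ((n : ℝ) + 1) / (2 * (L + 1))) = 1 / ((n : ℝ) + 1) / 2 * (L / (L + 1)) := by
    field_simp
  rw [e]
  refine mul_le_of_le_one_right (by positivity) ?_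
  rw [div_le_one hL]
  linarith

theorem approxRadius_le (L : ℝ≥0) (n : ℕ) : approxRadius L n ≤ 1 / ((n : ℝ) + 1) := by
  unfold approxRadius
  refine div_le_self (by positivity) ?_
  have : (0 : ℝ) ≤ L := L.2
  linarith

/-- A smooth approximation of the positive part of `l` that vanishes where `l` is small. -/
def approx (l : R3 → ℝ) (L : ℝ≥0) (n : ℕ) : R3 → ℂ :=
  mollify (approxRadius_pos L n) fun x => ((max (l x - 1 / ((n : ℝ) + 1)) 0 : ℝ) : ℂ)

section Approx

variable {l : R3 → ℝ} {L : ℝ≥0} (hl : LipschitzWith L l)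

include hl

theorem lipschitzWith_cutoff (δ : ℝ) :
    LipschitzWith L fun x => ((max (l x - δ) 0 : ℝ) : ℂ) := by
  refine LipschitzWith.of_dist_le_mul fun x y => ?_
  rw [dist_eq_norm, ← Complex.ofReal_sub, Complex.norm_real, Real.norm_eq_abs]
  refine (abs_max_sub_max_le_abs _ _ _).trans ?_
  rw [sub_sub_sub_cancel_right, ← Real.dist_eq]
  exact hl.dist_le_mul x y

theorem contDiff_approx (n : ℕ) : ContDiff ℝ ∞ (approx l L n) :=
  contDiff_mollify _ (lipschitzWith_cutoff hl _).continuous.locallyIntegrable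

theorem norm_grad_approx_le (n : ℕ) (x : R3) : ‖grad (approx l L n) x‖ ≤ 3 * L :=
  norm_grad_le (lipschitzWith_mollify _ (lipschitzWith_cutoff hl _)) x

theorem norm_approx_le (n : ℕ) (x : R3) : ‖approx l L n x‖ ≤ |l x| + 1 := by
  have h1 := dist_mollify_le (approxRadius_pos L n) (lipschitzWith_cutoff hl (1 / ((n : ℝ) + 1))) x
  have h2 := mul_approxRadius_le L n
  have h3 : 1 / ((n : ℝ) + 1) ≤ 1 := by
    rw [div_le_one (by positivity)]
    linarith [Nat.cast_nonneg (α := ℝ) n]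
  have h3' : 0 < 1 / ((n : ℝ) + 1) := by positivity
  have h4 : ‖((max (l x - 1 / ((n : ℝ) + 1)) 0 : ℝ) : ℂ)‖ ≤ |l x| := by
    rw [Complex.norm_real, Real.norm_of_nonneg (le_max_right _ _)]
    refine max_le ?_ (abs_nonneg _)
    linarith [le_abs_self (l x)]
  rw [dist_eq_norm] at h1
  have h5 := norm_le_norm_add_norm_sub' (approx l L n x)
    ((max (l x - 1 / ((n : ℝ) + 1)) 0 : ℝ) : ℂ)
  change ‖approx l L n x - _‖ ≤ _ at h1
  linarith

theorem approx_eq_zero {n : ℕ} {x : R3} (hx : l x < 1 / ((n : ℝ) + 1) / 2) :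
    approx l L n x = 0 := by
  unfold approx mollify
  refine integral_eq_zero_of_ae (Filter.Eventually.of_forall fun z => ?_)
  change eta _ z • ((max (l (x - z) - 1 / ((n : ℝ) + 1)) 0 : ℝ) : ℂ) = 0
  rcases le_or_gt (approxRadius L n) ‖z‖ with hz | hz
  · rw [eta_eq_zero _ hz, zero_smul]
  · have h1 := hl.dist_le_mul (x - z) x
    rw [Real.dist_eq, dist_eq_norm, sub_sub_cancel_left, norm_neg] at h1
    have h2 := (le_abs_self _).trans (h1.trans (mul_le_mul_of_nonneg_left hz.le L.2))
    have h3 := mul_approxRadius_le L n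
    change l (x - z) - l x ≤ L * approxRadius L n at h2
    rw [max_eq_right (by linarith), Complex.ofReal_zero, smul_zero]

theorem grad_approx_eq_zero {n : ℕ} {x : R3} (hx : l x < 1 / ((n : ℝ) + 1) / 2) :
    grad (approx l L n) x = 0 := by
  have h : approx l L n =ᶠ[nhds x] fun y => dot 0 (toC y) + 0 := by
    filter_upwards [hl.continuous.continuousAt.eventually_lt continuousAt_const hx] with y hy
    rw [approx_eq_zero hl hy, dot_zero_left, add_zero]
  rw [grad_congr h, grad_dot_toC]

/-- Where `l` is positive and affine, its approximations are exact up to the cut-off level. -/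
theorem eventually_approx_eq {x : R3} (hx : 0 < l x) {g : C3} {s : ℂ}
    (hg : ∀ᶠ y in nhds x, (l y : ℂ) = dot g (toC y) + s) :
    ∀ᶠ n in Filter.atTop, approx l L n x = (l x : ℂ) - ((1 / ((n : ℝ) + 1) : ℝ) : ℂ) ∧
      grad (approx l L n) x = g := by
  have h1 : ∀ᶠ y in nhds x, l x / 2 < l y :=
    hl.continuous.continuousAt.eventually_const_lt (half_lt_self hx)
  obtain ⟨ρ, hρ, hball⟩ := Metric.eventually_nhds_iff_ball.1 (hg.and h1)
  have hev : ∀ᶠ n : ℕ in Filter.atTop, 1 / ((n : ℝ) + 1) < min ρ (l x / 2) :=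
    tendsto_one_div_add_atTop_nhds_zero_nat.eventually (gt_mem_nhds (lt_min hρ (half_pos hx)))
  filter_upwards [hev] with n hn
  have hn1 := hn.trans_le (min_le_left _ _)
  have hn2 := hn.trans_le (min_le_right _ _)
  set s' : ℂ := s - ((1 / ((n : ℝ) + 1) : ℝ) : ℂ) with hs'
  have he : approx l L n =ᶠ[nhds x] fun y => dot g (toC y) + s' := by
    refine mollify_eventuallyEq (continuous_dot_toC g s') (dot_toC_symm g s') (fun y hy => ?_)
      (approxRadius_pos L n) ((approxRadius_le L n).trans_lt hn1)
    obtain ⟨h2, h3⟩ := hball y hy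
    rw [max_eq_left (by linarith), Complex.ofReal_sub, h2, hs']
    ring
  refine ⟨?_, by rw [grad_congr he, grad_dot_toC]⟩
  rw [he.eq_of_nhds, (hball x (Metric.mem_ball_self hρ)).1, hs']
  ring

end Approx

/-- The Whitney field `l₁ ∇ l₂ - l₂ ∇ l₁` of two piecewise affine functions, restricted to the set
where both are positive, belongs to `H₀(curl)` if this set is contained in the domain. -/
theorem whitney_mem_H0curl {Ω : Set R3} (hopen : IsOpen Ω) (hbdd : Bornology.IsBounded Ω)
    {l₁ l₂ : R3 → ℝ} {L : ℝ≥0} (h₁ : LipschitzWith L l₁) (h₂ : LipschitzWith L l₂)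
    (hpos : ∀ x, 0 < l₁ x → 0 < l₂ x → x ∈ Ω) {p : CurlPair Ω}
    (hp : ∀ᵐ x ∂volume.restrict Ω,
      ((l₁ x < 0 ∨ l₂ x < 0) ∧ p.fst x = 0 ∧ p.snd x = 0) ∨
      (0 < l₁ x ∧ 0 < l₂ x ∧ ∃ g₁ g₂ s₁ s₂, (∀ᶠ y in nhds x, (l₁ y : ℂ) = dot g₁ (toC y) + s₁) ∧
        (∀ᶠ y in nhds x, (l₂ y : ℂ) = dot g₂ (toC y) + s₂) ∧
        p.fst x = (l₁ x : ℂ) • g₂ - (l₂ x : ℂ) • g₁ ∧ p.snd x = (2 : ℂ) • cross g₁ g₂)) :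
    p ∈ H0curl Ω := by
  have hfin : IsFiniteMeasure (volume.restrict Ω) :=
    ⟨by rw [Measure.restrict_apply_univ]; exact hbdd.measure_lt_top⟩
  have hlev : ∀ n : ℕ, 0 < 1 / ((n : ℝ) + 1) / 2 := fun n => by positivity
  let φ : ℕ → R3 → C3 := fun n x =>
    approx l₁ L n x • grad (approx l₂ L n) x - approx l₂ L n x • grad (approx l₁ L n) x
  have hcurl : ∀ (n : ℕ) (x : R3), curl (φ n) x
      = (2 : ℂ) • cross (grad (approx l₁ L n) x) (grad (approx l₂ L n) x) := fun n x =>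
    curl_whitney (contDiff_approx h₁ n) (contDiff_approx h₂ n) x
  have hzero : ∀ (n : ℕ) (x : R3), (l₁ x < 1 / ((n : ℝ) + 1) / 2 ∨ l₂ x < 1 / ((n : ℝ) + 1) / 2) →
      φ n x = 0 ∧ curl (φ n) x = 0 := by
    have hc0 : ∀ a : C3, cross 0 a = 0 ∧ cross a 0 = 0 := fun a => by
      constructor <;> ext i <;> fin_cases i <;> simp [cross]
    rintro n x (hx | hx)
    · rw [hcurl, grad_approx_eq_zero h₁ hx, (hc0 _).1, smul_zero]
      simp only [φ]
      rw [grad_approx_eq_zero h₁ hx, approx_eq_zero h₁ hx, zero_smul, smul_zero, sub_zero]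
      exact ⟨rfl, trivial⟩
    · rw [hcurl, grad_approx_eq_zero h₂ hx, (hc0 _).2, smul_zero]
      simp only [φ]
      rw [grad_approx_eq_zero h₂ hx, approx_eq_zero h₂ hx, zero_smul, smul_zero, sub_zero]
      exact ⟨rfl, trivial⟩
  have htest : ∀ n, IsTest Ω (φ n) := by
    intro n
    let K : Set R3 := {x | 1 / ((n : ℝ) + 1) / 2 ≤ l₁ x} ∩ {x | 1 / ((n : ℝ) + 1) / 2 ≤ l₂ x}
    have hK : IsClosed K := (isClosed_le continuous_const h₁.continuous).inter
      (isClosed_le continuous_const h₂.continuous)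
    have hKΩ : K ⊆ Ω := fun x hx => hpos x ((hlev n).trans_le hx.1) ((hlev n).trans_le hx.2)
    have hsub : Function.support (φ n) ⊆ K := fun x hx => by
      by_contra hn
      refine hx (hzero n x ?_).1
      by_contra hn'
      rw [not_or, not_lt, not_lt] at hn'
      exact hn hn'
    refine ⟨?_, HasCompactSupport.of_support_subset_isCompact
      (Metric.isCompact_of_isClosed_isBounded hK (hbdd.subset hKΩ)) hsub,
      (closure_minimal hsub hK).trans hKΩ⟩
    have ha := contDiff_approx h₁ n
    have hb := contDiff_approx h₂ n
    exact (ha.smul (contDiff_grad hb)).sub (hb.smul (contDiff_grad ha))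
  -- uniform bounds, by compactness of the set of possible values
  obtain ⟨M₁, hM₁⟩ := hbdd.isCompact_closure.exists_bound_of_continuousOn h₁.continuous.continuousOn
  obtain ⟨M₂, hM₂⟩ := hbdd.isCompact_closure.exists_bound_of_continuousOn h₂.continuous.continuousOn
  let B : Set ((ℂ × ℂ) × (C3 × C3)) :=
    (Metric.closedBall 0 (M₁ + 1) ×ˢ Metric.closedBall 0 (M₂ + 1)) ×ˢ
      (Metric.closedBall 0 (3 * L) ×ˢ Metric.closedBall 0 (3 * L))
  have hB : IsCompact B := ((isCompact_closedBall _ _).prod (isCompact_closedBall _ _)).prod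
    ((isCompact_closedBall _ _).prod (isCompact_closedBall _ _))
  obtain ⟨M, hM⟩ := hB.exists_bound_of_continuousOn
    (f := fun z => z.1.1 • z.2.2 - z.1.2 • z.2.1) (by fun_prop)
  obtain ⟨M', hM'⟩ := hB.exists_bound_of_continuousOn
    (f := fun z => (2 : ℂ) • cross z.2.1 z.2.2) (by unfold cross; fun_prop)
  have hmem : ∀ n, ∀ x ∈ Ω, ((approx l₁ L n x, approx l₂ L n x),
      (grad (approx l₁ L n) x, grad (approx l₂ L n) x)) ∈ B := fun n x hx => by
    have hx' := subset_closure hx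
    refine ⟨⟨mem_closedBall_zero_iff.2 ?_, mem_closedBall_zero_iff.2 ?_⟩,
      mem_closedBall_zero_iff.2 (norm_grad_approx_le h₁ n x),
      mem_closedBall_zero_iff.2 (norm_grad_approx_le h₂ n x)⟩
    · exact (norm_approx_le h₁ n x).trans (add_le_add_left (hM₁ x hx') 1)
    · exact (norm_approx_le h₂ n x).trans (add_le_add_left (hM₂ x hx') 1)
  refine mem_H0curl_of_tendsto hopen.measurableSet htest (M := max M M')
    (fun n x hx => (hM _ (hmem n x hx)).trans (le_max_left _ _))
    (fun n x hx => by
      rw [hcurl]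
      exact (hM' _ (hmem n x hx)).trans (le_max_right _ _)) ?_
  filter_upwards [hp] with x hx
  rcases hx with ⟨hneg, hf, hs⟩ | ⟨hp₁, hp₂, g₁, g₂, s₁, s₂, hg₁, hg₂, hf, hs⟩
  · have h0 := fun n => hzero n x (hneg.imp (fun h => h.trans (hlev n)) fun h => h.trans (hlev n))
    simp only [hf, hs, fun n => (h0 n).1, fun n => (h0 n).2]
    exact ⟨tendsto_const_nhds, tendsto_const_nhds⟩
  · have h3 := (eventually_approx_eq h₁ hp₁ hg₁).and (eventually_approx_eq h₂ hp₂ hg₂)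
    have hδ : Filter.Tendsto (fun n : ℕ => ((1 / ((n : ℝ) + 1) : ℝ) : ℂ)) Filter.atTop (nhds 0) := by
      have := (Complex.continuous_ofReal.tendsto 0).comp
        (tendsto_one_div_add_atTop_nhds_zero_nat (𝕜 := ℝ))
      simpa only [Complex.ofReal_zero, Function.comp_def] using this
    constructor
    · have h4 := ((tendsto_const_nhds (x := (l₁ x : ℂ))).sub hδ).smul
        (tendsto_const_nhds (x := g₂))
      have h5 := ((tendsto_const_nhds (x := (l₂ x : ℂ))).sub hδ).smul
        (tendsto_const_nhds (x := g₁))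
      have h6 := h4.sub h5
      rw [sub_zero, sub_zero, ← hf] at h6
      refine h6.congr' ?_
      filter_upwards [h3] with n hn
      simp only [φ]
      rw [hn.1.1, hn.1.2, hn.2.1, hn.2.2]
    · refine tendsto_const_nhds.congr' ?_
      filter_upwards [h3] with n hn
      rw [hcurl, hn.1.2, hn.2.2, hs]

/-! ### Barycentric coordinates around an interior edge -/

theorem exists_dot_eq (ℓ : R3 →ᵃ[ℝ] ℝ) :
    ∃ (g : C3) (s : ℂ), ∀ x, (ℓ x : ℂ) = dot g (toC x) + s := by
  refine ⟨toC (WithLp.toLp 2 fun i => ℓ.linear (EuclideanSpace.single i 1)), (ℓ 0 : ℂ), fun x => ?_⟩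
  have h1 : ℓ x = ℓ.linear x + ℓ 0 := by
    have := ℓ.map_vadd 0 x
    simpa using this
  have h2 : ℓ.linear x = ∑ i, x i * ℓ.linear (EuclideanSpace.single i 1) := by
    conv_lhs => rw [← (EuclideanSpace.basisFun (Fin 3) ℝ).sum_repr x]
    rw [map_sum]
    simp
  rw [h1, h2]
  simp only [dot, toC]
  push_cast
  congr 1
  exact Finset.sum_congr rfl fun i _ => mul_comm _ _

theorem exists_lipschitzWith_affine (ℓ : R3 →ᵃ[ℝ] ℝ) : ∃ L : ℝ≥0, LipschitzWith L ℓ := by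
  obtain ⟨g, s, hgs⟩ := exists_dot_eq ℓ
  refine ⟨3 * ‖g‖₊, LipschitzWith.of_dist_le_mul fun x y => ?_⟩
  rw [Real.dist_eq, ← Real.norm_eq_abs, ← Complex.norm_real, Complex.ofReal_sub, hgs, hgs,
    add_sub_add_right_eq_sub, ← dot_sub_right, ← toC_sub, dist_eq_norm]
  refine (norm_dot_le _ _).trans ?_
  rw [norm_toC, ← mul_assoc]
  push_cast
  rfl

section EdgeHat

variable {Ω : Set R3} {𝒯 : TetMesh Ω} (o : EdgeOrientation 𝒯) {E : Finset R3}

/-- The tetrahedra around an interior edge are the parts of wedges that cover the space; hence the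
barycentric coordinates at the two endpoints extend from the tetrahedra to piecewise affine
functions on the whole space. -/
theorem exists_edgeHat (o : EdgeOrientation 𝒯) (hopen : IsOpen Ω) (hE : E ∈ interiorEdges 𝒯) :
    ∃ (l : R3 → R3 → ℝ) (L : ℝ≥0), (∀ y ∈ E, LipschitzWith L (l y)) ∧
      (∀ T ∈ 𝒯.cells, E ⊆ T → ∀ y ∈ E, ∀ x ∈ convexHull ℝ (T : Set R3), l y x = bary T y x) ∧
      ∀ x, (∀ y ∈ E, 0 ≤ l y x) → ∃ T ∈ 𝒯.cells, E ⊆ T ∧ x ∈ convexHull ℝ (T : Set R3) := by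
  classical
  have hE' := mem_edges_of_mem_interiorEdges hE
  obtain ⟨θ, hθ, hpΩ⟩ := exists_lineMap_mem hopen o hE
  set p : R3 := AffineMap.lineMap (o.tail E) (o.head E) θ with hp
  let C : Finset (Finset R3) := 𝒯.cells.filter fun T => E ⊆ T
  have hC : ∀ {T}, T ∈ C ↔ T ∈ 𝒯.cells ∧ E ⊆ T := Finset.mem_filter
  let W : Finset R3 → Set R3 := fun T => {x | ∀ u ∈ T, u ∉ E → 0 ≤ bary T u x}
  -- the barycentric coordinates of `p`
  have hp0 : ∀ T ∈ C, ∀ u, u ∉ E → bary T u p = 0 := fun T hT u hu => by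
    obtain ⟨hT, hET⟩ := hC.1 hT
    refine ((𝒯.isTet hT).bary_lineMap (hET (o.tail_mem hE')) (hET (o.head_mem hE'))
      (o.tail_ne_head hE') θ).2.2 u ?_ ?_
    · rintro rfl; exact hu (o.tail_mem hE')
    · rintro rfl; exact hu (o.head_mem hE')
  have hp1 : ∀ y ∈ E, ∃ r : ℝ, 0 < r ∧ ∀ T ∈ C, bary T y p = r := fun y hy => by
    rw [o.eq_pair hE', Finset.mem_insert, Finset.mem_singleton] at hy
    have hb := fun T (hT : T ∈ C) => (𝒯.isTet (hC.1 hT).1).bary_lineMap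
      ((hC.1 hT).2 (o.tail_mem hE')) ((hC.1 hT).2 (o.head_mem hE')) (o.tail_ne_head hE') θ
    rcases hy with rfl | rfl
    · exact ⟨1 - θ, sub_pos.2 hθ.2, fun T hT => (hb T hT).1⟩
    · exact ⟨θ, hθ.1, fun T hT => (hb T hT).2.1⟩
  have hray : ∀ T u x (s : ℝ), bary T u (AffineMap.lineMap p x s)
      = (1 - s) * bary T u p + s * bary T u x := fun T u x s => by
    rw [AffineMap.apply_lineMap, AffineMap.lineMap_apply_module, smul_eq_mul, smul_eq_mul]
  have hcont : ∀ x, Filter.Tendsto (fun s : ℝ => (AffineMap.lineMap p x s : R3))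
      (nhdsWithin 0 (Set.Ioi 0)) (nhds p) := fun x => by
    have h := (AffineMap.lineMap_continuous (R := ℝ) (p := p) (q := x)).tendsto 0
    rw [AffineMap.lineMap_apply_zero] at h
    exact h.mono_left nhdsWithin_le_nhds
  -- the ray from `p` towards `x` starts in a tetrahedron around the edge, and stays in its wedge
  have hcov : ∀ x, ∃ T ∈ C, x ∈ W T := fun x => by
    have h1 := (hcont x).eventually ((hopen.eventually_mem hpΩ).and
      (eventually_mem_tet 𝒯.cells p))
    obtain ⟨s, ⟨hsΩ, hs⟩, hs0⟩ := (h1.and self_mem_nhdsWithin).exists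
    obtain ⟨T, hT, hsT⟩ := exists_tet_mem (𝒯 := 𝒯) (subset_closure hsΩ)
    have hTC : T ∈ C := hC.2 ⟨hT, subset_of_lineMap_mem o hE' hθ hT (hs T hT hsT)⟩
    refine ⟨T, hTC, fun u hu huE => ?_⟩
    have h2 := (𝒯.isTet hT).mem_convexHull_iff.1 hsT u hu
    rw [hray, hp0 T hTC u huE, mul_zero, zero_add] at h2
    exact nonneg_of_mul_nonneg_right h2 hs0
  have hmem : ∀ T ∈ C, ∀ x ∈ W T, ∀ᶠ s : ℝ in nhdsWithin 0 (Set.Ioi 0),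
      AffineMap.lineMap p x s ∈ convexHull ℝ (T : Set R3) := fun T hT x hx => by
    have h1 : ∀ᶠ s : ℝ in nhdsWithin 0 (Set.Ioi 0), ∀ u ∈ T,
        0 ≤ bary T u (AffineMap.lineMap p x s) := by
      rw [Filter.eventually_all_finset]
      intro u hu
      by_cases huE : u ∈ E
      · obtain ⟨r, hr, hrT⟩ := hp1 u huE
        have h2 := (((continuous_bary T u).tendsto p).comp (hcont x))
        rw [hrT T hT] at h2
        filter_upwards [h2.eventually (lt_mem_nhds hr)] with s hs using hs.le
      · filter_upwards [self_mem_nhdsWithin] with s hs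
        rw [hray, hp0 T hT u huE, mul_zero, zero_add]
        exact mul_nonneg (le_of_lt hs) (hx u hu huE)
    filter_upwards [h1] with s hs
    exact (𝒯.isTet (hC.1 hT).1).mem_convexHull_iff.2 hs
  -- at points of two wedges the coordinates agree, because they do so near `p` on the ray
  have hcons : ∀ y ∈ E, ∀ x, ∀ T ∈ C, ∀ T' ∈ C, x ∈ W T → x ∈ W T' →
      bary T y x = bary T' y x := fun y hy x T hT T' hT' hx hx' => by
    obtain ⟨s, ⟨hs, hs'⟩, hs0⟩ := (((hmem T hT x hx).and (hmem T' hT' x hx')).and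
      self_mem_nhdsWithin).exists
    obtain ⟨r, -, hr⟩ := hp1 y hy
    have hm : AffineMap.lineMap p x s ∈ convexHull ℝ ((T : Set R3) ∩ T') := by
      rw [← 𝒯.inter T (hC.1 hT).1 T' (hC.1 hT').1]
      exact ⟨hs, hs'⟩
    have h1 := bary_eq_bary (𝒯.isTet (hC.1 hT).1) (𝒯.isTet (hC.1 hT').1) hm ((hC.1 hT).2 hy)
      ((hC.1 hT').2 hy)
    rw [hray, hray, hr T hT, hr T' hT', add_right_inj] at h1
    exact mul_left_cancel₀ (ne_of_gt hs0) h1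
  choose c hcC hcW using hcov
  choose K hK using fun T y => exists_lipschitzWith_affine (bary T y)
  have hl : ∀ y ∈ E, ∀ T ∈ C, ∀ x ∈ W T, bary (c x) y x = bary T y x := fun y hy T hT x hx =>
    hcons y hy x _ (hcC x) T hT (hcW x) hx
  have hWT : ∀ {T x}, T ∈ C → x ∈ convexHull ℝ (T : Set R3) → x ∈ W T := fun hT hx u hu _ =>
    (𝒯.isTet (hC.1 hT).1).mem_convexHull_iff.1 hx u hu
  have hWc : ∀ T ∈ C, IsClosed (W T) := fun T _ => by
    simp only [W, Set.ofPred_forall]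
    exact isClosed_iInter fun u => isClosed_iInter fun _ => isClosed_iInter fun _ =>
      isClosed_le continuous_const (continuous_bary T u)
  refine ⟨fun y x => bary (c x) y x, ∑ T ∈ C, ∑ y ∈ E, K T y, fun y hy => ?_,
    fun T hT hET y hy x hx => hl y hy T (hC.2 ⟨hT, hET⟩) x (hWT (hC.2 ⟨hT, hET⟩) hx), fun x hx => ?_⟩
  · rw [← lipschitzOnWith_univ]
    refine lipschitzOnWith_of_cover convex_univ ?_ C W (fun x _ => ⟨c x, hcC x, hcW x⟩)
      fun T hT => ?_
    · exact continuousOn_of_closed_cover C hWc (fun x _ => ⟨c x, hcC x, hcW x⟩)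
        (ℓ := fun T => bary T y) (fun T _ => continuous_bary T y) fun x _ T hT hx => hl y hy T hT x hx
    · have hle : K T y ≤ ∑ T ∈ C, ∑ y ∈ E, K T y :=
        (Finset.single_le_sum (f := fun y => K T y) (fun _ _ => zero_le) hy).trans
          (Finset.single_le_sum (f := fun T => ∑ y ∈ E, K T y) (fun _ _ => zero_le) hT)
      refine LipschitzOnWith.of_dist_le_mul fun z hz z' hz' => ?_
      change dist (bary (c z) y z) (bary (c z') y z') ≤ _
      rw [hl y hy T hT z hz.1, hl y hy T hT z' hz'.1]
      exact ((hK T y).weaken hle).dist_le_mul z z'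
  · refine ⟨c x, (hC.1 (hcC x)).1, (hC.1 (hcC x)).2,
      (𝒯.isTet (hC.1 (hcC x)).1).mem_convexHull_iff.2 fun u hu => ?_⟩
    by_cases huE : u ∈ E
    · exact hx u huE
    · exact hcW x u hu huE

/-! ### The edge basis -/

theorem nedField_whitney (g₁ g₂ : C3) (s₁ s₂ : ℂ) (x : R3) :
    nedField (cross g₁ g₂) (s₁ • g₂ - s₂ • g₁) x
      = (dot g₁ (toC x) + s₁) • g₂ - (dot g₂ (toC x) + s₂) • g₁ := by
  ext i
  fin_cases i <;> simp [nedField, cross, dot, Fin.sum_univ_three] <;> ring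

/-- The tangential component of a Whitney field along a segment is constant. -/
theorem dot_whitney_sub (g₁ g₂ : C3) (s₁ s₂ : ℂ) (x y : R3) :
    dot (nedField (cross g₁ g₂) (s₁ • g₂ - s₂ • g₁) x) (toC (y - x))
      = (dot g₁ (toC x) + s₁) * (dot g₂ (toC y) + s₂)
        - (dot g₂ (toC x) + s₂) * (dot g₁ (toC y) + s₁) := by
  rw [nedField_whitney, toC_sub, dot_sub_right, dot_sub_left, dot_sub_left, dot_smul_left,
    dot_smul_left, dot_smul_left, dot_smul_left]
  ring

theorem eq_of_subset_of_mem_edges (hE : E ∈ edges 𝒯) {E' : Finset R3} (hE' : E' ∈ edges 𝒯)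
    (h : E' ⊆ E) : E' = E := by
  obtain ⟨T, -, -, hc⟩ := mem_edges.1 hE
  obtain ⟨T', -, -, hc'⟩ := mem_edges.1 hE'
  exact Finset.eq_of_subset_of_card_le h (by rw [hc, hc'])

/-- The barycentric coordinates at the endpoints of one edge, evaluated at those of another. -/
theorem bary_det {T : Finset R3} (hT : T ∈ 𝒯.cells) (hE : E ∈ edges 𝒯) {E' : Finset R3}
    (hE' : E' ∈ edges 𝒯) (hET' : E' ⊆ T) :
    bary T (o.tail E) (o.tail E') * bary T (o.head E) (o.head E')
      - bary T (o.head E) (o.tail E') * bary T (o.tail E) (o.head E')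
      = if E' = E then 1 else 0 := by
  have h := 𝒯.isTet hT
  have ht := hET' (o.tail_mem hE')
  have hh := hET' (o.head_mem hE')
  split_ifs with e
  · subst e
    rw [h.bary_self ht, h.bary_self hh, h.bary_ne ht (o.tail_ne_head hE).symm]
    ring
  · have key : ∀ {y z : R3}, y ∈ E → z ∈ E → y ≠ z →
        bary T y (o.tail E') * bary T z (o.head E') = 0 := by
      intro y z hy hz hyz
      by_contra hn
      obtain ⟨h1, h2⟩ := mul_ne_zero_iff.1 hn
      have e1 : y = o.tail E' := by
        by_contra hne
        exact h1 (h.bary_ne ht hne)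
      have e2 : z = o.head E' := by
        by_contra hne
        exact h2 (h.bary_ne hh hne)
      refine e (eq_of_subset_of_mem_edges hE hE' fun x hx => ?_)
      rw [o.eq_pair hE', Finset.mem_insert, Finset.mem_singleton, ← e1, ← e2] at hx
      rcases hx with rfl | rfl
      · exact hy
      · exact hz
    rw [key (o.tail_mem hE) (o.head_mem hE) (o.tail_ne_head hE),
      key (o.head_mem hE) (o.tail_mem hE) (o.tail_ne_head hE).symm, sub_zero]

/-- A multiple of the Whitney field of an interior edge has mean one over that edge and mean zero over
the others. -/
theorem exists_edgeBasis (hopen : IsOpen Ω) (hbdd : Bornology.IsBounded Ω)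
    (hint : interior (closure Ω) ⊆ Ω) (hE : E ∈ interiorEdges 𝒯) :
    ∃ p : CurlPair Ω, p ∈ nedelec 𝒯.cells (H0curl Ω) ∧ ∀ E' ∈ interiorEdges 𝒯,
      HasEdgeMean o E' Ω p.fst (if E' = E then 1 else 0) := by
  classical
  have hE₀ := mem_edges_of_mem_interiorEdges hE
  have h := isPatch_domain 𝒯 hopen hint
  obtain ⟨l, L, hlip, hlT, hlK⟩ := exists_edgeHat o hopen hE
  have ht := o.tail_mem hE₀
  have hh := o.head_mem hE₀
  choose g s hgs using fun T y => exists_dot_eq (bary T y)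
  let a : Finset R3 → C3 := fun T => if E ⊆ T then cross (g T (o.tail E)) (g T (o.head E)) else 0
  let b : Finset R3 → C3 := fun T => if E ⊆ T then
    s T (o.tail E) • g T (o.head E) - s T (o.head E) • g T (o.tail E) else 0
  obtain ⟨v, hv⟩ := h.exists_piecewise (f := fun T => nedField (a T) (b T)) fun T =>
    continuous_nedField _ _
  obtain ⟨w, hw⟩ := h.exists_piecewise (f := fun T _ => (2 : ℂ) • a T) fun T => continuous_const
  have hpos : ∀ x, 0 < l (o.tail E) x → 0 < l (o.head E) x → x ∈ Ω := by
    intro x hx₁ hx₂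
    refine hint (mem_interior_iff_mem_nhds.2 ?_)
    filter_upwards [(hlip _ ht).continuous.continuousAt.eventually_const_lt hx₁,
      (hlip _ hh).continuous.continuousAt.eventually_const_lt hx₂] with y hy₁ hy₂
    obtain ⟨T, hT, -, hyT⟩ := hlK y fun z hz => by
      rw [o.eq_pair hE₀, Finset.mem_insert, Finset.mem_singleton] at hz
      rcases hz with rfl | rfl
      · exact hy₁.le
      · exact hy₂.le
    exact tet_subset_closure hT hyT
  have hvw : (WithLp.toLp 2 (v, w) : CurlPair Ω) ∈ H0curl Ω := by
    refine whitney_mem_H0curl hopen hbdd (hlip _ ht) (hlip _ hh) hpos ?_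
    filter_upwards [hv, hw, h.ae_restrict_mem_interior] with x hvx hwx ⟨T, hT, hxT⟩
    change _ ∧ v x = 0 ∧ w x = 0 ∨ _ ∧ _ ∧ ∃ g₁ g₂ s₁ s₂, _ ∧ _ ∧ v x = _ ∧ w x = _
    rw [hvx T hT hxT, hwx T hT hxT]
    by_cases hET : E ⊆ T
    · right
      have haff : ∀ y ∈ E, ∀ z ∈ interior (convexHull ℝ (T : Set R3)),
          (l y z : ℂ) = dot (g T y) (toC z) + s T y := fun y hy z hz => by
        rw [hlT T hT hET y hy z (interior_subset hz), hgs]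
      have hpx : ∀ y ∈ E, 0 < l y x := fun y hy => by
        rw [hlT T hT hET y hy x (interior_subset hxT)]
        exact (𝒯.isTet hT).mem_interior_iff.1 hxT y (hET hy)
      refine ⟨hpx _ ht, hpx _ hh, g T (o.tail E), g T (o.head E), s T (o.tail E), s T (o.head E),
        ?_, ?_, ?_, ?_⟩
      · filter_upwards [isOpen_interior.mem_nhds hxT] with z hz using haff _ ht z hz
      · filter_upwards [isOpen_interior.mem_nhds hxT] with z hz using haff _ hh z hz
      · simp only [a, b, if_pos hET]
        rw [nedField_whitney, haff _ ht x hxT, haff _ hh x hxT]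
      · simp only [a, if_pos hET]
    · left
      refine ⟨?_, ?_, ?_⟩
      · by_contra hn
        rw [not_or, not_lt, not_lt] at hn
        obtain ⟨T', hT', hET', hxT'⟩ := hlK x fun z hz => by
          rw [o.eq_pair hE₀, Finset.mem_insert, Finset.mem_singleton] at hz
          rcases hz with rfl | rfl
          · exact hn.1
          · exact hn.2
        rw [eq_of_mem_interior hT hT' hxT hxT'] at hET
        exact hET hET'
      · simp only [a, b, if_neg hET]
        rw [nedField_zero_left]
      · simp only [a, if_neg hET, smul_zero]
  have hned : ∀ T ∈ 𝒯.cells, IsNedOn Ω T v (a T) (b T) := fun T hT =>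
    IsPatch.isNedOn_of_ae (by filter_upwards [hv] with x hx using hx T hT)
  refine ⟨(edgeLength o E : ℂ) • WithLp.toLp 2 (v, w), Submodule.smul_mem _ _
    ⟨hvw, fun T hT => ⟨a T, b T, hned T hT⟩⟩, fun E' hE' T hT hET' => ?_⟩
  have hE'₀ := mem_edges_of_mem_interiorEdges hE'
  have hL := edgeLength_pos o hE₀
  have hL' := edgeLength_pos o hE'₀
  refine ⟨_, _, (hned T hT).smul (edgeLength o E : ℂ), ?_⟩
  rw [integral_dot_nedField_lineMap o hE'₀ _ _ 0, AffineMap.lineMap_apply_zero, nedField_smul,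
    dot_smul_left, tangent, toC_smul, dot_smul_right]
  by_cases hET : E ⊆ T
  · simp only [a, b, if_pos hET]
    rw [dot_whitney_sub, ← hgs, ← hgs, ← hgs, ← hgs]
    have := bary_det o hT hE₀ hE'₀ hET'
    split_ifs at this ⊢ with e
    · subst e
      have e2 : (edgeLength o E' : ℂ) ≠ 0 := by exact_mod_cast hL.ne'
      have h3 := congrArg Complex.ofReal this
      push_cast at h3
      rw [h3]
      push_cast
      field_simp
    · have h3 := congrArg Complex.ofReal this
      push_cast at h3
      rw [h3, mul_zero, mul_zero]
  · have e : E' ≠ E := by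
      rintro rfl
      exact hET hET'
    simp only [a, b, if_neg hET, if_neg e]
    rw [nedField_zero_left, dot_zero_left, mul_zero, mul_zero]

end EdgeHat

/-! ### Unisolvence of the edge means -/

theorem IsTet.eq_zero_of_dot_sub_eq_zero {T : Finset R3} (h : IsTet T) {N : C3} {x : R3}
    (hN : ∀ y ∈ T, dot N (toC (y - x)) = 0) : N = 0 := by
  have key : ∀ d : R3, dot N (toC d) = 0 := fun d => by
    have hd : d = ∑ y ∈ T, bary T y (x + d) • (y - x) := by
      simp only [smul_sub]
      rw [Finset.sum_sub_distrib, h.sum_bary_smul, ← Finset.sum_smul, h.sum_bary, one_smul,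
        add_sub_cancel_left]
    have hs : ∀ (S : Finset R3) (r : R3 → ℝ), toC (∑ y ∈ S, r y • (y - x))
        = ∑ y ∈ S, (r y : ℂ) • toC (y - x) := fun S r => by
      classical
      induction S using Finset.induction_on with
      | empty => simp
      | insert z S hz ih => rw [Finset.sum_insert hz, Finset.sum_insert hz, toC_add, toC_smul, ih]
    have hdot : ∀ (S : Finset R3) (f : R3 → C3), dot N (∑ y ∈ S, f y) = ∑ y ∈ S, dot N (f y) :=
        fun S f => by
      classical
      induction S using Finset.induction_on with
      | empty => simp
      | insert z S hz ih => rw [Finset.sum_insert hz, Finset.sum_insert hz, dot_add_right, ih]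
    rw [hd, hs, hdot]
    refine Finset.sum_eq_zero fun y hy => ?_
    rw [dot_smul_right, hN y hy, mul_zero]
  ext i
  have := key (EuclideanSpace.single i 1)
  fin_cases i <;> simpa [dot, toC, Fin.sum_univ_three] using this

theorem dot_nedField_sub_eq (a b : C3) (x y : R3) :
    dot (nedField a b x) (toC (y - x)) = dot (nedField a b y) (toC (y - x)) := by
  have := dot_nedField_add_smul a b x (y - x) 1
  rw [one_smul, add_sub_cancel] at this
  exact this.symm

/-- A Nédélec field is determined by its tangential components along the edges of a tetrahedron. -/
theorem IsTet.eq_zero_of_dot_edge {T : Finset R3} (h : IsTet T) {a b : C3}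
    (hab : ∀ x ∈ T, ∀ y ∈ T, x ≠ y → dot (nedField a b x) (toC (y - x)) = 0) : a = 0 ∧ b = 0 := by
  have h1 : ∀ x ∈ T, nedField a b x = 0 := fun x hx =>
    h.eq_zero_of_dot_sub_eq_zero (x := x) fun y hy => by
      by_cases e : x = y
      · rw [e, sub_self, toC_zero, dot_zero_right]
      · exact hab x hx y hy e
  refine nedField_eq_zero isOpen_univ Set.univ_nonempty fun x _ =>
    h.eq_zero_of_dot_sub_eq_zero (x := x) fun y hy => ?_
  rw [dot_nedField_sub_eq, h1 y hy, dot_zero_left]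

section Unisolvence

variable {Ω : Set R3} {𝒯 : TetMesh Ω} (o : EdgeOrientation 𝒯) {E : Finset R3}

/-- Near an inner point of an edge, the tetrahedra that contain the edge are invariant under small
shifts along it. -/
theorem eventually_add_smul_mem (hE : E ∈ edges 𝒯) {θ : ℝ} (hθ : θ ∈ Set.Ioo (0 : ℝ) 1) :
    ∀ᶠ z : R3 × ℝ in nhds (AffineMap.lineMap (o.tail E) (o.head E) θ, 0),
      ∀ T ∈ 𝒯.cells, E ⊆ T → z.1 ∈ convexHull ℝ (T : Set R3) →
        z.1 + z.2 • (o.head E - o.tail E) ∈ convexHull ℝ (T : Set R3) := by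
  rw [Filter.eventually_all_finset]
  intro T hT
  by_cases hET : E ⊆ T
  swap
  · exact Filter.Eventually.of_forall fun _ h => absurd h hET
  have h := 𝒯.isTet hT
  have ht := hET (o.tail_mem hE)
  have hh := hET (o.head_mem hE)
  obtain ⟨hb1, hb2, -⟩ := h.bary_lineMap ht hh (o.tail_ne_head hE) θ
  have hc : ∀ u, Continuous fun z : R3 × ℝ => bary T u (z.1 + z.2 • (o.head E - o.tail E)) :=
    fun u => (continuous_bary T u).comp (by fun_prop)
  have hpos : ∀ u, 0 < bary T u (AffineMap.lineMap (o.tail E) (o.head E) θ) →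
      ∀ᶠ z : R3 × ℝ in nhds (AffineMap.lineMap (o.tail E) (o.head E) θ, 0),
        0 < bary T u (z.1 + z.2 • (o.head E - o.tail E)) := fun u hu => by
    refine (hc u).continuousAt.eventually_const_lt ?_
    simpa using hu
  filter_upwards [hpos _ (by rw [hb1]; exact sub_pos.2 hθ.2), hpos _ (by rw [hb2]; exact hθ.1)]
    with z hz1 hz2 _ hzT
  refine h.mem_convexHull_iff.2 fun u hu => ?_
  by_cases e1 : u = o.tail E
  · rw [e1]; exact hz1.le
  by_cases e2 : u = o.head E
  · rw [e2]; exact hz2.le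
  have e : bary T u (z.1 + z.2 • (o.head E - o.tail E)) = bary T u z.1 := by
    have h1 := (bary T u).map_vadd z.1 (z.2 • (o.head E - o.tail E))
    have h2 := (bary T u).linearMap_vsub (o.head E) (o.tail E)
    rw [vsub_eq_sub, vsub_eq_sub, h.bary_ne hh e2, h.bary_ne ht e1, sub_zero] at h2
    rw [map_smul, h2, smul_zero, vadd_eq_add, vadd_eq_add, zero_add, add_comm] at h1
    exact h1
  rw [e]
  exact h.mem_convexHull_iff.1 hzT u hu

/-- On a boundary edge the tangential component of a field of the coarse space vanishes: the
extension by zero has a weak curl, and inner points of the edge are limits of segments parallel to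
the edge in the exterior of the domain. -/
theorem dot_tangent_eq_zero_of_boundary (hopen : IsOpen Ω) (hint : interior (closure Ω) ⊆ Ω)
    (hE : E ∈ edges 𝒯) (hEb : E ∉ interiorEdges 𝒯) {v : CurlPair Ω}
    (hv : v ∈ nedelec 𝒯.cells (H0curl Ω)) {T : Finset R3} (hT : T ∈ 𝒯.cells) (hET : E ⊆ T)
    {a b : C3} (hab : IsNedOn Ω T v.fst a b) :
    dot (nedField a b (o.tail E)) (toC (o.head E - o.tail E)) = 0 := by
  have h := isPatch_domain 𝒯 hopen hint
  have hfin := h.isFiniteMeasure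
  have hGm := hopen.measurableSet
  have hfr : convexHull ℝ (E : Set R3) ⊆ frontier Ω := by
    by_contra hn
    exact hEb (mem_interiorEdges.2 ⟨hE, hn⟩)
  have hθ : (1 / 2 : ℝ) ∈ Set.Ioo (0 : ℝ) 1 := by constructor <;> norm_num
  set d : R3 := o.head E - o.tail E with hd
  set p : R3 := AffineMap.lineMap (o.tail E) (o.head E) (1 / 2 : ℝ) with hp
  have hpe : p = o.tail E + (1 / 2 : ℝ) • d := by
    rw [hp, AffineMap.lineMap_apply, vsub_eq_sub, vadd_eq_add, add_comm]
  have hpfr : p ∈ frontier Ω := hfr (lineMap_mem_tet o hE (Set.Ioo_subset_Icc_self hθ) subset_rfl)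
  have hpn : p ∉ interior (closure Ω) := fun hn => by
    rw [hopen.frontier_eq] at hpfr
    exact hpfr.2 (hint hn)
  -- a ball around the midpoint in which the mesh is invariant along the edge
  obtain ⟨ρ, hρ, hball⟩ := Metric.eventually_nhds_iff_ball.1 (eventually_add_smul_mem o hE hθ)
  obtain ⟨ρ', hρ', hball'⟩ := Metric.eventually_nhds_iff_ball.1 (eventually_mem_tet 𝒯.cells p)
  set R := min ρ ρ' with hR
  have hR0 : 0 < R := lt_min hρ hρ'
  have hinv : ∀ y ∈ Metric.ball p R, ∀ c : ℝ, |c| < R → y ∈ closure Ω → y + c • d ∈ closure Ω := by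
    intro y hy c hc hyΩ
    obtain ⟨T', hT', hyT'⟩ := exists_tet_mem (𝒯 := 𝒯) hyΩ
    have hpT' := hball' y (Metric.ball_subset_ball (min_le_right _ _) hy) T' hT' hyT'
    refine tet_subset_closure hT' (hball (y, c) ?_ T' hT'
      (subset_of_lineMap_mem o hE hθ hT' hpT') hyT')
    rw [Metric.mem_ball, Prod.dist_eq, max_lt_iff, Real.dist_eq, sub_zero]
    exact ⟨(Metric.mem_ball.1 hy).trans_le (min_le_left _ _), hc.trans_le (min_le_left _ _)⟩
  -- a step `s • d` along the edge so short that the segments below stay in the ball and in `T`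
  obtain ⟨s, hs0, hs1, hsR, hsd⟩ : ∃ s : ℝ, 0 < s ∧ s ≤ 1 / 4 ∧ s < R ∧ s * ‖d‖ < R / 2 := by
    refine ⟨min (1 / 4) (R / (2 * (‖d‖ + 2))), by positivity, min_le_left _ _, ?_, ?_⟩
    · refine (min_le_right _ _).trans_lt ?_
      rw [div_lt_iff₀ (by positivity)]
      nlinarith [norm_nonneg d]
    · calc min (1 / 4) (R / (2 * (‖d‖ + 2))) * ‖d‖ ≤ R / (2 * (‖d‖ + 2)) * ‖d‖ := by
            gcongr
            exact min_le_right _ _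
        _ < R / 2 := by
            rw [div_mul_eq_mul_div, div_lt_div_iff₀ (by positivity) (by positivity)]
            nlinarith [norm_nonneg d]
  have hmove : ∀ x ∈ Metric.ball p (R / 2), ∀ r ∈ Set.Icc (0 : ℝ) 1,
      x + r • s • d ∈ Metric.ball p R := by
    intro x hx r hr
    rw [mem_ball_iff_norm] at hx ⊢
    have e : x + r • s • d - p = (x - p) + r • s • d := by abel
    have h1 : ‖r • s • d‖ ≤ s * ‖d‖ := by
      rw [norm_smul, norm_smul, Real.norm_of_nonneg hr.1, Real.norm_of_nonneg hs0.le]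
      exact mul_le_of_le_one_left (by positivity) hr.2
    rw [e]
    linarith [norm_add_le (x - p) (r • s • d)]
  obtain ⟨M, hM1, hM2⟩ := h.exists_bound ⟨H0curl_le_Hcurl Ω hv.1, hv.2⟩
  have hbd : ∀ {f : R3 → C3}, (∀ᵐ x, x ∈ Ω → ‖f x‖ ≤ M) →
      ∀ᵐ x, x ∈ Metric.ball p R → ‖Ω.indicator f x‖ ≤ |M| := fun hf => by
    filter_upwards [hf] with x hx _
    by_cases hxΩ : x ∈ Ω
    · rw [Set.indicator_of_mem hxΩ]
      exact (hx hxΩ).trans (le_abs_self M)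
    · rw [Set.indicator_of_notMem hxΩ, norm_zero]
      exact abs_nonneg M
  -- an exterior point near `p` stays exterior when moved along the edge, since the mesh is
  -- invariant under moving back
  have hext : p ∈ closure {x | ∀ r ∈ Set.Icc (0 : ℝ) 1,
      x + r • s • d ∈ (closure Ω)ᶜ ∩ Metric.ball p R} := by
    rw [mem_closure_iff_nhds]
    intro V hV
    have h1 : ¬ V ∩ Metric.ball p (R / 2) ⊆ closure Ω := fun hsub =>
      hpn (mem_interior_iff_mem_nhds.2 (Filter.mem_of_superset
        (Filter.inter_mem hV (Metric.ball_mem_nhds p (half_pos hR0))) hsub))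
    obtain ⟨x, ⟨hxV, hxb⟩, hxΩ⟩ := Set.not_subset.1 h1
    refine ⟨x, hxV, fun r hr => ⟨fun hn => hxΩ ?_, hmove x hxb r hr⟩⟩
    have := hinv _ (hmove x hxb r hr) (-(r * s)) (by
      rw [abs_neg, abs_of_nonneg (mul_nonneg hr.1 hs0.le)]
      exact (mul_le_of_le_one_left hs0.le hr.2).trans_lt hsR) hn
    have e : x + r • s • d + (-(r * s)) • d = x := by module
    rwa [e] at this
  have hpT : p ∈ convexHull ℝ (T : Set R3) :=
    lineMap_mem_tet o hE (Set.Ioo_subset_Icc_self hθ) hET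
  have hptT : p + (2 : ℝ) • s • d ∈ convexHull ℝ (T : Set R3) := by
    have e : p + (2 : ℝ) • s • d = AffineMap.lineMap (o.tail E) (o.head E) (1 / 2 + 2 * s) := by
      rw [hpe, AffineMap.lineMap_apply, vsub_eq_sub, vadd_eq_add, ← hd]
      module
    rw [e]
    exact lineMap_mem_tet o hE ⟨by linarith, by linarith⟩ hET
  have hpR : p ∈ Metric.ball p (R / 2) := Metric.mem_ball_self (half_pos hR0)
  have hpst : p + s • d ∈ Metric.ball p R := by
    have := hmove p hpR 1 ⟨zero_le_one, le_rfl⟩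
    rwa [one_smul] at this
  have key := tangential_eq (v := Ω.indicator v.fst) (w := Ω.indicator v.snd)
    (integrable_indicator_of_memLp hGm hfin (Lp.memLp _)).locallyIntegrable
    (integrable_indicator_of_memLp hGm hfin (Lp.memLp _)).locallyIntegrable
    (U := Metric.ball p R) Metric.isOpen_ball (convex_ball p R)
    (fun φ hφ => by
      rw [integral_dot_indicator hGm, integral_dot_indicator hGm]
      exact weakCurl_of_mem_H0curl hv.1 (hφ.mono (Set.subset_univ _))) (hbd hM1) (hbd hM2)
    (isClosed_closure.isOpen_compl.inter Metric.isOpen_ball)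
    (isOpen_interior.inter Metric.isOpen_ball) Set.inter_subset_right Set.inter_subset_right
    (a₀ := 0) (b₀ := 0) (a₁ := a) (b₁ := b)
    (Filter.Eventually.of_forall fun x hx => by
      rw [Set.indicator_of_notMem fun hn => hx.1 (subset_closure hn), nedField_zero_left])
    (by
      filter_upwards [h.ae_eq_of_isNedOn hT hab] with y hy hyV
      rw [Set.indicator_of_mem (h.interior_tet_subset T hT hyV.1), hy hyV.1]) (t := s • d) hext
    (mem_closure_segment_interior (convex_convexHull ℝ _) (𝒯.isTet hT).interior_nonempty
      Metric.isOpen_ball (convex_ball p R) hpT hptT (Metric.mem_ball_self hR0) hpst)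
  rw [nedField_zero_left, dot_zero_left, toC_smul, dot_smul_right] at key
  have h0 := (mul_eq_zero.1 key).resolve_left (by exact_mod_cast hs0.ne')
  rwa [hpe, dot_nedField_add_smul] at h0

/-- A field of the coarse space is determined by its means over the interior edges. -/
theorem eq_zero_of_hasEdgeMean_zero (hopen : IsOpen Ω) (hint : interior (closure Ω) ⊆ Ω)
    {v : CurlPair Ω} (hv : v ∈ nedelec 𝒯.cells (H0curl Ω))
    (hmean : ∀ E ∈ interiorEdges 𝒯, HasEdgeMean o E Ω v.fst 0) : v = 0 := by
  classical
  have h := isPatch_domain 𝒯 hopen hint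
  refine h.eq_zero_of_fst_eq_zero (H0curl_le_Hcurl Ω hv.1) (h.eq_zero_of_isNedOn_zero fun T hT => ?_)
  obtain ⟨a, b, hab⟩ := hv.2 T hT
  have hedge : ∀ E ∈ edges 𝒯, E ⊆ T →
      dot (nedField a b (o.tail E)) (toC (o.head E - o.tail E)) = 0 := by
    intro E hE hET
    by_cases hEi : E ∈ interiorEdges 𝒯
    · obtain ⟨a', b', hab', hm⟩ := hmean E hEi T hT hET
      obtain ⟨rfl, rfl⟩ := h.isNedOn_unique hT hab hab'
      rw [integral_dot_nedField_lineMap o hE _ _ 0, AffineMap.lineMap_apply_zero] at hm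
      rw [← edgeLength_smul_tangent o hE, toC_smul, dot_smul_right, ← hm, mul_zero]
    · exact dot_tangent_eq_zero_of_boundary o hopen hint hE hEi hv hT hET hab
  have h0 : a = 0 ∧ b = 0 := by
    refine (𝒯.isTet hT).eq_zero_of_dot_edge fun x hx y hy hxy => ?_
    have hE : ({x, y} : Finset R3) ∈ edges 𝒯 :=
      mem_edges.2 ⟨T, hT, Finset.insert_subset hx (Finset.singleton_subset_iff.2 hy),
        Finset.card_pair hxy⟩
    have h1 := hedge _ hE (Finset.insert_subset hx (Finset.singleton_subset_iff.2 hy))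
    have ht := o.tail_mem hE
    have hh := o.head_mem hE
    have hne := o.tail_ne_head hE
    rw [Finset.mem_insert, Finset.mem_singleton] at ht hh
    rcases ht with ht | ht <;> rcases hh with hh | hh <;> rw [ht, hh] at h1 hne
    · exact absurd rfl hne
    · exact h1
    · rw [dot_nedField_sub_eq, ← neg_sub x y, toC_neg, ← neg_one_smul ℂ, dot_smul_right, h1,
        mul_zero]
    · exact absurd rfl hne
  rwa [h0.1, h0.2] at hab

/-! ### The Falk-Winther operator is a projection -/

open Classical in
/-- The conditions that select `edgeBasis` can be met, so the selected field satisfies them. -/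
theorem edgeBasis_spec (hopen : IsOpen Ω) (hbdd : Bornology.IsBounded Ω)
    (hint : interior (closure Ω) ⊆ Ω) (hE : E ∈ interiorEdges 𝒯) :
    edgeBasis o E ∈ coarse 𝒯 ∧ ∀ E' ∈ interiorEdges 𝒯,
      HasEdgeMean o E' Ω (edgeBasis o E : CurlPair Ω).fst (if E' = E then 1 else 0) := by
  obtain ⟨p, hp, hpm⟩ := exists_edgeBasis o hopen hbdd hint hE
  have hex : ∃ ψ : H0curl Ω, ψ ∈ coarse 𝒯 ∧ ∀ E' ∈ interiorEdges 𝒯,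
      HasEdgeMean o E' Ω (ψ : CurlPair Ω).fst (if E' = E then 1 else 0) :=
    ⟨⟨p, hp.1⟩, hp, fun E' hE' => by convert hpm E' hE'⟩
  exact Classical.epsilon_spec hex

/-- The expansion of a field of the coarse space in the edge basis. -/
theorem eq_sum_edgeBasis (hopen : IsOpen Ω) (hbdd : Bornology.IsBounded Ω)
    (hint : interior (closure Ω) ⊆ Ω) {u : H0curl Ω} (hu : u ∈ coarse 𝒯) {m : Finset R3 → ℂ}
    (hm : ∀ E ∈ interiorEdges 𝒯, HasEdgeMean o E Ω (u : CurlPair Ω).fst (m E)) :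
    ∑ E ∈ interiorEdges 𝒯, m E • edgeBasis o E = u := by
  classical
  have hb := fun E (hE : E ∈ interiorEdges 𝒯) => edgeBasis_spec o hopen hbdd hint hE
  let b : Finset R3 → CurlPair Ω := fun E => edgeBasis o E
  have hbN : ∀ E ∈ interiorEdges 𝒯, b E ∈ nedelec 𝒯.cells (H0curl Ω) := fun E hE => (hb E hE).1
  have hsum : (u : CurlPair Ω) - ∑ E ∈ interiorEdges 𝒯, m E • b E = 0 := by
    have hd : (u : CurlPair Ω) - ∑ E ∈ interiorEdges 𝒯, m E • b E ∈ nedelec 𝒯.cells (H0curl Ω) :=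
      Submodule.sub_mem _ hu (Submodule.sum_mem _ fun E hE => Submodule.smul_mem _ _ (hbN E hE))
    refine eq_zero_of_hasEdgeMean_zero o hopen hint hd fun E' hE' => ?_
    obtain ⟨θ, hθ, hp⟩ := exists_lineMap_mem hopen o hE'
    obtain ⟨μ, hμ⟩ := (isPatch_domain 𝒯 hopen hint).exists_edgeMean o
      (mem_edges_of_mem_interiorEdges hE') hθ hp
    have hle : ∀ {q : CurlPair Ω}, q ∈ nedelec 𝒯.cells (H0curl Ω) →
        q ∈ nedelec 𝒯.cells (Hcurl Ω) := fun hq => ⟨H0curl_le_Hcurl Ω hq.1, hq.2⟩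
    let B : Finset R3 → nedelec 𝒯.cells (Hcurl Ω) := fun E =>
      if hE : E ∈ interiorEdges 𝒯 then ⟨b E, hle (hbN E hE)⟩ else 0
    have hBb : ∀ E (hE : E ∈ interiorEdges 𝒯), B E = ⟨b E, hle (hbN E hE)⟩ := fun E hE =>
      dif_pos hE
    have hB : ∀ E ∈ interiorEdges 𝒯, (B E : CurlPair Ω) = b E := fun E hE => by rw [hBb E hE]
    have hμB : ∀ E ∈ interiorEdges 𝒯, μ (B E) = if E' = E then 1 else 0 := fun E hE => by
      refine ((hμ (B E) _).1 ?_).symm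
      rw [hB E hE]
      convert (hb E hE).2 E' hE'
    have hμu : μ ⟨u, hle hu⟩ = m E' := ((hμ ⟨u, hle hu⟩ _).1 (hm E' hE')).symm
    have e : (u : CurlPair Ω) - ∑ E ∈ interiorEdges 𝒯, m E • b E
        = ((⟨u, hle hu⟩ - ∑ E ∈ interiorEdges 𝒯, m E • B E : nedelec 𝒯.cells (Hcurl Ω)) :
          CurlPair Ω) := by
      rw [Submodule.coe_sub, Submodule.coe_sum]
      congr 1
      exact Finset.sum_congr rfl fun E hE => by rw [Submodule.coe_smul, hB E hE]
    have hs : ∑ E ∈ interiorEdges 𝒯, μ (m E • B E)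
        = ∑ E ∈ interiorEdges 𝒯, if E' = E then m E else 0 :=
      Finset.sum_congr rfl fun E hE => by
        rw [map_smul, hμB E hE, smul_eq_mul, mul_ite, mul_one, mul_zero]
    rw [e, hμ, map_sub, map_sum, hμu, hs, Finset.sum_ite_eq, if_pos hE', sub_self]
  refine Subtype.ext ?_
  rw [Submodule.coe_sum]
  exact (sub_eq_zero.1 hsum).symm

/-- The Falk-Winther operator is a continuous projection onto the coarse space. -/
theorem exists_falkWintherCLM (hopen : IsOpen Ω) (hbdd : Bornology.IsBounded Ω)
    (hint : interior (closure Ω) ⊆ Ω) :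
    ∃ π : H0curl Ω →L[ℂ] H0curl Ω, (∀ u, π u = falkWinther o u) ∧ (∀ u, π u ∈ coarse 𝒯) ∧
      ∀ u ∈ coarse 𝒯, π u = u := by
  choose! m hm hmean using fun E (hE : E ∈ interiorEdges 𝒯) =>
    exists_coefficientCLM o hopen hint hE
  have hπ : ∀ u, (∑ E ∈ interiorEdges 𝒯, (m E).smulRight (edgeBasis o E)) u
      = ∑ E ∈ interiorEdges 𝒯, m E u • edgeBasis o E := fun u => by
    rw [sum_apply]
    rfl
  refine ⟨∑ E ∈ interiorEdges 𝒯, (m E).smulRight (edgeBasis o E), fun u => ?_, fun u => ?_,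
    fun u hu => ?_⟩
  · rw [hπ, falkWinther_eq o hm]
  · rw [hπ]
    exact Submodule.sum_mem _ fun E hE =>
      Submodule.smul_mem _ _ (edgeBasis_spec o hopen hbdd hint hE).1
  · rw [hπ]
    exact eq_sum_edgeBasis o hopen hbdd hint hu fun E hE => hmean E hE u hu

end Unisolvence

end CurlLOD

end

theorem mainTheorem7 (Ω : Set CurlLOD.R3) (hopen : IsOpen Ω) (hbdd : Bornology.IsBounded Ω)
    (hcontr : ContractibleSpace Ω) (hlip : CurlLOD.HasLipschitzBoundary Ω)
    (𝒯 : CurlLOD.TetMesh Ω) (o : CurlLOD.EdgeOrientation 𝒯) (c : CurlLOD.Coefficients Ω)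
    (hell : ∃ α : ℝ, 0 < α ∧ ∀ v : CurlLOD.H0curl Ω, α * ‖v‖ ^ 2 ≤ ‖CurlLOD.form c v v‖) :
    (∀ (f : CurlLOD.Hdiv Ω) (u : CurlLOD.H0curl Ω),
      (∀ ψ : CurlLOD.H0curl Ω, CurlLOD.form c u ψ
        = inner ℂ (ψ : CurlLOD.CurlPair Ω).fst (f : CurlLOD.DivPair Ω).fst) →
      ∀ w : CurlLOD.H0curl Ω,
        (w ∈ CurlLOD.coarse 𝒯 ∧ ∀ v ∈ CurlLOD.coarse 𝒯,
          CurlLOD.form c ↑(w + CurlLOD.corrector o c w) ↑(v + CurlLOD.correctorAdj o c v)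
            = inner ℂ
                ((v + CurlLOD.correctorAdj o c v : CurlLOD.H0curl Ω) : CurlLOD.CurlPair Ω).fst
                (f : CurlLOD.DivPair Ω).fst)
          ↔ w = CurlLOD.falkWinther o u) ∧
    ∃ a : CurlLOD.coarse 𝒯 →ₗ[ℂ] CurlLOD.coarse 𝒯 →ₗ⋆[ℂ] ℂ,
      (∀ v w : CurlLOD.coarse 𝒯, a v w
        = CurlLOD.form c ↑((v : CurlLOD.H0curl Ω) + CurlLOD.corrector o c v)
            ↑((w : CurlLOD.H0curl Ω) + CurlLOD.correctorAdj o c w)) ∧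
      ∃ α' : ℝ, 0 < α' ∧ ∀ v : CurlLOD.coarse 𝒯, α' * ‖v‖ ^ 2 ≤ ‖a v v‖ := by
  have hint := CurlLOD.interior_closure_subset_of_lipschitz hopen hlip
  exact (CurlLOD.exists_falkWintherCLM o hopen hbdd hint).elim fun π hπ =>
    CurlLOD.corrected_problem_of_projection o c hell π hπ.1 hπ.2.1 hπ.2.2
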